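/- Fix the following conventions. An instance $\mathcal P$ of $\mathrm{CGTDS}^F$ consists of a rational discount factor $0<\lambda<1$, a rational target $t$, finitely many rational weights, and a regular expression $e$ over the weights. A solution of $\mathcal P$ is a finite (possibly empty) sequence $w=w(0)w(1)\cdots w(n-1)$ of weights that belongs to the language of $e$ and satisfies $\sum_{i=0}^{n-1}w(i)\lambda^i=t$; its length is $n$. An instance of $\mathrm{GTDS}^F$ is the same without $e$ (all finite sequences of weights are allowed), and an instance of $\mathrm{TDS}^F$ is an instance of $\mathrm{GTDS}^F$ with two weights $a,b$. Rational numbers are given to algorithms as fractions in binary. The length $|e|$ is the number of letters and of symbols $\emptyset,\varepsilon,+,{}^*$ in $e$ (concatenation and parentheses are not counted). **Theorem.** (1) The problem whether a given instance of $\mathrm{CGTDS}^F$ has a solution is decidable in PSPACE; so are the corresponding problems for $\mathrm{GTDS}^F$ and $\mathrm{TDS}^F$. (2) Let $\mathcal P$ be an instance of $\mathrm{CGTDS}^F$ with $\lambda=\frac pq$ ($p,q\in\mathbb N$), $t=\frac cd$ ($c\in\mathbb Z$, $d\in\mathbb N$, $d\ge 1$) and weights $a_1<a_2<\dots<a_k$,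 $k\ge 1$, not all equal to $0$, with a common denominator $m\ge 1$ (so $m a_i\in\mathbb Z$ for all $i$). If $\mathcal P$ has a solution, then it has a solution of length at most $$4\cdot d(q-p)\cdot(|e|+2)\cdot\max(|a_k|,|a_1|)\cdot\frac{\lambda m}{1-\lambda}.$$ For instances of $\mathrm{GTDS}^F$ the same holds with $|e|$ replaced by $0$, also if the only weight is $0$. -/

import Mathlib

/-! ### Polynomial space -/

/-- The space occupied by a configuration of a multi-stack Turing machine: the total number of
symbols stored on its (finitely many) stacks, the input stack included. -/
def spaceUsed (tm : Turing.FinTM2) (c : tm.Cfg) : ℕ :=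
  letI := tm.kFin
  ∑ k, (Turing.TM2.Cfg.stk c k).length

/-- The decision problem `P` on instances of type `α`, presented to the machine as words over the
alphabet `Γ` through the encoding `enc`, is decidable in PSPACE: there are a deterministic
multi-stack Turing machine with finite stack alphabets and a polynomial `s` such that, started on
the encoding of any instance `x`, the machine only passes through configurations of space at most
`s (length of the encoding)`, and it halts with the correct answer to `P x` (one Boolean symbol)
on its output stack. -/
def DecidableInPSPACE {α Γ : Type} (enc : α → List Γ) (P : α → Prop) : Prop :=
  ∃ (M : Turing.TM2ComputableAux Γ Bool) (s : Polynomial ℕ),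
    (∀ k, Finite (M.tm.Γ k)) ∧
    ∀ x : α,
      (∀ c, StateTransition.Reaches M.tm.step
          (Turing.initList M.tm ((enc x).map M.inputAlphabet.symm)) c →
        spaceUsed M.tm c ≤ s.eval (enc x).length) ∧
      ∃ (answer : Bool) (c : M.tm.Cfg),
        c ∈ StateTransition.eval M.tm.step
          (Turing.initList M.tm ((enc x).map M.inputAlphabet.symm)) ∧
        Turing.TM2.Cfg.stk c M.tm.k₁ = [M.outputAlphabet.symm answer] ∧
        (answer = true ↔ P x)

/-! ### The target discounted-sum problems over finite sequences -/

/-- The discounted sum `∑ w(i) λ ^ i` of a finite sequence (`0` for the empty sequence). -/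
def discountedSum (lam : ℚ) (w : List ℚ) : ℚ :=
  ∑ i : Fin w.length, w.get i * lam ^ (i : ℕ)

/-- An instance of the target discounted-sum problem over finite sequences: a rational discount
factor in `(0, 1)`, a rational target and two rational weights. -/
structure TDSF where
  disc : ℚ
  disc_pos : 0 < disc
  disc_lt_one : disc < 1
  target : ℚ
  a : ℚ
  b : ℚ

/-- An instance of the generalized target discounted-sum problem over finite sequences:
arbitrarily many rational weights. -/
structure GTDSF where
  disc : ℚ
  disc_pos : 0 < disc
  disc_lt_one : disc < 1
  target : ℚ
  weights : List ℚ

/-- An instance of the constrained generalized target discounted-sum problem over finite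
sequences: additionally a regular expression, whose letters are weights. -/
structure CGTDSF extends GTDSF where
  constraint : RegularExpression ℚ

/-- `w ∈ {a, b}*` has discounted sum equal to the target. -/
def TDSF.IsSolution (P : TDSF) (w : List ℚ) : Prop :=
  (∀ x ∈ w, x = P.a ∨ x = P.b) ∧ discountedSum P.disc w = P.target

/-- `w` is a finite sequence of weights whose discounted sum equals the target. -/
def GTDSF.IsSolution (P : GTDSF) (w : List ℚ) : Prop :=
  (∀ x ∈ w, x ∈ P.weights) ∧ discountedSum P.disc w = P.target

/-- `w` is a finite sequence of weights whose discounted sum equals the target and which belongs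
to the language of the constraint. -/
def CGTDSF.IsSolution (P : CGTDSF) (w : List ℚ) : Prop :=
  P.toGTDSF.IsSolution w ∧ w ∈ P.constraint.matches'

/-- The length `|e|` of a regular expression: the number of its letters and of its symbols
`∅`, `ε`, `+`, `*`. Concatenation is juxtaposition and, like parentheses, is not counted. -/
def regexLength {α : Type} : RegularExpression α → ℕ
  | .zero => 1
  | .epsilon => 1
  | .char _ => 1
  | .plus e f => regexLength e + regexLength f + 1
  | .comp e f => regexLength e + regexLength f
  | .star e => regexLength e + 1

/-! ### Binary encoding of the instances -/

/-- The input alphabet. -/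
inductive InputSymbol
  | bit (b : Bool)
  | minus
  | slash
  | sep
  | hash
  | letter
  | empty
  | eps
  | plus
  | comp
  | star
  deriving DecidableEq

/-- A natural number in binary, least significant digit first. -/
def encodeNat (n : ℕ) : List InputSymbol :=
  n.bits.map InputSymbol.bit

/-- A rational number: an optional minus sign, then numerator and denominator in binary. -/
def encodeRat (x : ℚ) : List InputSymbol :=
  (if x < 0 then [InputSymbol.minus] else []) ++ encodeNat x.num.natAbs ++ [InputSymbol.slash] ++
    encodeNat x.den ++ [InputSymbol.sep]

/-- A regular expression in Polish (prefix) notation. -/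
def encodeRegex : RegularExpression ℚ → List InputSymbol
  | .zero => [InputSymbol.empty]
  | .epsilon => [InputSymbol.eps]
  | .char x => InputSymbol.letter :: encodeRat x
  | .plus e f => InputSymbol.plus :: (encodeRegex e ++ encodeRegex f)
  | .comp e f => InputSymbol.comp :: (encodeRegex e ++ encodeRegex f)
  | .star e => InputSymbol.star :: encodeRegex e

def TDSF.encode (P : TDSF) : List InputSymbol :=
  encodeRat P.disc ++ encodeRat P.target ++ encodeRat P.a ++ encodeRat P.b

def GTDSF.encode (P : GTDSF) : List InputSymbol :=
  encodeRat P.disc ++ encodeRat P.target ++ P.weights.flatMap encodeRat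

def CGTDSF.encode (P : CGTDSF) : List InputSymbol :=
  P.toGTDSF.encode ++ [InputSymbol.hash] ++ encodeRegex P.constraint

/-!
# Target discounted-sum problems over finite sequences

*Remainders.* Let `remainder lam t w` be what is left of the target `t` after the word `w`,
rescaled by the discount factor. A word `w` has discounted sum `t` if and only if its remainder is
`0`. Read forwards, the denominators of the remainders only collect powers of the numerator of
`lam`; read backwards from the end of a solution, only powers of its denominator. As the two are
coprime, all remainders of a solution are multiples of one number `1 / (d * m)`
(`exists_int_mul_remainder`). They are also bounded, being discounted sums of suffixes
(`abs_discountedSum_mul_le`). So a solution only passes through finitely many remainders.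

*Length.* The constraint `e` and its iterated partial derivatives are the states of an automaton for
`e`; there are at most `|e| + 1` of them. A shortest solution never repeats a pair of a state and a
remainder, which gives the bound (`exists_short_solution`).

*Space.* The number of remainders is exponential, so a single remainder fits into polynomial space.
Whether some word of `e` leads from one remainder to another is a game with polynomially many
rounds: for a concatenation, the first player names the remainder in the middle and the second
player chooses the half to be verified; for a star, paths of length `2 ^ k` are halved in the same
way, as in Savitch's theorem; at a letter, one equation is checked. Soundness and completeness of
the game are `exists_word_of_gameValue` and `gameValue_of_word`. The game is evaluated by traversing
its tree depth first, remembering only the moves on the current branch (`PSpace.gameValue`).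

*Machines.* The computation is carried out by structured programs over counters (`CounterProg`).
Each stack of the Turing machine, except one for output and carries, stores one counter as a numeral
in bijective base 12, so that the input word itself is the initial value of a counter, and the space
needed is logarithmic in the counters (`CounterProg.decidableInPSPACE`). The class `PSpace` of the functions that such programs compute
with numbers of polynomially many bits is closed under composition and under iteration with small
intermediate results; everything else is assembled from these. The problem without a constraint is
reduced to the constrained one with the constraint `(x₁ + ⋯ + xₙ)*`.
-/

/-! ### Discounted sums and remainders -/

theorem discountedSum_nil (lam : ℚ) : discountedSum lam [] = 0 := rfl

theorem discountedSum_cons (lam x : ℚ) (w : List ℚ) :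
    discountedSum lam (x :: w) = x + lam * discountedSum lam w := by
  have h : discountedSum lam (x :: w) =
      ∑ i : Fin (w.length + 1), (x :: w).get i * lam ^ (i : ℕ) := rfl
  rw [h, Fin.sum_univ_succ, discountedSum, Finset.mul_sum]
  congr 1
  · simp
  · refine Finset.sum_congr rfl fun i _ => ?_
    show w.get i * lam ^ ((i : ℕ) + 1) = _
    ring

/-- What is left of the target `u` after the weights `w` have been played, rescaled so that the next
weight counts fully. -/
def remainder (lam u : ℚ) (w : List ℚ) : ℚ := w.foldl (fun u x => (u - x) / lam) u

@[simp] theorem remainder_nil (lam u : ℚ) : remainder lam u [] = u := rfl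

@[simp] theorem remainder_cons (lam u x : ℚ) (w : List ℚ) :
    remainder lam u (x :: w) = remainder lam ((u - x) / lam) w := rfl

theorem remainder_append (lam u : ℚ) (w v : List ℚ) :
    remainder lam u (w ++ v) = remainder lam (remainder lam u w) v := List.foldl_append

theorem eq_discountedSum_add_remainder {lam : ℚ} (hlam : lam ≠ 0) (u : ℚ) (w : List ℚ) :
    u = discountedSum lam w + lam ^ w.length * remainder lam u w := by
  induction w generalizing u with
  | nil => simp [discountedSum_nil]
  | cons x w ih =>
    rw [remainder_cons, discountedSum_cons, List.length_cons, pow_succ]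
    have h := ih ((u - x) / lam)
    rw [div_eq_iff hlam] at h
    linear_combination h

theorem remainder_eq_zero_iff {lam : ℚ} (hlam : lam ≠ 0) (u : ℚ) (w : List ℚ) :
    remainder lam u w = 0 ↔ discountedSum lam w = u := by
  have h := eq_discountedSum_add_remainder hlam u w
  constructor
  · intro h0; rw [h0] at h; linarith
  · intro h0
    have : lam ^ w.length * remainder lam u w = 0 := by linarith
    exact (mul_eq_zero.1 this).resolve_left (pow_ne_zero _ hlam)

theorem abs_discountedSum_mul_le {lam A : ℚ} (h0 : 0 < lam) (h1 : lam < 1) (w : List ℚ)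
    (hA : ∀ x ∈ w, |x| ≤ A) :
    |discountedSum lam w| * (1 - lam) ≤ A * (1 - lam ^ w.length) := by
  induction w with
  | nil => simp [discountedSum_nil]
  | cons x w ih =>
    have h2 := ih fun y hy => hA y (by simp [hy])
    have h3 := hA x (by simp)
    rw [discountedSum_cons, List.length_cons, pow_succ]
    have h4 : |x + lam * discountedSum lam w| ≤ |x| + lam * |discountedSum lam w| :=
      (abs_add_le _ _).trans (by rw [abs_mul, abs_of_pos h0])
    have h5 : 0 < 1 - lam := by linarith
    nlinarith [mul_le_mul_of_nonneg_right h4 h5.le, mul_le_mul_of_nonneg_right h3 h5.le,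
      mul_le_mul_of_nonneg_left h2 h0.le]

/-- The values which a solution passes through lie on a fixed grid: forwards, only powers of the
numerator of the discount factor can enter the denominator, and backwards only powers of its
denominator. -/
theorem exists_int_mul_remainder {lam t : ℚ} (hlam : 0 < lam) {m d : ℕ} (w v : List ℚ)
    (hm : 0 < m) (ht : ∃ z : ℤ, d * t = z) (hw : ∀ x ∈ w ++ v, ∃ z : ℤ, m * x = z)
    (h0 : remainder lam t (w ++ v) = 0) :
    ∃ z : ℤ, d * m * remainder lam t w = z := by
  have hp : (lam.num : ℚ) ≠ 0 := by exact_mod_cast (Rat.num_pos.2 hlam).ne'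
  have hq : (lam.den : ℚ) ≠ 0 := by exact_mod_cast lam.den_nz
  have hpq : lam = lam.num / lam.den := (Rat.num_div_den lam).symm
  -- read forwards, each step divides by `lam`, which adds one power of its numerator to the
  -- denominator of the remainder
  have h1 : ∃ z : ℤ, d * m * (lam.num : ℚ) ^ w.length * remainder lam t w = z := by
    have gen : ∀ (w : List ℚ) (u : ℚ) (k : ℕ), (∀ x ∈ w, ∃ z : ℤ, m * x = z) →
        (∃ z : ℤ, d * m * (lam.num : ℚ) ^ k * u = z) →
        ∃ z : ℤ, d * m * (lam.num : ℚ) ^ (k + w.length) * remainder lam u w = z := by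
      intro w
      induction w with
      | nil => intro u k _ hu; simpa using hu
      | cons x w ih =>
        intro u k hx ⟨z, hz⟩
        obtain ⟨y, hy⟩ := hx x (by simp)
        have := ih ((u - x) / lam) (k + 1) (fun x' hx' => hx x' (by simp [hx']))
          ⟨lam.den * (z - d * lam.num ^ k * y), by
            have : (u - x) / lam = (u - x) * lam.den / lam.num := by
              conv_lhs => rw [hpq]
              field_simp
            rw [this, pow_succ]
            push_cast
            rw [← hz, ← hy]
            field_simp⟩
        rw [remainder_cons, List.length_cons, show k + (w.length + 1) = k + 1 + w.length by ring]
        exact this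
    obtain ⟨z, hz⟩ := ht
    have := gen w t 0 (fun x hx => hw x (by simp [hx])) ⟨m * z, by push_cast; rw [← hz]; ring⟩
    simpa using this
  -- read backwards, the remainder is a discounted sum, whose denominator only involves powers of
  -- the denominator of `lam`
  have h2 : ∃ z : ℤ, m * (lam.den : ℚ) ^ v.length * remainder lam t w = z := by
    rw [remainder_append, remainder_eq_zero_iff hlam.ne'] at h0
    rw [← h0]
    have hv : ∀ x ∈ v, ∃ z : ℤ, m * x = z := fun x hx => hw x (by simp [hx])
    clear h0 h1 hw
    induction v with
    | nil => exact ⟨0, by simp [discountedSum_nil]⟩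
    | cons x v ih =>
      obtain ⟨y, hy⟩ := hv x (by simp)
      obtain ⟨z, hz⟩ := ih fun x' hx' => hv x' (by simp [hx'])
      refine ⟨lam.den ^ (v.length + 1) * y + lam.num * z, ?_⟩
      rw [discountedSum_cons, List.length_cons]
      push_cast
      rw [← hy, ← hz]
      have : (lam.num : ℚ) = lam * lam.den := (Rat.mul_den_eq_num lam).symm
      rw [this]
      ring
  obtain ⟨y, hy⟩ := h1
  obtain ⟨z, hz⟩ := h2
  have hcop : IsCoprime (lam.num ^ w.length) ((lam.den : ℤ) ^ v.length) := by
    apply IsCoprime.pow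
    rw [Int.isCoprime_iff_gcd_eq_one]
    simpa [Int.gcd] using lam.reduced
  obtain ⟨a, b, hab⟩ := hcop
  refine ⟨a * y + b * d * z, ?_⟩
  have hab' : (a : ℚ) * (lam.num : ℚ) ^ w.length + b * (lam.den : ℚ) ^ v.length = 1 := by
    exact_mod_cast hab
  push_cast
  rw [← hy, ← hz]
  linear_combination (-(d : ℚ) * m * remainder lam t w) * hab'

/-! ### The length of shortest solutions -/

section Automata
variable {σ : Type} (δ : σ → ℚ → σ → Prop)

/-- The automaton with the transition relation `δ` can go from the first to the second state
reading the word. -/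
def Run : σ → List ℚ → σ → Prop
  | s, [], s' => s = s'
  | s, x :: w, s' => ∃ s₁, δ s x s₁ ∧ Run s₁ w s'

theorem run_append (s s' : σ) (w v : List ℚ) :
    Run δ s (w ++ v) s' ↔ ∃ s₁, Run δ s w s₁ ∧ Run δ s₁ v s' := by
  induction w generalizing s with
  | nil => simp [Run]
  | cons x w ih =>
    simp only [List.cons_append, Run, ih]
    constructor
    · rintro ⟨s₁, h1, s₂, h2, h3⟩; exact ⟨s₂, ⟨s₁, h1, h2⟩, h3⟩
    · rintro ⟨s₂, ⟨s₁, h1, h2⟩, h3⟩; exact ⟨s₁, h1, s₂, h2, h3⟩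

theorem Run.mem {δ : σ → ℚ → σ → Prop} {S : Finset σ} (hS : ∀ s ∈ S, ∀ x s', δ s x s' → s' ∈ S)
    {s s' : σ} {w : List ℚ} (h : Run δ s w s') (hs : s ∈ S) : s' ∈ S := by
  induction w generalizing s with
  | nil => exact h ▸ hs
  | cons x w ih =>
    obtain ⟨s₁, h1, h2⟩ := h
    exact ih h2 (hS s hs x s₁ h1)

/-- A shortest solution never passes twice through the same state with the same remainder; as the
possible remainders are multiples of `1 / (d * m)` in an open interval of half-length `N`, this
bounds its length. -/
theorem exists_short_solution {lam t : ℚ} (h0 : 0 < lam) (h1 : lam < 1) {m d N : ℕ} (hm : 0 < m)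
    (hd : 0 < d) (ht : ∃ z : ℤ, d * t = z) {X : Set ℚ} (hX : ∀ x ∈ X, ∃ z : ℤ, m * x = z) {A : ℚ}
    (hA : ∀ x ∈ X, |x| ≤ A) (hA0 : 0 < A) (hN : d * m * A ≤ N * (1 - lam))
    {δ : σ → ℚ → σ → Prop} {S : Finset σ} (hS : ∀ s ∈ S, ∀ x s', δ s x s' → s' ∈ S) {s₀ : σ}
    (hs₀ : s₀ ∈ S) {F : Set σ}
    (h : ∃ w, (∀ x ∈ w, x ∈ X) ∧ discountedSum lam w = t ∧ ∃ s ∈ F, Run δ s₀ w s) :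
    ∃ w, ((∀ x ∈ w, x ∈ X) ∧ discountedSum lam w = t ∧ ∃ s ∈ F, Run δ s₀ w s) ∧
      w.length ≤ 2 * N * S.card := by
  classical
  let Q : List ℚ → Prop := fun w =>
    (∀ x ∈ w, x ∈ X) ∧ discountedSum lam w = t ∧ ∃ s ∈ F, Run δ s₀ w s
  have hex : ∃ n w, Q w ∧ w.length = n := by
    obtain ⟨w, hw⟩ := h
    exact ⟨_, w, hw, rfl⟩
  obtain ⟨w, ⟨hwX, hwt, s, hsF, hrun⟩, hlen⟩ := Nat.find_spec hex
  have hmin : ∀ v, Q v → w.length ≤ v.length := fun v hv => by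
    rw [hlen]; exact Nat.find_min' hex ⟨v, hv, rfl⟩
  refine ⟨w, ⟨hwX, hwt, s, hsF, hrun⟩, ?_⟩
  have hst : ∀ i, ∃ s', Run δ s₀ (w.take i) s' ∧ Run δ s' (w.drop i) s := fun i => by
    rw [← run_append, List.take_append_drop]; exact hrun
  choose st hst1 hst2 using hst
  have hwt' : remainder lam t w = 0 := (remainder_eq_zero_iff h0.ne' t w).2 hwt
  have hint : ∀ i, ∃ z : ℤ, d * m * remainder lam t (w.take i) = z := fun i =>
    exists_int_mul_remainder h0 (w.take i) (w.drop i) hm ht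
      (by rw [List.take_append_drop]; exact fun x hx => hX x (hwX x hx))
      (by rw [List.take_append_drop]; exact hwt')
  choose z hz using hint
  have hzN : ∀ i, z i ∈ Finset.Ioo (-(N : ℤ)) N := by
    intro i
    have hr : remainder lam t (w.take i) = discountedSum lam (w.drop i) := by
      rw [eq_comm, ← remainder_eq_zero_iff h0.ne', ← remainder_append, List.take_append_drop]
      exact hwt'
    have habs := abs_discountedSum_mul_le h0 h1 (w.drop i)
      (fun x hx => hA x (hwX x (List.mem_of_mem_drop hx)))
    rw [← hr] at habs
    have hpow : 0 < lam ^ (w.drop i).length := pow_pos h0 _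
    have hdm : (0 : ℚ) < d * m := by positivity
    have hlt : |(z i : ℚ)| < N := by
      have h2 : |(z i : ℚ)| = d * m * |remainder lam t (w.take i)| := by
        rw [← hz i, abs_mul, abs_of_pos hdm]
      have h3 : |remainder lam t (w.take i)| * (1 - lam) < A := by nlinarith
      have h4 : |(z i : ℚ)| * (1 - lam) < N * (1 - lam) := by
        rw [h2, mul_assoc]
        exact (mul_lt_mul_of_pos_left h3 hdm).trans_le hN
      exact lt_of_mul_lt_mul_right h4 (by linarith)
    rw [abs_lt] at hlt
    rw [Finset.mem_Ioo]
    exact ⟨by exact_mod_cast hlt.1, by exact_mod_cast hlt.2⟩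
  have hinj : Set.InjOn (fun i => (z i, st i)) (Finset.range (w.length + 1)) := by
    have key : ∀ i j, i < j → j ≤ w.length → (z i, st i) ≠ (z j, st j) := by
      intro i j hij hj heq
      rw [Prod.mk.injEq] at heq
      have hrem : remainder lam t (w.take i) = remainder lam t (w.take j) := by
        have h2 := hz i
        rw [heq.1, ← hz j] at h2
        exact mul_left_cancel₀ (by positivity) h2
      have hv : Q (w.take i ++ w.drop j) := by
        refine ⟨fun x hx => ?_, ?_, s, hsF, ?_⟩
        · rcases List.mem_append.1 hx with hx | hx
          · exact hwX x (List.mem_of_mem_take hx)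
          · exact hwX x (List.mem_of_mem_drop hx)
        · rw [← remainder_eq_zero_iff h0.ne', remainder_append, hrem, ← remainder_append,
            List.take_append_drop]
          exact hwt'
        · rw [run_append]
          exact ⟨st i, hst1 i, heq.2 ▸ hst2 j⟩
      have := hmin _ hv
      rw [List.length_append, List.length_take, List.length_drop] at this
      omega
    intro i hi j hj heq
    simp only [Finset.coe_range, Set.mem_Iio] at hi hj
    rcases lt_trichotomy i j with h | h | h
    · exact absurd heq (key i j h (by omega))
    · exact h
    · exact absurd heq.symm (key j i h (by omega))
  have hcard := Finset.card_le_card_of_injOn (t := Finset.Ioo (-(N : ℤ)) N ×ˢ S) _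
    (fun i _ => Finset.mem_product.2 ⟨hzN i, (hst1 i).mem hS hs₀⟩) hinj
  rw [Finset.card_range, Finset.card_product, Int.card_Ioo] at hcard
  refine (Nat.le_succ _).trans (hcard.trans (Nat.mul_le_mul_right _ ?_))
  omega

end Automata

/-! ### Partial derivatives of regular expressions -/

namespace RegularExpression
variable {α : Type}

/-- The partial derivatives of a regular expression with respect to a letter. -/
def partialDeriv : RegularExpression α → α → Set (RegularExpression α)
  | .zero, _ => ∅
  | .epsilon, _ => ∅
  | .char b, a => {r | r = .epsilon ∧ a = b}
  | .plus e f, a => partialDeriv e a ∪ partialDeriv f a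
  | .comp e f, a =>
    (fun r => .comp r f) '' partialDeriv e a ∪ {r | [] ∈ e.matches' ∧ r ∈ partialDeriv f a}
  | .star e, a => (fun r => .comp r (.star e)) '' partialDeriv e a

theorem cons_mem_mul {L M : Language α} {a : α} {w : List α} :
    a :: w ∈ L * M ↔ (∃ u v, a :: u ∈ L ∧ v ∈ M ∧ u ++ v = w) ∨ [] ∈ L ∧ a :: w ∈ M := by
  rw [Language.mem_mul]
  constructor
  · rintro ⟨u, hu, v, hv, h⟩
    rcases u with _ | ⟨b, u⟩
    · right; exact ⟨hu, by simpa using h ▸ hv⟩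
    · rw [List.cons_append, List.cons.injEq] at h
      obtain ⟨rfl, rfl⟩ := h
      exact Or.inl ⟨u, v, hu, hv, rfl⟩
  · rintro (⟨u, v, hu, hv, rfl⟩ | ⟨h1, h2⟩)
    · exact ⟨a :: u, hu, v, hv, rfl⟩
    · exact ⟨[], h1, a :: w, h2, rfl⟩

/-- The partial derivatives describe what may follow a given first letter. -/
theorem cons_mem_matches'_iff (e : RegularExpression α) (a : α) (w : List α) :
    a :: w ∈ e.matches' ↔ ∃ r ∈ e.partialDeriv a, w ∈ r.matches' := by
  induction e generalizing w with
  | zero => simp [partialDeriv, matches', Language.notMem_zero]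
  | epsilon => simp [partialDeriv, matches', Language.mem_one]
  | char b =>
    simp only [partialDeriv, Set.mem_ofPred_eq, matches']
    constructor
    · intro h
      have h' : a :: w = [b] := h
      rw [List.cons.injEq] at h'
      exact ⟨_, ⟨rfl, h'.1⟩, h'.2⟩
    · rintro ⟨r, ⟨rfl, rfl⟩, h⟩
      have h' : w = [] := h
      exact h' ▸ rfl
  | plus e f ihe ihf =>
    show a :: w ∈ e.matches' + f.matches' ↔ _
    rw [Language.mem_add, ihe, ihf]
    simp only [partialDeriv, Set.mem_union]
    constructor
    · rintro (⟨r, h1, h2⟩ | ⟨r, h1, h2⟩)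
      exacts [⟨r, Or.inl h1, h2⟩, ⟨r, Or.inr h1, h2⟩]
    · rintro ⟨r, h1 | h1, h2⟩
      exacts [Or.inl ⟨r, h1, h2⟩, Or.inr ⟨r, h1, h2⟩]
  | comp e f ihe ihf =>
    show a :: w ∈ e.matches' * f.matches' ↔ _
    rw [cons_mem_mul, ihf]
    simp only [ihe, partialDeriv]
    constructor
    · rintro (⟨u, v, ⟨r, h1, h2⟩, hv, rfl⟩ | ⟨h0, r, h1, h2⟩)
      · exact ⟨_, Or.inl ⟨r, h1, rfl⟩, Language.append_mem_mul h2 hv⟩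
      · exact ⟨r, Or.inr ⟨h0, h1⟩, h2⟩
    · rintro ⟨_, ⟨r, h1, rfl⟩ | ⟨h0, h1⟩, h2⟩
      · obtain ⟨u, hu, v, hv, rfl⟩ := Language.mem_mul.1 (show w ∈ r.matches' * f.matches' from h2)
        exact Or.inl ⟨u, v, ⟨r, h1, hu⟩, hv, rfl⟩
      · exact Or.inr ⟨h0, _, h1, h2⟩
  | star e ihe =>
    show a :: w ∈ KStar.kstar e.matches' ↔ _
    simp only [partialDeriv]
    constructor
    · intro h
      obtain ⟨L, hL, hmem⟩ := Language.mem_kstar_iff_exists_nonempty.1 h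
      rcases L with _ | ⟨u, L⟩
      · simp at hL
      · obtain ⟨hu1, hu2⟩ := hmem u (by simp)
        rcases u with _ | ⟨b, u⟩
        · exact absurd rfl hu2
        · rw [List.flatten_cons, List.cons_append, List.cons.injEq] at hL
          obtain ⟨rfl, rfl⟩ := hL
          obtain ⟨r, hr, hur⟩ := (ihe u).1 hu1
          refine ⟨_, ⟨r, hr, rfl⟩, Language.append_mem_mul hur ?_⟩
          exact Language.join_mem_kstar fun y hy => (hmem y (by simp [hy])).1
    · rintro ⟨_, ⟨r, hr, rfl⟩, h⟩
      obtain ⟨u, hu, v, hv, rfl⟩ :=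
        Language.mem_mul.1 (show w ∈ r.matches' * KStar.kstar e.matches' from h)
      have h1 := (ihe u).2 ⟨r, hr, hu⟩
      obtain ⟨L, rfl, hL⟩ := Language.mem_kstar.1 hv
      exact Language.join_mem_kstar (L := (a :: u) :: L) fun y hy => by
        rcases List.mem_cons.1 hy with rfl | hy
        exacts [h1, hL y hy]

open Classical in
/-- A finite set containing all iterated partial derivatives. -/
noncomputable def partialDerivs : RegularExpression α → Finset (RegularExpression α)
  | .zero => ∅
  | .epsilon => ∅
  | .char _ => {.epsilon}
  | .plus e f => partialDerivs e ∪ partialDerivs f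
  | .comp e f => (partialDerivs e).image (fun r => .comp r f) ∪ partialDerivs f
  | .star e => (partialDerivs e).image fun r => .comp r (.star e)

/-- Concatenations need not be counted, as they contribute no derivatives of their own. -/
theorem card_partialDerivs_le (e : RegularExpression α) :
    e.partialDerivs.card ≤ regexLength e := by
  classical
  induction e with
  | zero => simp [partialDerivs]
  | epsilon => simp [partialDerivs]
  | char => simp [partialDerivs, regexLength]
  | plus e f ihe ihf =>
    exact (Finset.card_union_le _ _).trans ((Nat.add_le_add ihe ihf).trans (Nat.le_succ _))
  | comp e f ihe ihf =>
    exact (Finset.card_union_le _ _).trans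
      (Nat.add_le_add (Finset.card_image_le.trans ihe) ihf)
  | star e ihe => exact Finset.card_image_le.trans (ihe.trans (Nat.le_succ _))

theorem partialDeriv_subset (e : RegularExpression α) (a : α) :
    e.partialDeriv a ⊆ e.partialDerivs := by
  classical
  induction e with
  | zero => simp [partialDeriv]
  | epsilon => simp [partialDeriv]
  | char => rintro _ ⟨rfl, -⟩; simp [partialDerivs]
  | plus e f ihe ihf =>
    rintro r (h | h)
    · exact Finset.mem_union_left _ (ihe h)
    · exact Finset.mem_union_right _ (ihf h)
  | comp e f ihe ihf =>
    rintro r (⟨r, h, rfl⟩ | ⟨-, h⟩)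
    · exact Finset.mem_union_left _ (Finset.mem_image_of_mem _ (ihe h))
    · exact Finset.mem_union_right _ (ihf h)
  | star e ihe =>
    rintro _ ⟨r, h, rfl⟩
    exact Finset.mem_image_of_mem _ (ihe h)

theorem partialDerivs_closed (e r r' : RegularExpression α) (a : α) (hr : r ∈ e.partialDerivs)
    (h : r' ∈ r.partialDeriv a) : r' ∈ e.partialDerivs := by
  classical
  induction e generalizing r r' with
  | zero => simp [partialDerivs] at hr
  | epsilon => simp [partialDerivs] at hr
  | char =>
    rw [partialDerivs, Finset.mem_singleton] at hr
    subst hr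
    exact absurd h (Set.notMem_empty _)
  | plus e f ihe ihf =>
    rcases Finset.mem_union.1 hr with hr | hr
    · exact Finset.mem_union_left _ (ihe r r' hr h)
    · exact Finset.mem_union_right _ (ihf r r' hr h)
  | comp e f ihe ihf =>
    rcases Finset.mem_union.1 hr with hr | hr
    · obtain ⟨s, hs, rfl⟩ := Finset.mem_image.1 hr
      rcases h with ⟨s', hs', rfl⟩ | ⟨-, h⟩
      · exact Finset.mem_union_left _ (Finset.mem_image_of_mem _ (ihe s s' hs hs'))
      · exact Finset.mem_union_right _ (partialDeriv_subset f a h)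
    · exact Finset.mem_union_right _ (ihf r r' hr h)
  | star e ihe =>
    obtain ⟨s, hs, rfl⟩ := Finset.mem_image.1 hr
    rcases h with ⟨s', hs', rfl⟩ | ⟨-, h⟩
    · exact Finset.mem_image_of_mem _ (ihe s s' hs hs')
    · obtain ⟨s', hs', rfl⟩ := h
      exact Finset.mem_image_of_mem _ (partialDeriv_subset e a hs')

end RegularExpression

/-- The partial derivatives are the states of an automaton for the language of the expression; the
accepting states are the expressions that contain the empty word. -/
theorem mem_matches'_iff_run (e : RegularExpression ℚ) (w : List ℚ) :
    w ∈ e.matches' ↔ ∃ r ∈ {r : RegularExpression ℚ | [] ∈ r.matches'},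
      Run (fun r x r' => r' ∈ r.partialDeriv x) e w r := by
  induction w generalizing e with
  | nil => simp [Run]
  | cons x w ih =>
    rw [RegularExpression.cons_mem_matches'_iff]
    simp only [ih, Run]
    constructor
    · rintro ⟨r, hr, r', hr', h⟩; exact ⟨r', hr', r, hr, h⟩
    · rintro ⟨r', hr', r, hr, h⟩; exact ⟨r, hr, r', hr', h⟩

/-- The bound of the theorem, as `2 * N * L` for a natural number `N` which is large enough for
`exists_short_solution`. -/
theorem exists_grid_bound {k : ℕ} {a : Fin (k + 1) → ℚ} (ha : StrictMono a) {lam : ℚ}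
    (h0 : 0 < lam) (h1 : lam < 1) {p q d m : ℕ} (hpq : lam = p / q) (hm : 0 < m)
    (hint : ∀ i, ∃ z : ℤ, a i = z / m) (hne : ∃ i, a i ≠ 0) :
    0 < max |a (Fin.last k)| |a 0| ∧ (∀ i, |a i| ≤ max |a (Fin.last k)| |a 0|) ∧
    ∃ N : ℕ, (d * m * max |a (Fin.last k)| |a 0| ≤ N * (1 - lam)) ∧
      ∀ L : ℚ, 2 * N * L = 4 * (d * (q - p)) * L * max |a (Fin.last k)| |a 0| *
        (lam * m / (1 - lam)) := by
  set A := max |a (Fin.last k)| |a 0| with hA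
  have hle : ∀ i, |a i| ≤ A := by
    intro i
    have hlast : a i ≤ a (Fin.last k) := ha.monotone (Fin.le_last i)
    have hzero : a 0 ≤ a i := ha.monotone (Fin.zero_le i)
    rw [abs_le]
    have h2 := le_max_left |a (Fin.last k)| |a 0|
    have h3 := le_max_right |a (Fin.last k)| |a 0|
    have h4 := le_abs_self (a (Fin.last k))
    have h5 := neg_abs_le (a 0)
    constructor <;> linarith
  obtain ⟨i₀, hi₀⟩ := hne
  have hApos : 0 < A := (abs_pos.2 hi₀).trans_le (hle i₀)
  have hm' : (0 : ℚ) < m := by exact_mod_cast hm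
  obtain ⟨M, hM⟩ : ∃ M : ℕ, (M : ℚ) = m * A := by
    have hj : ∃ j, A = |a j| := by
      rcases max_choice |a (Fin.last k)| |a 0| with h | h
      exacts [⟨_, h⟩, ⟨_, h⟩]
    obtain ⟨j, hj⟩ := hj
    obtain ⟨z, hz⟩ := hint j
    refine ⟨z.natAbs, ?_⟩
    rw [hj, hz, abs_div, abs_of_pos hm', mul_div_cancel₀ _ hm'.ne', Nat.cast_natAbs]
    push_cast
    rfl
  have hq : (q : ℚ) ≠ 0 := by
    rintro h
    rw [hpq, h, div_zero] at h0
    exact lt_irrefl _ h0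
  have hq0 : (0 : ℚ) < q := lt_of_le_of_ne (by positivity) (Ne.symm hq)
  have hp0 : 0 < p := by
    rcases Nat.eq_zero_or_pos p with rfl | h
    · simp [hpq] at h0
    · exact h
  have hlt : p < q := by
    rw [hpq, div_lt_one hq0] at h1
    exact_mod_cast h1
  have hp1 : (1 : ℚ) ≤ p := by exact_mod_cast hp0
  have hqp1 : (1 : ℚ) ≤ q - p := by
    have : (p : ℚ) + 1 ≤ q := by exact_mod_cast hlt
    linarith
  have hlamq : (1 - lam) * q = q - p := by rw [hpq]; field_simp
  have hlamq' : lam * q = p := by rw [hpq]; field_simp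
  refine ⟨hApos, hle, 2 * d * p * M, ?_, fun L => ?_⟩
  · -- `q ≤ 2 * p * (q - p)`, since `p` and `q - p` are at least `1`
    have h2 : (q : ℚ) ≤ 2 * p * (q - p) := by nlinarith
    have hdm : (0 : ℚ) ≤ d * m * A := by positivity
    push_cast
    rw [hM, ← mul_le_mul_iff_left₀ hq0]
    calc (d : ℚ) * m * A * q ≤ d * m * A * (2 * p * (q - p)) := mul_le_mul_of_nonneg_left h2 hdm
      _ = 2 * d * p * (m * A) * (1 - lam) * q := by rw [mul_assoc _ (1 - lam), hlamq]; ring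
  · have h3 : lam * m / (1 - lam) = p * m / (q - p) := by
      rw [div_eq_div_iff (by linarith) (by linarith), ← hlamq, ← hlamq']
      ring
    have h4 : (q : ℚ) - p ≠ 0 := by linarith
    push_cast
    rw [h3, hM]
    field_simp
    ring

theorem mem_weights_iff {k : ℕ} {a : Fin (k + 1) → ℚ} {l : List ℚ} (h : l = List.ofFn a) {x : ℚ} :
    x ∈ l ↔ ∃ i, a i = x := by rw [h, List.mem_ofFn']; rfl

theorem CGTDSF.exists_short_solution (P : CGTDSF) (k : ℕ) (a : Fin (k + 1) → ℚ) (p q : ℕ) (c : ℤ)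
    (d m : ℕ) (ha : StrictMono a) (hw : P.weights = List.ofFn a) (hpq : P.disc = p / q)
    (hd : 0 < d) (ht : P.target = c / d) (hm : 0 < m) (hint : ∀ i, ∃ z : ℤ, a i = z / m)
    (hne : ∃ i, a i ≠ 0) (hsol : ∃ w, P.IsSolution w) :
    ∃ w, P.IsSolution w ∧
      (w.length : ℚ) ≤ 4 * (d * (q - p)) * (regexLength P.constraint + 2) *
        max |a (Fin.last k)| |a 0| * (P.disc * m / (1 - P.disc)) := by
  classical
  obtain ⟨hA, hle, N, hN, hL⟩ := exists_grid_bound (d := d) ha P.disc_pos P.disc_lt_one hpq hm hint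
    hne
  have hd' : (d : ℚ) ≠ 0 := by exact_mod_cast hd.ne'
  have hm' : (m : ℚ) ≠ 0 := by exact_mod_cast hm.ne'
  obtain ⟨w, ⟨hX, hsum, hrun⟩, hlen⟩ := _root_.exists_short_solution P.disc_pos P.disc_lt_one
    (t := P.target) hm hd
    ⟨c, by rw [ht]; field_simp⟩ (X := {x | x ∈ P.weights})
    (fun x hx => by
      obtain ⟨i, rfl⟩ := (mem_weights_iff hw).1 hx
      obtain ⟨z, hz⟩ := hint i
      exact ⟨z, by rw [hz]; field_simp⟩)
    (fun x hx => by
      obtain ⟨i, rfl⟩ := (mem_weights_iff hw).1 hx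
      exact hle i) hA hN
    (δ := fun r x r' => r' ∈ r.partialDeriv x)
    (S := insert P.constraint P.constraint.partialDerivs)
    (fun s hs x s' hs' => by
      refine Finset.mem_insert_of_mem ?_
      rcases Finset.mem_insert.1 hs with rfl | hs
      · exact RegularExpression.partialDeriv_subset _ x hs'
      · exact RegularExpression.partialDerivs_closed _ _ _ x hs hs')
    (s₀ := P.constraint) (Finset.mem_insert_self _ _)
    (F := {r : RegularExpression ℚ | [] ∈ r.matches'})
    (by
      obtain ⟨w, ⟨hX, hsum⟩, hmem⟩ := hsol
      exact ⟨w, hX, hsum, (mem_matches'_iff_run _ _).1 hmem⟩)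
  refine ⟨w, ⟨⟨hX, hsum⟩, (mem_matches'_iff_run _ _).2 hrun⟩, ?_⟩
  rw [← hL]
  have hcard : (insert P.constraint P.constraint.partialDerivs).card ≤
      regexLength P.constraint + 2 :=
    (Finset.card_insert_le _ _).trans
      ((Nat.succ_le_succ (RegularExpression.card_partialDerivs_le _)).trans (Nat.le_succ _))
  exact_mod_cast hlen.trans (Nat.mul_le_mul_left _ hcard)

/-- Without a constraint, an automaton with a single state suffices. -/
theorem GTDSF.exists_short_solution (P : GTDSF) (k : ℕ) (a : Fin (k + 1) → ℚ) (p q : ℕ) (c : ℤ)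
    (d m : ℕ) (ha : StrictMono a) (hw : P.weights = List.ofFn a) (hpq : P.disc = p / q)
    (hd : 0 < d) (ht : P.target = c / d) (hm : 0 < m) (hint : ∀ i, ∃ z : ℤ, a i = z / m)
    (hsol : ∃ w, P.IsSolution w) :
    ∃ w, P.IsSolution w ∧
      (w.length : ℚ) ≤ 4 * (d * (q - p)) * 2 *
        max |a (Fin.last k)| |a 0| * (P.disc * m / (1 - P.disc)) := by
  by_cases hne : ∃ i, a i ≠ 0
  · obtain ⟨hA, hle, N, hN, hL⟩ := exists_grid_bound (d := d) ha P.disc_pos P.disc_lt_one hpq hm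
      hint hne
    have hd' : (d : ℚ) ≠ 0 := by exact_mod_cast hd.ne'
    have hm' : (m : ℚ) ≠ 0 := by exact_mod_cast hm.ne'
    obtain ⟨w, ⟨hX, hsum, -⟩, hlen⟩ := _root_.exists_short_solution P.disc_pos P.disc_lt_one
      (t := P.target) hm hd
      ⟨c, by rw [ht]; field_simp⟩ (X := {x | x ∈ P.weights})
      (fun x hx => by
        obtain ⟨i, rfl⟩ := (mem_weights_iff hw).1 hx
        obtain ⟨z, hz⟩ := hint i
        exact ⟨z, by rw [hz]; field_simp⟩)
      (fun x hx => by
        obtain ⟨i, rfl⟩ := (mem_weights_iff hw).1 hx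
        exact hle i) hA hN
      (δ := fun (_ : Unit) _ _ => True) (S := Finset.univ) (fun _ _ _ _ _ => Finset.mem_univ _)
      (s₀ := ()) (Finset.mem_univ _) (F := Set.univ)
      (by
        obtain ⟨w, hX, hsum⟩ := hsol
        refine ⟨w, hX, hsum, (), Set.mem_univ _, ?_⟩
        clear hX hsum
        induction w with
        | nil => rfl
        | cons x w ih => exact ⟨(), trivial, ih⟩)
    refine ⟨w, ⟨hX, hsum⟩, ?_⟩
    rw [← hL]
    have : w.length ≤ 2 * N * 2 := hlen.trans (Nat.mul_le_mul_left _ (by simp))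
    exact_mod_cast this
  · -- all weights are zero, and then the target is zero
    push Not at hne
    obtain ⟨w, hX, hsum⟩ := hsol
    have hzero : discountedSum P.disc w = 0 := by
      clear hsum
      induction w with
      | nil => rfl
      | cons x w ih =>
        obtain ⟨i, hi⟩ := (mem_weights_iff hw).1 (hX x (by simp))
        rw [discountedSum_cons, ih fun y hy => hX y (by simp [hy]), ← hi, hne i]
        ring
    refine ⟨[], ⟨by simp, by rw [← hsum, hzero]; rfl⟩, ?_⟩
    simp [hne]

/-! ### Counter programs -/

/-- Programs over counters indexed by `ℕ`. -/
inductive CounterProg : Type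
  | skip : CounterProg
  | inc (r : ℕ) : CounterProg
  | dec (r : ℕ) : CounterProg
  | seq (p q : CounterProg) : CounterProg
  | loop (r : ℕ) (p : CounterProg) : CounterProg

namespace CounterProg

/-- Big-step semantics: `Exec B p s t` says that `p`, started with the counter values `s`, stops
with the values `t`, and that no increment on the way produces a value above `B`. The command
`loop r p` repeats `p` as long as counter `r` is nonzero. -/
inductive Exec (B : ℕ) : CounterProg → (ℕ → ℕ) → (ℕ → ℕ) → Prop
  | skip (s : ℕ → ℕ) : Exec B skip s s
  | inc (r : ℕ) (s : ℕ → ℕ) (h : s r + 1 ≤ B) :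
      Exec B (inc r) s (Function.update s r (s r + 1))
  | dec (r : ℕ) (s : ℕ → ℕ) : Exec B (dec r) s (Function.update s r (s r - 1))
  | seq {p q : CounterProg} {s t u : ℕ → ℕ} (h₁ : Exec B p s t) (h₂ : Exec B q t u) :
      Exec B (seq p q) s u
  | loop_zero {r : ℕ} {p : CounterProg} {s : ℕ → ℕ} (h : s r = 0) : Exec B (loop r p) s s
  | loop_step {r : ℕ} {p : CounterProg} {s t u : ℕ → ℕ} (h : s r ≠ 0) (h₁ : Exec B p s t)
      (h₂ : Exec B (loop r p) t u) : Exec B (loop r p) s u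

theorem Exec.mono {B B' : ℕ} (hB : B ≤ B') {p : CounterProg} {s t : ℕ → ℕ} (h : Exec B p s t) :
    Exec B' p s t := by
  induction h with
  | skip s => exact .skip s
  | inc r s h => exact .inc r s (h.trans hB)
  | dec r s => exact .dec r s
  | seq _ _ ih₁ ih₂ => exact .seq ih₁ ih₂
  | loop_zero h => exact .loop_zero h
  | loop_step h _ _ ih₁ ih₂ => exact .loop_step h ih₁ ih₂

/-- All counters occurring in the program are smaller than `varBound`. -/
def varBound : CounterProg → ℕ
  | skip => 0
  | inc r => r + 1
  | dec r => r + 1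
  | seq p q => max p.varBound q.varBound
  | loop r p => max (r + 1) p.varBound

/-! ### Compilation of counter programs to stack machines -/

/-- The numeral system of the machine: bijective base `12`, least significant digit first, where
the digit `d : Fin 12` has the value `d + 1`. Every word over the twelve input symbols is a numeral,
so the input stack is a counter from the start. -/
def numeral : List (Fin 12) → ℕ
  | [] => 0
  | d :: l => d + 1 + 12 * numeral l

theorem two_pow_length_le_numeral (l : List (Fin 12)) : 2 ^ l.length ≤ numeral l + 1 := by
  induction l with
  | nil => simp [numeral]
  | cons d l ih => simp only [List.length_cons, pow_succ, numeral]; omega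

theorem numeral_lt (l : List (Fin 12)) : numeral l < 16 ^ (l.length + 1) := by
  have h : numeral l + 2 ≤ 16 ^ (l.length + 1) := by
    induction l with
    | nil => simp [numeral]
    | cons d l ih => rw [List.length_cons, pow_succ]; simp only [numeral]; omega
  omega

theorem length_le_size_numeral (l : List (Fin 12)) : l.length ≤ Nat.size (numeral l) := by
  have h := two_pow_length_le_numeral l
  have h2 := Nat.lt_size_self (numeral l)
  exact (Nat.pow_le_pow_iff_right (by norm_num : 1 < 2)).1 (h.trans h2)

theorem numeral_replicate_max_append (k : ℕ) (l l' : List (Fin 12))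
    (h : numeral l' = numeral l + 1) :
    numeral (List.replicate k 0 ++ l') = numeral (List.replicate k 11 ++ l) + 1 := by
  induction k with
  | zero => simpa using h
  | succ k ih =>
    simp only [List.replicate_succ, List.cons_append, numeral, ih]
    simp
    ring

/-- The labels of the machine code of a program. -/
def Label : CounterProg → Type
  | skip => Unit
  | inc _ => Bool
  | dec _ => Bool
  | seq p q => Label p ⊕ Label q
  | loop _ p => Option (Label p)

instance instFintypeLabel : (p : CounterProg) → Fintype (Label p)
  | skip => inferInstanceAs (Fintype Unit)
  | inc _ => inferInstanceAs (Fintype Bool)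
  | dec _ => inferInstanceAs (Fintype Bool)
  | seq p q =>
    letI := instFintypeLabel p
    letI := instFintypeLabel q
    inferInstanceAs (Fintype (Label p ⊕ Label q))
  | loop _ p =>
    letI := instFintypeLabel p
    inferInstanceAs (Fintype (Option (Label p)))

/-- The label at which the code of a program starts. -/
def entry : (p : CounterProg) → Label p
  | skip => ()
  | inc _ => false
  | dec _ => false
  | seq p _ => Sum.inl (entry p)
  | loop _ _ => none

/-- The stack alphabets: the stack `none` holds bits (it is the output stack, and the scratch stack
of the arithmetic), the stack `some i` holds counter `i` as a numeral. -/
abbrev Alphabet (R : ℕ) : Option (Fin R) → Type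
  | none => Bool
  | some _ => Fin 12

open Turing.TM2 in
/-- The code of a program, as a fragment of a machine with labels `Λ`: the labels of the fragment
are placed into `Λ` by `emb`, and the fragment is left through the label `exit`.

An increment pops maximal digits, remembering their number on the stack `none`, then adds one to
the next digit and puts back as many minimal digits; a decrement is dual. The internal state is the
symbol read last. -/
def compile {R : ℕ} [NeZero R] {Λ : Type} : (p : CounterProg) → (emb : Label p → Λ) →
    (exit : Λ) → Label p → Stmt (Alphabet R) Λ (Option (Fin 12))
  | skip, _, exit, _ => .goto fun _ => exit
  | inc r, emb, _, false =>
    .pop (some (Fin.ofNat R r)) (fun _ a => a) <|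
      .branch (fun v => v == some 11)
        (.push none (fun _ => false) (.goto fun _ => emb false))
        (.push (some (Fin.ofNat R r)) (fun v => v.elim (0 : Fin 12) fun d => d + 1)
          (.goto fun _ => emb true))
  | inc r, emb, exit, true =>
    .pop none (fun _ a => a.map fun _ => 0) <|
      .branch Option.isSome
        (.push (some (Fin.ofNat R r)) (fun _ => (0 : Fin 12)) (.goto fun _ => emb true))
        (.goto fun _ => exit)
  | dec r, emb, _, false =>
    .pop (some (Fin.ofNat R r)) (fun _ a => a) <|
      .branch (fun v => v == some 0)
        (.push none (fun _ => false) (.goto fun _ => emb false))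
        (.branch Option.isSome
          (.push (some (Fin.ofNat R r)) (fun v => (v.elim (0 : Fin 12) fun d => d - 1))
            (.goto fun _ => emb true))
          (.pop none (fun v _ => v) (.goto fun _ => emb true)))
  | dec r, emb, exit, true =>
    .pop none (fun _ a => a.map fun _ => 0) <|
      .branch Option.isSome
        (.push (some (Fin.ofNat R r)) (fun _ => (11 : Fin 12)) (.goto fun _ => emb true))
        (.goto fun _ => exit)
  | seq p q, emb, _, Sum.inl l => compile p (emb ∘ Sum.inl) (emb (Sum.inr (entry q))) l
  | seq _ q, emb, exit, Sum.inr l => compile q (emb ∘ Sum.inr) exit l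
  | loop r p, emb, exit, none =>
    .peek (some (Fin.ofNat R r)) (fun _ a => a) <|
      .branch Option.isSome (.goto fun _ => emb (some (entry p))) (.goto fun _ => exit)
  | loop _ p, emb, _, some l => compile p (emb ∘ some) (emb none) l

/-- Reachability through configurations all of whose stacks have height at most `h` (the first
configuration excepted). -/
def ReachesWithin {K Λ σ : Type} [DecidableEq K] {Γ : K → Type} (M : Λ → Turing.TM2.Stmt Γ Λ σ)
    (h : ℕ) : Turing.TM2.Cfg Γ Λ σ → Turing.TM2.Cfg Γ Λ σ → Prop :=
  Relation.ReflTransGen fun c c' => c' ∈ Turing.TM2.step M c ∧ ∀ k, (c'.stk k).length ≤ h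

/-- The stacks `S` represent the counter values `s`. -/
def Represents {R : ℕ} (S : ∀ k, List (Alphabet R k)) (s : ℕ → ℕ) : Prop :=
  S none = [] ∧ ∀ i : Fin R, numeral (S (some i)) = s i

theorem Represents.update {R : ℕ} {S : ∀ k, List (Alphabet R k)} {s : ℕ → ℕ}
    (h : Represents S s) (i : Fin R) {l : List (Fin 12)} {n : ℕ} (hl : numeral l = n) :
    Represents (Function.update S (some i) l) (Function.update s i n) := by
  refine ⟨by rw [Function.update_of_ne (by simp)]; exact h.1, fun j => ?_⟩
  by_cases hj : j = i
  · subst hj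
    rw [Function.update_self, Function.update_self]
    exact hl
  · rw [Function.update_of_ne (by simpa using hj),
      Function.update_of_ne (by simpa [Fin.val_inj] using hj)]
    exact h.2 j

end CounterProg

namespace CounterProg
variable {R : ℕ}

/-- The stacks `S`, with the stack of counter `i` replaced by `l` and `j` symbols on the scratch
stack. -/
def withWork (S : ∀ k, List (Alphabet R k)) (i : Fin R) (l : List (Fin 12)) (j : ℕ) :
    ∀ k, List (Alphabet R k)
  | none => List.replicate j false
  | some i' => if i' = i then l else S (some i')

theorem withWork_self (S : ∀ k, List (Alphabet R k)) (i : Fin R) (h : S none = []) :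
    withWork S i (S (some i)) 0 = S := by
  funext k
  rcases k with _ | i'
  · simp [withWork, h]
  · by_cases hi : i' = i
    · subst hi; simp [withWork]
    · simp [withWork, hi]

@[simp] theorem update_some_withWork (S : ∀ k, List (Alphabet R k)) (i : Fin R)
    (l l' : List (Fin 12)) (j : ℕ) :
    Function.update (withWork S i l j) (some i) l' = withWork S i l' j := by
  funext k
  rcases k with _ | i'
  · rw [Function.update_of_ne (by simp)]; rfl
  · by_cases hi : i' = i
    · subst hi; rw [Function.update_self]; simp [withWork]
    · rw [Function.update_of_ne (by simpa using hi)]; simp [withWork, hi]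

@[simp] theorem update_none_withWork (S : ∀ k, List (Alphabet R k)) (i : Fin R)
    (l : List (Fin 12)) (j j' : ℕ) :
    Function.update (withWork S i l j) none (List.replicate j' false) = withWork S i l j' := by
  funext k
  rcases k with _ | i'
  · rw [Function.update_self]; rfl
  · rw [Function.update_of_ne (by simp)]; rfl

theorem withWork_some (S : ∀ k, List (Alphabet R k)) (i : Fin R) (l : List (Fin 12)) (j : ℕ) :
    withWork S i l j (some i) = l := by simp [withWork]

theorem withWork_none (S : ∀ k, List (Alphabet R k)) (i : Fin R) (l : List (Fin 12)) (j : ℕ) :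
    withWork S i l j none = List.replicate j false := rfl

theorem Represents.withWork {S : ∀ k, List (Alphabet R k)} {s : ℕ → ℕ}
    (h : Represents S s) (i : Fin R) {l : List (Fin 12)} {n : ℕ} (hl : numeral l = n) :
    Represents (withWork S i l 0) (Function.update s i n) := by
  have h2 := h.update i hl
  rwa [← withWork_self S i h.1, update_some_withWork] at h2

theorem withWork_length_le {S : ∀ k, List (Alphabet R k)} {h : ℕ}
    (hS : ∀ i, (S (some i)).length ≤ h) (i : Fin R) {l : List (Fin 12)} {j : ℕ} (hl : l.length ≤ h)
    (hj : j ≤ h) (k : Option (Fin R)) : (CounterProg.withWork S i l j k).length ≤ h := by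
  rcases k with _ | i'
  · simpa [CounterProg.withWork] using hj
  · by_cases hi : i' = i
    · subst hi; simpa [CounterProg.withWork] using hl
    · simpa [CounterProg.withWork, hi] using hS i'

theorem ReachesWithin.head {K Λ σ : Type} [DecidableEq K] {Γ : K → Type}
    {M : Λ → Turing.TM2.Stmt Γ Λ σ} {h : ℕ} {c c' c'' : Turing.TM2.Cfg Γ Λ σ}
    (h₁ : Turing.TM2.step M c = some c') (hl : ∀ k, (c'.stk k).length ≤ h)
    (h₂ : ReachesWithin M h c' c'') : ReachesWithin M h c c'' :=
  Relation.ReflTransGen.head ⟨h₁, hl⟩ h₂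

theorem ReachesWithin.single {K Λ σ : Type} [DecidableEq K] {Γ : K → Type}
    {M : Λ → Turing.TM2.Stmt Γ Λ σ} {h : ℕ} {c c' : Turing.TM2.Cfg Γ Λ σ}
    (h₁ : Turing.TM2.step M c = some c') (hl : ∀ k, (c'.stk k).length ≤ h) :
    ReachesWithin M h c c' :=
  .head h₁ hl .refl

theorem ReachesWithin.trans {K Λ σ : Type} [DecidableEq K] {Γ : K → Type}
    {M : Λ → Turing.TM2.Stmt Γ Λ σ} {h : ℕ} {c c' c'' : Turing.TM2.Cfg Γ Λ σ}
    (h₁ : ReachesWithin M h c c') (h₂ : ReachesWithin M h c' c'') : ReachesWithin M h c c'' :=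
  Relation.ReflTransGen.trans h₁ h₂

/-- Every word splits into a block of digits `a` and a rest which does not start with `a`. -/
theorem exists_replicate_append {α : Type} (a : α) (l : List α) :
    ∃ (k : ℕ) (m : List α), l = List.replicate k a ++ m ∧ m.head? ≠ some a := by
  induction l with
  | nil => exact ⟨0, [], by simp⟩
  | cons b l ih =>
    by_cases hb : b = a
    · obtain ⟨k, m, rfl, hm⟩ := ih
      exact ⟨k + 1, m, by simp [hb, List.replicate_succ], hm⟩
    · exact ⟨0, b :: l, by simp, by simpa using hb⟩

section
variable {Λ : Type} {M : Λ → Turing.TM2.Stmt (Alphabet R) Λ (Option (Fin 12))}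

/-- The second phase of an increment or decrement: the scratch stack is emptied, and for each
of its symbols a digit `d` is pushed. -/
theorem reachesWithin_flush {h : ℕ} {S : ∀ k, List (Alphabet R k)}
    (hS : ∀ i, (S (some i)).length ≤ h) (i : Fin R) (d : Fin 12) (a b : Λ)
    (hM : M a = .pop none (fun _ a => a.map fun _ => 0) (.branch Option.isSome
        (.push (some i) (fun _ => d) (.goto fun _ => a)) (.goto fun _ => b)))
    (j : ℕ) (l : List (Fin 12)) (v : Option (Fin 12)) (hlen : l.length + j ≤ h) :
    ReachesWithin M h ⟨some a, v, withWork S i l j⟩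
      ⟨some b, none, withWork S i (List.replicate j d ++ l) 0⟩ := by
  induction j generalizing l v with
  | zero =>
    refine .single ?_ (withWork_length_le hS i (by simpa using hlen) (by omega))
    have h2 := update_none_withWork S i l 0 0
    simp only [Turing.TM2.step, hM, Turing.TM2.stepAux, withWork_none]
    simp only [List.replicate_zero] at h2
    simp [h2]
  | succ j ih =>
    have := ih (d :: l) (some 0) (by simp only [List.length_cons]; omega)
    rw [List.replicate_succ', List.append_assoc]
    refine .head ?_ ?_ this
    · simp only [Turing.TM2.step, hM, Turing.TM2.stepAux, withWork_none]
      have h2 := update_none_withWork S i l (j+1) j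
      simp [List.replicate_succ, h2, withWork_some]
    · exact withWork_length_le hS i (by simp only [List.length_cons]; omega) (by omega)

/-- The first phase of an increment or decrement: a block of digits `d` is moved to the scratch
stack. -/
theorem reachesWithin_collect {h : ℕ} {S : ∀ k, List (Alphabet R k)}
    (hS : ∀ i, (S (some i)).length ≤ h) (i : Fin R) (d : Fin 12) (a : Λ)
    {q : Turing.TM2.Stmt (Alphabet R) Λ (Option (Fin 12))}
    (hM : M a = .pop (some i) (fun _ a => a) (.branch (fun v => v == some d)
        (.push none (fun _ => false) (.goto fun _ => a)) q))
    (k j : ℕ) (l : List (Fin 12)) (v : Option (Fin 12)) (hlen : l.length + k + j ≤ h) :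
    ∃ v', ReachesWithin M h ⟨some a, v, withWork S i (List.replicate k d ++ l) j⟩
      ⟨some a, v', withWork S i l (j + k)⟩ := by
  induction k generalizing j v with
  | zero => exact ⟨v, .refl⟩
  | succ k ih =>
    obtain ⟨v', hv⟩ := ih (j + 1) (some d) (by omega)
    refine ⟨v', .head ?_ ?_ (by rwa [show j + (k + 1) = j + 1 + k by ring])⟩
    · simp only [Turing.TM2.step, hM, Turing.TM2.stepAux]
      have h2 := update_none_withWork S i (List.replicate k d ++ l) j (j + 1)
      simp only [List.replicate_succ] at h2
      simp [List.replicate_succ, withWork_some, withWork_none, h2]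
    · exact withWork_length_le hS i
        (by simp only [List.length_append, List.length_replicate]; omega) (by omega)

/-- An increment adds one with carry; it needs room for one more digit. -/
theorem reachesWithin_inc [NeZero R] {h : ℕ} {S : ∀ k, List (Alphabet R k)} (i : Fin R)
    (hS : ∀ i, (S (some i)).length ≤ h) (h0 : S none = []) (hi : (S (some i)).length + 1 ≤ h)
    (emb : Bool → Λ) (b : Λ)
    (hM : ∀ l, M (emb l) = compile (.inc i) emb b l) (v : Option (Fin 12)) :
    ∃ v' l, numeral l = numeral (S (some i)) + 1 ∧
      ReachesWithin M h ⟨some (emb false), v, S⟩ ⟨some b, v', withWork S i l 0⟩ := by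
  obtain ⟨k, m, hl, hm⟩ := exists_replicate_append (11 : Fin 12) (S (some i))
  have hM1 := hM false
  have hM2 := hM true
  have hr : Fin.ofNat R i = i := by simp
  simp only [compile] at hM1 hM2
  rw [hr] at hM1 hM2
  have hlen : m.length + k + 1 ≤ h := by
    rw [hl, List.length_append, List.length_replicate] at hi; omega
  obtain ⟨v1, h1⟩ := reachesWithin_collect hS i 11 (emb false) hM1 k 0 m v (by omega)
  rw [← hl, withWork_self S i h0] at h1
  obtain ⟨m', hm', hlen', h2⟩ : ∃ m', numeral m' = numeral m + 1 ∧ m'.length ≤ m.length + 1 ∧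
      ∃ v2, ReachesWithin M h ⟨some (emb false), v1, withWork S i m (0 + k)⟩
        ⟨some (emb true), v2, withWork S i m' k⟩ := by
    rcases m with _ | ⟨d, m⟩
    · refine ⟨[0], by simp [numeral], by simp, none, .single ?_
        (withWork_length_le hS i (by simp; omega) (by omega))⟩
      simp only [Turing.TM2.step, hM1, Turing.TM2.stepAux]
      simp [withWork_some]
    · have hd : d ≠ 11 := by simpa using hm
      have hd' : ((d + 1 : Fin 12) : ℕ) = d + 1 :=
        (by decide : ∀ d : Fin 12, d ≠ 11 → ((d + 1 : Fin 12) : ℕ) = d + 1) d hd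
      refine ⟨(d + 1) :: m, by simp only [numeral, hd']; ring, by simp, some d, .single ?_
        (withWork_length_le hS i (by simp at hlen ⊢; omega) (by omega))⟩
      simp only [Turing.TM2.step, hM1, Turing.TM2.stepAux]
      simp only [withWork_some, List.head?_cons, List.tail_cons, update_some_withWork,
        Option.elim_some, zero_add]
      have hb : (some d == some (11 : Fin 12)) = false := beq_eq_false_iff_ne.2 (by simpa using hd)
      rw [hb]; rfl
  obtain ⟨v2, h2⟩ := h2
  have h3 := reachesWithin_flush hS i 0 (emb true) b hM2 k m' v2 (by omega)
  exact ⟨none, _, by rw [hl]; exact numeral_replicate_max_append k m m' hm', h1.trans (h2.trans h3)⟩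

/-- A decrement subtracts one with carry; if the numeral consists of digits `0` only, it becomes
shorter. -/
theorem reachesWithin_dec [NeZero R] {h : ℕ} {S : ∀ k, List (Alphabet R k)} (i : Fin R)
    (hS : ∀ i, (S (some i)).length ≤ h) (h0 : S none = [])
    (emb : Bool → Λ) (b : Λ)
    (hM : ∀ l, M (emb l) = compile (.dec i) emb b l) (v : Option (Fin 12)) :
    ∃ v' l, numeral l = numeral (S (some i)) - 1 ∧
      ReachesWithin M h ⟨some (emb false), v, S⟩ ⟨some b, v', withWork S i l 0⟩ := by
  obtain ⟨k, m, hl, hm⟩ := exists_replicate_append (0 : Fin 12) (S (some i))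
  have hM1 := hM false
  have hM2 := hM true
  have hr : Fin.ofNat R i = i := by simp
  simp only [compile] at hM1 hM2
  rw [hr] at hM1 hM2
  have hlen : m.length + k ≤ h := by
    have hi := hS i
    rw [hl, List.length_append, List.length_replicate] at hi; omega
  obtain ⟨v1, h1⟩ := reachesWithin_collect hS i 0 (emb false) hM1 k 0 m v (by omega)
  rw [← hl, withWork_self S i h0, zero_add] at h1
  obtain ⟨m', k', hm', hlen', v2, h2⟩ : ∃ m' k',
      numeral (List.replicate k' 11 ++ m') = numeral (List.replicate k 0 ++ m) - 1 ∧
      m'.length + k' ≤ m.length + k ∧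
      ∃ v2, ReachesWithin M h ⟨some (emb false), v1, withWork S i m k⟩
        ⟨some (emb true), v2, withWork S i m' k'⟩ := by
    rcases m with _ | ⟨d, m⟩
    · refine ⟨[], k - 1, ?_, by simp, none, .single ?_
        (withWork_length_le hS i (by simp) (by simp at hlen; omega))⟩
      · rcases k with _ | k
        · rfl
        · have := numeral_replicate_max_append k [] [0] (by simp [numeral])
          rw [List.replicate_succ', List.append_assoc]
          simp only [List.append_nil, Nat.add_sub_cancel] at this ⊢
          rw [this]; rfl
      · have h2 := update_none_withWork S i [] k (k - 1)
        simp only [Turing.TM2.step, hM1, Turing.TM2.stepAux]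
        simp [withWork_some, withWork_none, h2]
    · have hd : d ≠ 0 := by simpa using hm
      have hd' : ((d - 1 : Fin 12) : ℕ) + 1 = d :=
        (by decide : ∀ d : Fin 12, d ≠ 0 → ((d - 1 : Fin 12) : ℕ) + 1 = d) d hd
      refine ⟨(d - 1) :: m, k, ?_, by simp, some d, .single ?_
        (withWork_length_le hS i (by simp at hlen ⊢; omega) (by omega))⟩
      · rw [numeral_replicate_max_append k ((d - 1) :: m) (d :: m) ?_]; · rfl
        simp only [numeral, ← hd']; ring
      · simp only [Turing.TM2.step, hM1, Turing.TM2.stepAux]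
        simp only [withWork_some, List.head?_cons, List.tail_cons, update_some_withWork,
        Option.isSome_some, Option.elim_some, cond_true]
        have hb : (some d == some (0 : Fin 12)) = false := beq_eq_false_iff_ne.2 (by simpa using hd)
        rw [hb]; rfl
  have h3 := reachesWithin_flush hS i 11 (emb true) b hM2 k' m' v2 (by omega)
  exact ⟨none, _, by rw [hl]; exact hm', h1.trans (h2.trans h3)⟩

end
end CounterProg

namespace CounterProg
variable {R : ℕ}

theorem Represents.length_le {S : ∀ k, List (Alphabet R k)} {s : ℕ → ℕ} (h : Represents S s)
    {B : ℕ} (hB : ∀ r, s r ≤ B) (i : Fin R) : (S (some i)).length ≤ Nat.size B :=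
  (length_le_size_numeral _).trans (Nat.size_le_size ((h.2 i).trans_le (hB i)))

theorem Exec.le {B : ℕ} {p : CounterProg} {s t : ℕ → ℕ} (h : Exec B p s t)
    (hs : ∀ r, s r ≤ B) : ∀ r, t r ≤ B := by
  induction h with
  | skip s => exact hs
  | inc r s h =>
    intro r'
    by_cases hr : r' = r
    · subst hr; simpa using h
    · simpa [hr] using hs r'
  | dec r s =>
    intro r'
    by_cases hr : r' = r
    · subst hr; simpa using (Nat.sub_le _ _).trans (hs r')
    · simpa [hr] using hs r'
  | seq _ _ ih₁ ih₂ => exact ih₂ (ih₁ hs)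
  | loop_zero h => exact hs
  | loop_step h _ _ ih₁ ih₂ => exact ih₂ (ih₁ hs)

/-- Correctness of the compilation: the code simulates the big-step semantics, and its stacks are
at most one symbol higher than the largest numeral. -/
theorem Exec.reachesWithin [NeZero R] {B : ℕ} {p : CounterProg} {s t : ℕ → ℕ} (hp : Exec B p s t)
    (hs : ∀ r, s r ≤ B) (hR : p.varBound ≤ R) {Λ : Type}
    {M : Λ → Turing.TM2.Stmt (Alphabet R) Λ (Option (Fin 12))} (emb : Label p → Λ) (b : Λ)
    (hM : ∀ l, M (emb l) = compile p emb b l) (v : Option (Fin 12)) (S : ∀ k, List (Alphabet R k))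
    (hS : Represents S s) :
    ∃ v' S', Represents S' t ∧
      ReachesWithin M (Nat.size B + 1) ⟨some (emb (entry p)), v, S⟩ ⟨some b, v', S'⟩ := by
  induction hp generalizing b v S with
  | skip s =>
    refine ⟨v, S, hS, .single (by rw [Turing.TM2.step, hM]; rfl) ?_⟩
    rintro (_ | i)
    · simp [hS.1]
    · exact (hS.length_le hs i).trans (Nat.le_succ _)
  | inc r s h =>
    obtain ⟨i, rfl⟩ : ∃ i : Fin R, (i : ℕ) = r := ⟨⟨r, hR⟩, rfl⟩
    obtain ⟨v', l, hl, hr⟩ := reachesWithin_inc i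
      (fun j => (hS.length_le hs j).trans (Nat.le_succ _)) hS.1
      (Nat.succ_le_succ (hS.length_le hs i)) emb b hM v
    rw [hS.2] at hl
    exact ⟨v', _, hS.withWork i hl, hr⟩
  | dec r s =>
    obtain ⟨i, rfl⟩ : ∃ i : Fin R, (i : ℕ) = r := ⟨⟨r, hR⟩, rfl⟩
    obtain ⟨v', l, hl, hr⟩ := reachesWithin_dec i
      (fun j => (hS.length_le hs j).trans (Nat.le_succ _)) hS.1 emb b hM v
    rw [hS.2] at hl
    exact ⟨v', _, hS.withWork i hl, hr⟩
  | @seq p q s t u h₁ h₂ ih₁ ih₂ =>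
    obtain ⟨v₁, S₁, hS₁, hr₁⟩ := ih₁ hs ((le_max_left _ _).trans hR) (emb ∘ Sum.inl)
      (emb (Sum.inr (entry q))) (fun l => hM (Sum.inl l)) v S hS
    obtain ⟨v₂, S₂, hS₂, hr₂⟩ := ih₂ (h₁.le hs) ((le_max_right _ _).trans hR) (emb ∘ Sum.inr)
      b (fun l => hM (Sum.inr l)) v₁ S₁ hS₁
    exact ⟨v₂, S₂, hS₂, hr₁.trans hr₂⟩
  | @loop_zero r p s h =>
    obtain ⟨i, rfl⟩ : ∃ i : Fin R, (i : ℕ) = r := ⟨⟨r, (le_max_left _ _).trans hR⟩, rfl⟩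
    have hi : Fin.ofNat R i = i := by simp
    have hM0 := hM none
    simp only [compile] at hM0
    rw [hi] at hM0
    have hnil : S (some i) = [] := by
      have := hS.2 i
      rw [h] at this
      rcases hl : S (some i) with _ | ⟨d, l⟩
      · rfl
      · rw [hl] at this; simp [numeral] at this
    refine ⟨none, S, hS, .single (c' := ⟨some b, none, S⟩) ?_ ?_⟩
    · simp only [entry, Turing.TM2.step, hM0, Turing.TM2.stepAux, hnil]
      rfl
    · rintro (_ | i)
      · simp [hS.1]
      · exact (hS.length_le hs i).trans (Nat.le_succ _)
  | @loop_step r p s t u h h₁ h₂ ih₁ ih₂ =>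
    obtain ⟨i, rfl⟩ : ∃ i : Fin R, (i : ℕ) = r := ⟨⟨r, (le_max_left _ _).trans hR⟩, rfl⟩
    have hi : Fin.ofNat R i = i := by simp
    have hM0 := hM none
    simp only [compile] at hM0
    rw [hi] at hM0
    obtain ⟨d, l, hl⟩ : ∃ d l, S (some i) = d :: l := by
      have := hS.2 i
      rcases hl : S (some i) with _ | ⟨d, l⟩
      · rw [hl] at this; exact absurd this.symm h
      · exact ⟨d, l, rfl⟩
    obtain ⟨v₁, S₁, hS₁, hr₁⟩ := ih₁ hs ((le_max_right _ _).trans hR) (emb ∘ some)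
      (emb none) (fun l => hM (some l)) (some d) S hS
    obtain ⟨v₂, S₂, hS₂, hr₂⟩ := ih₂ (h₁.le hs) hR emb b hM v₁ S₁ hS₁
    refine ⟨v₂, S₂, hS₂, .head (c' := ⟨some (emb (some (entry p))), some d, S⟩) ?_ ?_
      (hr₁.trans hr₂)⟩
    · simp only [entry, Turing.TM2.step, hM0, Turing.TM2.stepAux, hl]
      rfl
    · rintro (_ | i)
      · simp [hS.1]
      · exact (hS.length_le hs i).trans (Nat.le_succ _)

/-- The machine of a program `p`: it runs `p`, with its input in counter `0`, and then outputs
whether counter `1` is nonzero. The input stack is read as counter `0` through the identification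
`e` of the input symbols with digits. -/
def machine {Γ : Type} (e : Fin 12 ≃ Γ) (p : CounterProg) :
    Turing.TM2ComputableAux Γ Bool where
  tm :=
    { K := Option (Fin (p.varBound + 2))
      k₀ := some 0
      k₁ := none
      Γ := Alphabet (p.varBound + 2)
      Λ := Option (Label p)
      main := some (entry p)
      σ := Option (Fin 12)
      initialState := none
      Γk₀Fin := inferInstanceAs (Fintype (Fin 12))
      m := fun l => match l with
        | some l => compile p some none l
        | none => .peek (some 1) (fun _ a => a) (.push none Option.isSome .halt) }
  inputAlphabet := e
  outputAlphabet := Equiv.refl Bool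

/-- A problem is decidable in PSPACE if a program decides it with counter values of polynomially
many bits. -/
theorem decidableInPSPACE {α Γ : Type} (enc : α → List Γ) (P : α → Prop) (e : Fin 12 ≃ Γ)
    (p : CounterProg) (f : List (Fin 12) → Bool) (q : Polynomial ℕ)
    (hp : ∀ l : List (Fin 12), ∃ t, Exec (2 ^ q.eval l.length) p
      (Function.update (fun _ => 0) 0 (numeral l)) t ∧ (t 1 ≠ 0 ↔ f l = true))
    (hf : ∀ x, f ((enc x).map e.symm) = true ↔ P x) :
    DecidableInPSPACE enc P := by
  refine ⟨machine e p, Polynomial.C (p.varBound + 3) * (q + 4 * Polynomial.X + 6), ?_, fun x => ?_⟩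
  · rintro (_ | i)
    · exact inferInstanceAs (Finite Bool)
    · exact inferInstanceAs (Finite (Fin 12))
  set l : List (Fin 12) := (enc x).map e.symm with hl
  have hlen : l.length = (enc x).length := by simp [hl]
  obtain ⟨t, ht, hout⟩ := hp l
  set R := p.varBound + 2 with hR
  set n := l.length with hn
  set B := 2 ^ (q.eval n + 4 * (n + 1)) with hB
  set M := (machine e p).tm.m with hM
  set c₀ := Turing.initList (machine e p).tm l with hc₀
  have ht' : Exec B p (Function.update (fun _ => 0) 0 (numeral l)) t :=
    ht.mono (Nat.pow_le_pow_right (by norm_num) (by omega))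
  have hs : ∀ r, (Function.update (fun _ => 0) 0 (numeral l) : ℕ → ℕ) r ≤ B := by
    intro r
    by_cases hr : r = 0
    · subst hr
      rw [Function.update_self]
      have := (numeral_lt l).le
      rw [show (16 : ℕ) = 2 ^ 4 by norm_num, ← pow_mul] at this
      exact this.trans (Nat.pow_le_pow_right (by norm_num) (by omega))
    · simp [hr]
  have hrep : Represents (R := R) c₀.stk (Function.update (fun _ => 0) 0 (numeral l)) := by
    refine ⟨rfl, fun i => ?_⟩
    by_cases hi : i = 0
    · subst hi
      simp only [Fin.val_zero, Function.update_self]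
      rfl
    · have hne : (some i : Option (Fin R)) ≠ some 0 := by simpa using hi
      rw [Function.update_of_ne (show (i : ℕ) ≠ 0 from fun h => hi (Fin.ext h))]
      have : c₀.stk (some i) = [] := by
        rw [hc₀]; unfold Turing.initList; exact dif_neg hne
      rw [this]; rfl
  obtain ⟨v, S, hS, hreach⟩ := ht'.reachesWithin (R := R) (M := M) hs (by omega) some none
    (fun _ => rfl) none c₀.stk hrep
  have hlenS : ∀ k, (S k).length ≤ Nat.size B + 1 := by
    rintro (_ | i)
    · simp [hS.1]
    · exact (hS.length_le (ht'.le hs) i).trans (Nat.le_succ _)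
  set S₁ : ∀ k, List (Alphabet R k) :=
    Function.update S none ((S (some 1)).head?.isSome :: S none) with hS₁
  have hS₁none : S₁ none = [(S (some 1)).head?.isSome] := by
    rw [hS₁, Function.update_self, hS.1]
  set c₁ : (machine e p).tm.Cfg := ⟨none, (S (some 1)).head?, S₁⟩ with hc₁
  have hlast : Turing.TM2.step M ⟨some none, v, S⟩ = some c₁ := rfl
  have hall : ReachesWithin M (Nat.size B + 1) c₀ c₁ := by
    refine hreach.trans (.single hlast ?_)
    intro k
    rcases k with _ | i
    · exact (congrArg List.length hS₁none).trans_le (Nat.succ_le_succ (Nat.zero_le _))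
    · have : S₁ (some i) = S (some i) := by rw [hS₁, Function.update_of_ne (by simp)]
      exact (congrArg List.length this).trans_le (hlenS _)
  have hsize : Nat.size B = q.eval n + 4 * (n + 1) + 1 := by rw [hB, Nat.size_pow]
  have hspace : ∀ c : (machine e p).tm.Cfg, (∀ k, (c.stk k).length ≤ Nat.size B + 1) →
      spaceUsed (machine e p).tm c ≤
        (Polynomial.C (p.varBound + 3) * (q + 4 * Polynomial.X + 6)).eval (enc x).length := by
    intro c hc
    unfold spaceUsed
    refine (Finset.sum_le_card_nsmul _ _ _ fun k _ => hc k).trans ?_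
    have hcard : (Finset.univ : Finset (Option (Fin R))).card = p.varBound + 3 := by
      simp [hR]
    rw [← hlen]
    simp only [Polynomial.eval_mul, Polynomial.eval_C, Polynomial.eval_add, Polynomial.eval_X,
      Polynomial.eval_ofNat, smul_eq_mul]
    refine Nat.mul_le_mul hcard.le ?_
    omega
  constructor
  · intro c hc
    apply hspace
    have key : ∀ a : (machine e p).tm.Cfg, ReachesWithin M (Nat.size B + 1) a c₁ →
        StateTransition.Reaches (machine e p).tm.step a c →
        (∀ k, (a.stk k).length ≤ Nat.size B + 1) → ∀ k, (c.stk k).length ≤ Nat.size B + 1 := by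
      intro a ha
      induction ha using Relation.ReflTransGen.head_induction_on with
      | refl =>
        intro h h2
        rcases Relation.ReflTransGen.cases_head h with h | ⟨d, hd, -⟩
        · exact h ▸ h2
        · exact absurd hd (Option.not_mem_none d)
      | @head a b hab _ ih =>
        intro h h2
        rcases Relation.ReflTransGen.cases_head h with h | ⟨d, hd, hdc⟩
        · exact h ▸ h2
        · obtain rfl : d = b := Option.mem_unique hd hab.1
          exact ih hdc hab.2
    refine key c₀ hall hc ?_
    rintro (_ | i)
    · exact (congrArg List.length hrep.1).trans_le (Nat.zero_le _)
    · exact (hrep.length_le hs i).trans (Nat.le_succ _)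
  · refine ⟨f l, c₁, ?_, ?_, hf x⟩
    · refine StateTransition.mem_eval.2 ⟨?_, rfl⟩
      have hreaches : ∀ c, ReachesWithin M (Nat.size B + 1) c₀ c →
          StateTransition.Reaches (machine e p).tm.step c₀ c := by
        intro c hc
        induction hc with
        | refl => exact .refl
        | tail _ h ih => exact ih.tail h.1
      exact hreaches _ hall
    · have h1 : numeral (S (some 1)) = t 1 :=
        (hS.2 1).trans (congrArg t (Nat.mod_eq_of_lt (Nat.lt_add_left _ Nat.one_lt_two)))
      have : (S (some 1)).head?.isSome = f l := by
        rw [Bool.eq_iff_iff, ← hout]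
        rcases hl1 : S (some 1) with _ | ⟨d, l'⟩
        · rw [hl1] at h1
          have : t 1 = 0 := by simpa [numeral] using h1.symm
          simp [this]
        · rw [hl1] at h1
          have : t 1 ≠ 0 := by
            rw [← h1]; simp [numeral]
          simp [this]
      exact hS₁none.trans (by rw [this]; rfl)

end CounterProg

/-! ### Functions computable in polynomial space -/

/-- Types whose elements are presented to counter programs as lists of natural numbers of a fixed
length. -/
class Coded (α : Type) where
  /-- the number of counters used for an element -/
  dim : ℕ
  /-- the values of these counters -/
  code : α → List ℕ
  length_code : ∀ x, (code x).length = dim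

namespace Coded

attribute [simp] length_code

/-- A number is presented by itself. -/
instance : Coded ℕ := ⟨1, fun n => [n], fun _ => rfl⟩

/-- Truth values are presented as `0` and `1`. -/
instance : Coded Bool := ⟨1, fun b => [b.toNat], fun _ => rfl⟩

/-- A pair is presented by the presentations of its components, one after the other. -/
instance {α β : Type} [Coded α] [Coded β] : Coded (α × β) :=
  ⟨dim α + dim β, fun x => code x.1 ++ code x.2, fun x => by simp⟩

/-- Words over the digits are presented as a single number, of which they are the numeral. -/
instance : Coded (List (Fin 12)) := ⟨1, fun l => [CounterProg.numeral l], fun _ => rfl⟩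

/-- A digit is presented by its index, not by its value in a numeral, which is one larger. -/
instance : Coded (Fin 12) := ⟨1, fun d => [(d : ℕ)], fun _ => rfl⟩

@[simp] theorem code_nat (n : ℕ) : code n = [n] := rfl

@[simp] theorem code_bool (b : Bool) : code b = [b.toNat] := rfl

@[simp] theorem code_word (l : List (Fin 12)) : code l = [CounterProg.numeral l] := rfl

@[simp] theorem code_prod {α β : Type} [Coded α] [Coded β] (x : α × β) :
    code x = code x.1 ++ code x.2 := rfl

/-- The largest counter value in the presentation of `x`. -/
def mag {α : Type} [Coded α] (x : α) : ℕ := (code x).foldr max 0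

theorem foldr_max_le {l : List ℕ} {B : ℕ} : l.foldr max 0 ≤ B ↔ ∀ a ∈ l, a ≤ B := by
  induction l with
  | nil => simp
  | cons a l ih => simp [ih]

theorem mag_le {α : Type} [Coded α] {x : α} {B : ℕ} : mag x ≤ B ↔ ∀ a ∈ code x, a ≤ B :=
  foldr_max_le

theorem le_mag {α : Type} [Coded α] {x : α} {a : ℕ} (h : a ∈ code x) : a ≤ mag x :=
  mag_le.1 le_rfl a h

@[simp] theorem mag_nat (n : ℕ) : mag n = n := by simp [mag]

theorem mag_bool (b : Bool) : mag b ≤ 1 := by cases b <;> simp [mag]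

@[simp] theorem mag_word (l : List (Fin 12)) : mag l = CounterProg.numeral l := by simp [mag]

theorem mag_prod {α β : Type} [Coded α] [Coded β] (x : α × β) :
    mag x = max (mag x.1) (mag x.2) := by
  apply le_antisymm
  · rw [mag_le]
    intro a ha
    rcases List.mem_append.1 ha with h | h
    · exact (le_mag h).trans (le_max_left _ _)
    · exact (le_mag h).trans (le_max_right _ _)
  · exact max_le (mag_le.2 fun a ha => le_mag (List.mem_append_left _ ha))
      (mag_le.2 fun a ha => le_mag (List.mem_append_right _ ha))

end Coded

open Coded

/-- The bounds on the values of counters: numbers of at most polynomially many bits. -/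
def bitBound (c n : ℕ) : ℕ := 2 ^ ((Nat.size n + 2) ^ c)

theorem bitBound_mono {c d m n : ℕ} (hc : c ≤ d) (hm : m ≤ n) : bitBound c m ≤ bitBound d n := by
  refine Nat.pow_le_pow_right (by norm_num) ?_
  exact (Nat.pow_le_pow_left (Nat.add_le_add_right (Nat.size_le_size hm) 2) c).trans
    (Nat.pow_le_pow_right (by omega) hc)

theorem le_bitBound_one (n : ℕ) : n ≤ bitBound 1 n := by
  refine (Nat.lt_size_self n).le.trans (Nat.pow_le_pow_right (by norm_num) ?_)
  rw [pow_one]; omega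

theorem bitBound_bitBound (c d n : ℕ) : bitBound c (bitBound d n) ≤ bitBound ((d + 2) * c) n := by
  unfold bitBound
  rw [Nat.size_pow]
  refine Nat.pow_le_pow_right (by norm_num) ?_
  rw [pow_mul]
  refine Nat.pow_le_pow_left ?_ c
  have h1 : 1 ≤ (Nat.size n + 2) ^ d := Nat.one_le_pow _ _ (by omega)
  have h2 : 2 ^ 2 ≤ (Nat.size n + 2) ^ 2 := Nat.pow_le_pow_left (by omega) 2
  rw [pow_add]
  nlinarith

theorem bitBound_mul_self (c n : ℕ) : bitBound c n * bitBound c n ≤ bitBound (c + 1) n := by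
  unfold bitBound
  rw [← pow_add]
  refine Nat.pow_le_pow_right (by norm_num) ?_
  rw [pow_succ]
  nlinarith [Nat.zero_le ((Nat.size n + 2) ^ c * Nat.size n)]

theorem const_le_bitBound (k : ℕ) : ∃ c, ∀ n, k ≤ bitBound c n := by
  refine ⟨k, fun n => ?_⟩
  have h1 : k ≤ (Nat.size n + 2) ^ k :=
    (Nat.lt_pow_self (by omega)).le
  exact (Nat.lt_pow_self (by norm_num)).le.trans (Nat.pow_le_pow_right (by norm_num) h1)

/-- Numbers depending on `x` whose number of bits is polynomial in that of `x`. -/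
def PolyBits {α : Type} [Coded α] (f : α → ℕ) : Prop := ∃ c, ∀ x, f x ≤ bitBound c (mag x)

/-- Numbers depending on `x` which are polynomial in the number of bits of `x`. -/
def PolyLength {α : Type} [Coded α] (f : α → ℕ) : Prop :=
  ∃ c, ∀ x, f x ≤ (Nat.size (mag x) + 2) ^ c

section PolyBits
variable {α β : Type} [Coded α] [Coded β] {f g : α → ℕ}

theorem PolyBits.of_le (hg : PolyBits g) (h : ∀ x, f x ≤ g x) : PolyBits f :=
  hg.imp fun _ hc x => (h x).trans (hc x)

theorem PolyBits.const (k : ℕ) : PolyBits fun _ : α => k :=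
  (const_le_bitBound k).imp fun _ hc _ => hc _

theorem PolyBits.mag : PolyBits fun x : α => Coded.mag x := ⟨1, fun _ => le_bitBound_one _⟩

theorem PolyBits.mul (hf : PolyBits f) (hg : PolyBits g) : PolyBits fun x => f x * g x := by
  obtain ⟨c, hc⟩ := hf
  obtain ⟨d, hd⟩ := hg
  refine ⟨max c d + 1, fun x => (Nat.mul_le_mul ?_ ?_).trans (bitBound_mul_self _ _)⟩
  · exact (hc x).trans (bitBound_mono (le_max_left _ _) le_rfl)
  · exact (hd x).trans (bitBound_mono (le_max_right _ _) le_rfl)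

theorem PolyBits.add (hf : PolyBits f) (hg : PolyBits g) : PolyBits fun x => f x + g x := by
  have h : PolyBits fun x => (f x + 1) * (g x + 1) := by
    have : ∀ {f : α → ℕ}, PolyBits f → PolyBits fun x => f x + 1 := by
      rintro f ⟨c, hc⟩
      refine ⟨c + 1, fun x => le_trans ?_ (bitBound_mul_self _ _)⟩
      have h1 := hc x
      have h2 : 2 ≤ bitBound c (Coded.mag x) := by
        unfold bitBound
        exact Nat.le_self_pow (Nat.pos_iff_ne_zero.1 (by positivity)) 2
      nlinarith
    exact (this hf).mul (this hg)
  exact h.of_le fun x => by nlinarith [Nat.zero_le (f x * g x)]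

theorem PolyBits.max (hf : PolyBits f) (hg : PolyBits g) : PolyBits fun x => max (f x) (g x) :=
  (hf.add hg).of_le fun x => by omega

theorem PolyBits.pow (hf : PolyBits f) (hg : PolyLength g) : PolyBits fun x => f x ^ g x := by
  obtain ⟨c, hc⟩ := hf
  obtain ⟨d, hd⟩ := hg
  refine ⟨c + d, fun x => (Nat.pow_le_pow_left (hc x) _).trans ?_⟩
  unfold bitBound
  rw [← pow_mul, pow_add]
  exact Nat.pow_le_pow_right (by norm_num) (Nat.mul_le_mul_left _ (hd x))

theorem PolyBits.comp {f : β → ℕ} (hf : PolyBits f) {g : α → β}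
    (hg : PolyBits fun x => Coded.mag (g x)) : PolyBits fun x => f (g x) := by
  obtain ⟨c, hc⟩ := hf
  obtain ⟨d, hd⟩ := hg
  exact ⟨(d + 2) * c, fun x => (hc _).trans
    ((bitBound_mono le_rfl (hd x)).trans (bitBound_bitBound _ _ _))⟩

theorem PolyBits.mag_prod {γ δ : Type} [Coded γ] [Coded δ] {f : α → γ} {g : α → δ}
    (hf : PolyBits fun x => Coded.mag (f x)) (hg : PolyBits fun x => Coded.mag (g x)) :
    PolyBits fun x => Coded.mag (f x, g x) := by
  simp only [Coded.mag_prod]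
  exact hf.max hg

theorem PolyLength.of_le (hg : PolyLength g) (h : ∀ x, f x ≤ g x) : PolyLength f :=
  hg.imp fun _ hc x => (h x).trans (hc x)

theorem PolyLength.const (k : ℕ) : PolyLength fun _ : α => k :=
  ⟨k, fun x => (Nat.lt_pow_self (by omega)).le⟩

theorem PolyLength.mul (hf : PolyLength f) (hg : PolyLength g) :
    PolyLength fun x => f x * g x := by
  obtain ⟨c, hc⟩ := hf
  obtain ⟨d, hd⟩ := hg
  exact ⟨c + d, fun x => by rw [pow_add]; exact Nat.mul_le_mul (hc x) (hd x)⟩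

theorem PolyLength.add (hf : PolyLength f) (hg : PolyLength g) :
    PolyLength fun x => f x + g x := by
  obtain ⟨c, hc⟩ := hf
  obtain ⟨d, hd⟩ := hg
  refine ⟨max c d + 1, fun x => ?_⟩
  have h1 := (hc x).trans (Nat.pow_le_pow_right (by omega) (le_max_left c d))
  have h2 := (hd x).trans (Nat.pow_le_pow_right (by omega) (le_max_right c d))
  rw [pow_succ]
  nlinarith [Nat.zero_le ((Nat.size (Coded.mag x) + 2) ^ Max.max c d * Nat.size (Coded.mag x))]

theorem PolyLength.comp {f : β → ℕ} (hf : PolyLength f) {g : α → β}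
    (hg : PolyBits fun x => Coded.mag (g x)) : PolyLength fun x => f (g x) := by
  obtain ⟨c, hc⟩ := hf
  obtain ⟨d, hd⟩ := hg
  refine ⟨(d + 2) * c, fun x => (hc _).trans ?_⟩
  have h := (bitBound_mono (c := c) le_rfl (hd x)).trans (bitBound_bitBound _ _ _)
  exact (Nat.pow_le_pow_iff_right (by norm_num)).1 h

end PolyBits

open Coded

namespace CounterProg

/-! ### Programs on the list of counters -/

/-- The counter values given by a list, all further counters being zero. -/
def ofList (l : List ℕ) : ℕ → ℕ := fun i => l.getD i 0

theorem ofList_append_zero (l : List ℕ) : ofList (l ++ [0]) = ofList l := by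
  funext i
  rcases lt_trichotomy i l.length with h | h | h
  · simp [ofList, List.getD_eq_getElem?_getD, List.getElem?_append, h]
  · simp [ofList, List.getD_eq_getElem?_getD, h]
  · simp [ofList, List.getD_eq_getElem?_getD, List.getElem?_eq_none h.le,
      List.getElem?_eq_none (show (l ++ [0]).length ≤ i by simpa using h)]

theorem ofList_mid (l r : List ℕ) (a : ℕ) : ofList (l ++ a :: r) l.length = a := by
  simp [ofList]

theorem update_ofList (l r : List ℕ) (a b : ℕ) :
    Function.update (ofList (l ++ a :: r)) l.length b = ofList (l ++ b :: r) := by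
  funext i
  by_cases hi : i = l.length
  · subst hi; simp [ofList_mid]
  · rw [Function.update_of_ne hi]
    simp only [ofList, List.getD_eq_getElem?_getD, List.getElem?_append]
    split_ifs with h
    · rfl
    · obtain ⟨k, hk⟩ : ∃ k, i - l.length = k + 1 := ⟨i - l.length - 1, by omega⟩
      simp [hk]

theorem Exec.of_eq {B : ℕ} {p : CounterProg} {s s' t t' : ℕ → ℕ} (h : Exec B p s t)
    (hs : s = s') (ht : t = t') : Exec B p s' t' := hs ▸ ht ▸ h

theorem Exec.le_max {B : ℕ} {p : CounterProg} {s t : ℕ → ℕ} (h : Exec B p s t) (r : ℕ) :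
    t r ≤ max (s r) B := by
  induction h with
  | skip s => exact le_max_left _ _
  | inc r' s h =>
    by_cases hr : r = r'
    · subst hr; simp [h]
    · simp [hr]
  | dec r' s =>
    by_cases hr : r = r'
    · subst hr; simp
    · simp [hr]
  | seq _ _ ih₁ ih₂ => omega
  | loop_zero h => exact le_max_left _ _
  | loop_step h _ _ ih₁ ih₂ => omega

theorem exec_inc_ofList {B : ℕ} (l r : List ℕ) (a : ℕ) (h : a + 1 ≤ B) :
    Exec B (.inc l.length) (ofList (l ++ a :: r)) (ofList (l ++ (a + 1) :: r)) := by
  have := Exec.inc (B := B) l.length (ofList (l ++ a :: r)) (by rwa [ofList_mid])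
  rwa [ofList_mid, update_ofList] at this

theorem exec_dec_ofList {B : ℕ} (l r : List ℕ) (a : ℕ) :
    Exec B (.dec l.length) (ofList (l ++ a :: r)) (ofList (l ++ (a - 1) :: r)) := by
  have := Exec.dec (B := B) l.length (ofList (l ++ a :: r))
  rwa [ofList_mid, update_ofList] at this

/-- A loop whose body counts its own counter down runs as often as the counter says. -/
theorem Exec.loop_of_dec {B : ℕ} {p : CounterProg} {r : ℕ} (σ : ℕ → ℕ → ℕ) (n : ℕ)
    (hr : ∀ i ≤ n, σ i r = n - i) (h : ∀ i < n, Exec B p (σ i) (σ (i + 1))) :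
    Exec B (.loop r p) (σ 0) (σ n) := by
  induction n generalizing σ with
  | zero => exact .loop_zero (hr 0 le_rfl)
  | succ n ih =>
    refine .loop_step (by rw [hr 0 (by omega)]; omega) (h 0 (by omega)) ?_
    exact ih (fun i => σ (i + 1)) (fun i hi => by rw [hr _ (by omega)]; omega)
      (fun i hi => h _ (by omega))

/-- Sets counter `i` to zero. -/
def clear (i : ℕ) : CounterProg := .loop i (.dec i)

theorem exec_clear {B : ℕ} (l r : List ℕ) (a : ℕ) :
    Exec B (clear l.length) (ofList (l ++ a :: r)) (ofList (l ++ 0 :: r)) := by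
  have := Exec.loop_of_dec (B := B) (p := .dec l.length) (r := l.length)
    (fun i => ofList (l ++ (a - i) :: r)) a (fun i _ => ofList_mid _ _ _)
    (fun i _ => exec_dec_ofList l r _)
  simpa [clear] using this

/-- Moves counter `i` to counter `j`. -/
def move (i j : ℕ) : CounterProg := .loop i (.seq (.dec i) (.inc j))

/-- The contents of counter `i` are moved to the preceding counter, which is zero. -/
theorem exec_move {B : ℕ} (l r : List ℕ) (a : ℕ) (ha : a ≤ B) :
    Exec B (move (l.length + 1) l.length) (ofList (l ++ 0 :: a :: r))
      (ofList (l ++ a :: 0 :: r)) := by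
  have h1 : ∀ b c, l ++ b :: c :: r = (l ++ [b]) ++ c :: r := by simp
  have hl : ∀ b, (l ++ [b]).length = l.length + 1 := by simp
  have := Exec.loop_of_dec (B := B) (p := .seq (.dec (l.length + 1)) (.inc l.length))
    (r := l.length + 1) (fun i => ofList (l ++ i :: (a - i) :: r)) a
    (fun i _ => by
      show ofList _ _ = _
      rw [h1, ← hl i, ofList_mid])
    (fun i hi => by
      refine .seq (t := ofList (l ++ i :: (a - (i + 1)) :: r)) ?_
        (exec_inc_ofList l _ i (by omega))
      have := exec_dec_ofList (B := B) (l ++ [i]) r (a - i)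
      rw [hl, ← h1, ← h1] at this
      exact this)
  simpa [move] using this

/-- Copies counter `i` to the counter `j`, using counter `j + 1`. -/
def copy (i j : ℕ) : CounterProg :=
  .seq (.loop i (.seq (.dec i) (.seq (.inc j) (.inc (j + 1)))))
    (.loop (j + 1) (.seq (.dec (j + 1)) (.inc i)))

/-- Copying is non-destructive: the contents of the counter are moved to two places at once, and
then back from the second of these. -/
theorem exec_copy {B : ℕ} (l m : List ℕ) (a : ℕ) (ha : a ≤ B) :
    Exec B (copy l.length (l ++ a :: m).length) (ofList (l ++ a :: m))
      (ofList (l ++ a :: m ++ [a])) := by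
  set j := (l ++ a :: m).length with hj
  have hj1 : ∀ b, (l ++ b :: m).length = j := by simp [hj]
  have hj2 : ∀ b c, (l ++ b :: (m ++ [c])).length = j + 1 := by simp [hj]; omega
  have e : ∀ b c d, l ++ b :: (m ++ [c, d]) = (l ++ b :: m) ++ c :: [d] := by simp
  have e' : ∀ b c d, l ++ b :: (m ++ [c, d]) = (l ++ b :: (m ++ [c])) ++ d :: [] := by simp
  have h1 := Exec.loop_of_dec (B := B)
    (p := .seq (.dec l.length) (.seq (.inc j) (.inc (j + 1)))) (r := l.length)
    (fun i => ofList (l ++ (a - i) :: (m ++ [i, i]))) a (fun i _ => ofList_mid _ _ _)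
    (fun i hi => by
      refine .seq (t := ofList (l ++ (a - (i + 1)) :: (m ++ [i, i])))
        (exec_dec_ofList l _ (a - i))
        (.seq (t := ofList (l ++ (a - (i + 1)) :: (m ++ [i + 1, i]))) ?_ ?_)
      · rw [e, e, ← hj1 (a - (i + 1))]
        exact exec_inc_ofList _ _ i (by omega)
      · rw [e', e', ← hj2 (a - (i + 1)) (i + 1)]
        exact exec_inc_ofList _ _ i (by omega))
  have h2 := Exec.loop_of_dec (B := B)
    (p := .seq (.dec (j + 1)) (.inc l.length)) (r := j + 1)
    (fun i => ofList (l ++ i :: (m ++ [a, a - i]))) a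
    (fun i _ => by
      show ofList _ _ = _
      rw [e', ← hj2 i a, ofList_mid])
    (fun i hi => by
      refine .seq (t := ofList (l ++ i :: (m ++ [a, a - (i + 1)]))) ?_
        (exec_inc_ofList l _ i (by omega))
      rw [e', e', ← hj2 i a]
      exact exec_dec_ofList _ _ (a - i))
  simp only [Nat.sub_zero, Nat.sub_self] at h1 h2
  refine (Exec.seq h1 h2).of_eq ?_ ?_
  · rw [show l ++ a :: (m ++ [0, 0]) = (l ++ a :: m) ++ [0] ++ [0] by simp, ofList_append_zero,
      ofList_append_zero]
  · rw [show l ++ a :: (m ++ [a, 0]) = (l ++ a :: m ++ [a]) ++ [0] by simp, ofList_append_zero]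

/-- Copies the block of `k` counters starting at `i` to the counters starting at `j`. -/
def copyBlock (i j : ℕ) : ℕ → CounterProg
  | 0 => .skip
  | k + 1 => .seq (copy i j) (copyBlock (i + 1) (j + 1) k)

theorem exec_copyBlock {B : ℕ} (l m y : List ℕ) (hy : ∀ a ∈ y, a ≤ B) :
    Exec B (copyBlock l.length (l ++ y ++ m).length y.length) (ofList (l ++ y ++ m))
      (ofList (l ++ y ++ m ++ y)) := by
  induction y generalizing l m with
  | nil => simpa [copyBlock] using Exec.skip _
  | cons a y ih =>
    have h1 := exec_copy (B := B) l (y ++ m) a (hy a (by simp))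
    have h2 := ih (l ++ [a]) (m ++ [a]) (fun b hb => hy b (by simp [hb]))
    have e1 : (l ++ [a]).length = l.length + 1 := by simp
    have e2 : (l ++ [a] ++ y ++ (m ++ [a])).length = (l ++ a :: y ++ m).length + 1 := by
      simp; omega
    rw [e1, e2] at h2
    refine Exec.seq (t := ofList (l ++ a :: y ++ m ++ [a])) ?_ ?_
    · simpa using h1
    · simpa using h2

/-- Removes counter `i`, shifting down the `n` counters above it. -/
def remove (i : ℕ) (n : ℕ) : CounterProg :=
  .seq (clear i) (go i n)
where
  /-- Shifts `n` counters down to position `i`. -/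
  go (i : ℕ) : ℕ → CounterProg
  | 0 => .skip
  | n + 1 => .seq (move (i + 1) i) (go (i + 1) n)

theorem exec_remove {B : ℕ} (l z : List ℕ) (a : ℕ) (hz : ∀ a ∈ z, a ≤ B) :
    Exec B (remove l.length z.length) (ofList (l ++ a :: z)) (ofList (l ++ z)) := by
  refine .seq (exec_clear l z a) ?_
  induction z generalizing l with
  | nil => exact (Exec.skip _).of_eq rfl (by simp [ofList_append_zero])
  | cons b z ih =>
    have h2 := ih (l ++ [b]) (fun c hc => hz c (by simp [hc]))
    rw [show (l ++ [b]).length = l.length + 1 by simp] at h2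
    refine Exec.seq (exec_move l z b (hz b (by simp))) ?_
    simpa using h2

/-- Removes the `k` counters starting at `i`, shifting down the `n` counters above them. -/
def removeBlock (i n : ℕ) : ℕ → CounterProg
  | 0 => .skip
  | k + 1 => .seq (remove i (k + n)) (removeBlock i n k)

theorem exec_removeBlock {B : ℕ} (l y z : List ℕ) (hy : ∀ a ∈ y, a ≤ B) (hz : ∀ a ∈ z, a ≤ B) :
    Exec B (removeBlock l.length z.length y.length) (ofList (l ++ y ++ z)) (ofList (l ++ z)) := by
  induction y with
  | nil => simpa [copyBlock, removeBlock] using Exec.skip _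
  | cons b y ih =>
    have h1 := exec_remove (B := B) l (y ++ z) b (fun a ha => by
      rcases List.mem_append.1 ha with h | h
      · exact hy a (by simp [h])
      · exact hz a h)
    have h2 := ih (fun a ha => hy a (by simp [ha]))
    refine Exec.seq (t := ofList (l ++ y ++ z)) ?_ h2
    simpa using h1

end CounterProg

/-! ### Closure properties -/

open CounterProg in
/-- `f` is computable in polynomial space: there are counter programs which, started with a
presentation of `x` in the counters from `b` on and zeros above it, write a presentation of `f x`
above that of `x`, restore all other counters, and form only numbers of polynomially many bits. -/
@[fun_prop]
def PSpace {α β : Type} [Coded α] [Coded β] (f : α → β) : Prop :=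
  ∃ c, ∀ b, ∃ p, ∀ l : List ℕ, l.length = b → ∀ x,
    Exec (bitBound c (mag x)) p (ofList (l ++ code x)) (ofList (l ++ code x ++ code (f x)))

namespace PSpace
open CounterProg

variable {α β γ δ : Type} [Coded α] [Coded β] [Coded γ] [Coded δ]

/-- A result of polynomial space has polynomially many bits, since it is formed by increments. -/
theorem polyBits {f : α → β} (hf : PSpace f) : PolyBits fun x => mag (f x) := by
  obtain ⟨c, hc⟩ := hf
  obtain ⟨p, hp⟩ := hc 0
  refine ⟨c, fun x => mag_le.2 fun a ha => ?_⟩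
  have h := (hp [] rfl x).le_max
  obtain ⟨l, r, hlr⟩ := List.append_of_mem ha
  have h1 := h (code x ++ l).length
  rw [hlr, List.nil_append, ← List.append_assoc, ofList_mid] at h1
  refine h1.trans (max_le ?_ le_rfl)
  simp [ofList, List.getD_eq_getElem?_getD]

@[fun_prop]
theorem id : PSpace fun x : α => x := by
  refine ⟨1, fun b => ⟨copyBlock b (b + dim α) (dim α), fun l hl x => ?_⟩⟩
  have := exec_copyBlock (B := bitBound 1 (mag x)) l [] (code x)
    (fun a ha => (le_mag ha).trans (le_bitBound_one _))
  simpa [hl] using this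

/-- A fixed number of increments. -/
def load (i : ℕ) : ℕ → CounterProg
  | 0 => .skip
  | n + 1 => .seq (load i n) (.inc i)

theorem exec_load {B : ℕ} (l : List ℕ) (n : ℕ) (h : n ≤ B) :
    Exec B (load l.length n) (ofList (l ++ [0])) (ofList (l ++ [n])) := by
  induction n with
  | zero => exact .skip _
  | succ n ih => exact .seq (ih (by omega)) (exec_inc_ofList l [] n h)

/-- Writes the numbers of a list to the counters from `i` on. -/
def loadList (i : ℕ) : List ℕ → CounterProg
  | [] => .skip
  | n :: y => .seq (load i n) (loadList (i + 1) y)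

theorem exec_loadList {B : ℕ} (l y : List ℕ) (h : ∀ a ∈ y, a ≤ B) :
    Exec B (loadList l.length y) (ofList l) (ofList (l ++ y)) := by
  induction y generalizing l with
  | nil => simpa [loadList] using Exec.skip _
  | cons n y ih =>
    have h2 := ih (l ++ [n]) (fun a ha => h a (by simp [ha]))
    rw [show (l ++ [n]).length = l.length + 1 by simp] at h2
    refine .seq ((exec_load l n (h n (by simp))).of_eq (ofList_append_zero l) rfl) ?_
    simpa using h2

@[fun_prop]
theorem const (k : β) : PSpace fun _ : α => k := by
  obtain ⟨c, hc⟩ := const_le_bitBound (mag k)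
  refine ⟨c, fun b => ⟨loadList (b + dim α) (code k), fun l hl x => ?_⟩⟩
  have := exec_loadList (B := bitBound c (mag x)) (l ++ code x) (code k)
    (fun a ha => (le_mag ha).trans (hc _))
  simpa [hl] using this

/-- Both programs are run, and then the intermediate result is removed. -/
@[fun_prop]
theorem comp {g : β → γ} {f : α → β} (hg : PSpace g) (hf : PSpace f) :
    PSpace fun x => g (f x) := by
  obtain ⟨e, he⟩ : PolyBits fun x => mag (g (f x)) := hg.polyBits.comp hf.polyBits
  obtain ⟨m, hm⟩ := hf.polyBits
  obtain ⟨c, hc⟩ := hg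
  obtain ⟨d, hd⟩ := hf
  refine ⟨max (max d e) (max m ((m + 2) * c)), fun b => ?_⟩
  obtain ⟨p, hp⟩ := hd b
  obtain ⟨q, hq⟩ := hc (b + dim α)
  refine ⟨.seq p (.seq q (removeBlock (b + dim α) (dim γ) (dim β))), fun l hl x => ?_⟩
  set C := max (max d e) (max m ((m + 2) * c))
  have hlen : (l ++ code x).length = b + dim α := by simp [hl]
  have h1 := (hp l hl x).mono (bitBound_mono (show d ≤ C by omega) le_rfl)
  have h2 := (hq (l ++ code x) hlen (f x)).mono
    (((bitBound_mono le_rfl (hm x)).trans (bitBound_bitBound c m _)).trans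
      (bitBound_mono (show _ ≤ C by omega) le_rfl))
  have h3 := exec_removeBlock (B := bitBound C (mag x)) (l ++ code x) (code (f x))
    (code (g (f x)))
    (fun a ha => ((le_mag ha).trans (hm x)).trans (bitBound_mono (by omega) le_rfl))
    (fun a ha => ((le_mag ha).trans (he x)).trans (bitBound_mono (by omega) le_rfl))
  rw [hlen, length_code, length_code] at h3
  exact .seq h1 (.seq h2 h3)

/-- The second program is run on a copy of the input above the first result; then this copy is
removed. -/
@[fun_prop]
theorem prodMk {f : α → β} {g : α → γ} (hf : PSpace f) (hg : PSpace g) :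
    PSpace fun x => (f x, g x) := by
  obtain ⟨m, hm⟩ := hg.polyBits
  obtain ⟨d, hd⟩ := hf
  obtain ⟨c, hc⟩ := hg
  refine ⟨max 1 (max m (max c d)), fun b => ?_⟩
  obtain ⟨p, hp⟩ := hd b
  obtain ⟨q, hq⟩ := hc (b + dim α + dim β)
  refine ⟨.seq p (.seq (copyBlock b (b + dim α + dim β) (dim α))
    (.seq q (removeBlock (b + dim α + dim β) (dim γ) (dim α)))), fun l hl x => ?_⟩
  set C := max 1 (max m (max c d))
  have hlen : (l ++ code x ++ code (f x)).length = b + dim α + dim β := by simp [hl]; omega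
  have hx : ∀ a ∈ code x, a ≤ bitBound C (mag x) := fun a ha =>
    (le_mag ha).trans ((le_bitBound_one _).trans (bitBound_mono (by omega) le_rfl))
  have h1 := (hp l hl x).mono (bitBound_mono (show d ≤ C by omega) le_rfl)
  have h2 := exec_copyBlock l (code (f x)) (code x) hx
  have h3 := (hq _ hlen x).mono (bitBound_mono (show c ≤ C by omega) le_rfl)
  have h4 := exec_removeBlock (l ++ code x ++ code (f x)) (code x) (code (g x)) hx
    (fun a ha => ((le_mag ha).trans (hm x)).trans (bitBound_mono (by omega) le_rfl))
  rw [hlen, length_code] at h2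
  rw [hlen, length_code, length_code] at h4
  rw [hl] at h2
  refine .seq h1 (.seq h2 (.seq h3 (h4.of_eq rfl ?_)))
  simp

@[fun_prop]
theorem fst : PSpace fun x : α × β => x.1 := by
  refine ⟨1, fun b => ⟨copyBlock b (b + (dim α + dim β)) (dim α), fun l hl x => ?_⟩⟩
  have := exec_copyBlock (B := bitBound 1 (mag x)) l (code x.2) (code x.1)
    (fun a ha => (le_mag (x := x) (List.mem_append_left _ ha)).trans (le_bitBound_one _))
  simpa [hl, add_assoc] using this

@[fun_prop]
theorem snd : PSpace fun x : α × β => x.2 := by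
  refine ⟨1, fun b => ⟨copyBlock (b + dim α) (b + (dim α + dim β)) (dim β), fun l hl x => ?_⟩⟩
  have := exec_copyBlock (B := bitBound 1 (mag x)) (l ++ code x.1) [] (code x.2)
    (fun a ha => (le_mag (x := x) (List.mem_append_right _ ha)).trans (le_bitBound_one _))
  simpa [hl, add_assoc] using this

/-- If programs replace the number `x` in a counter by `f x`, then `f` is computed by applying them
to a copy of `x`. -/
theorem of_inPlace {f : ℕ → ℕ} (c : ℕ) (p : ℕ → CounterProg)
    (h : ∀ (l : List ℕ) (x : ℕ), Exec (bitBound c x) (p l.length) (ofList (l ++ [x]))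
      (ofList (l ++ [f x]))) : PSpace f := by
  refine ⟨max 1 c, fun b => ⟨.seq (copyBlock b (b + 1) 1) (p (b + 1)), fun l hl x => ?_⟩⟩
  have h1 := exec_copyBlock (B := bitBound (max 1 c) x) l [] [x]
    (fun a ha => by
      rw [List.mem_singleton.1 ha]
      exact (le_bitBound_one _).trans (bitBound_mono (by omega) le_rfl))
  have h2 := (h (l ++ [x]) x).mono (bitBound_mono (show c ≤ max 1 c by omega) le_rfl)
  refine .seq (t := ofList (l ++ [x] ++ [x])) ?_ ?_
  · simpa [hl] using h1
  · simpa [hl] using h2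

theorem succ : PSpace Nat.succ :=
  of_inPlace 2 (fun i => .inc i) fun l x => exec_inc_ofList l [] x (by
    refine (Nat.lt_size_self x).trans_le (Nat.pow_le_pow_right (by norm_num) ?_)
    nlinarith [Nat.zero_le (Nat.size x)])

theorem pred : PSpace Nat.pred :=
  of_inPlace 0 (fun i => .dec i) fun l x => exec_dec_ofList l [] x

/-- A function may be iterated, provided all intermediate results have polynomially many bits. The
number of iterations may be exponential. -/
theorem iterate {N : α → ℕ} {f : α → β} {h : β → β} (hN : PSpace N) (hf : PSpace f)
    (hh : PSpace h) {G : α → ℕ} (hG : PolyBits G)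
    (hb : ∀ x, ∀ i ≤ N x, mag (h^[i] (f x)) ≤ G x) :
    PSpace fun x => h^[N x] (f x) := by
  obtain ⟨e, he⟩ := hG
  obtain ⟨m, hm⟩ := hN.polyBits
  obtain ⟨d, hd⟩ := hN.prodMk hf
  obtain ⟨c, hc⟩ := hh
  refine ⟨max (max d e) (max m ((e + 2) * c)), fun b => ?_⟩
  obtain ⟨p, hp⟩ := hd b
  set a := b + dim α with ha
  obtain ⟨q, hq⟩ := hc (a + 1)
  refine ⟨.seq p (.seq (.loop a (.seq (.dec a) (.seq q (removeBlock (a + 1) (dim β) (dim β)))))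
    (remove a (dim β))), fun l hl x => ?_⟩
  set C := max (max d e) (max m ((e + 2) * c)) with hC
  set s := l ++ code x with hs
  have hlen : s.length = a := by simp [hs, hl, ha]
  have hle : ∀ i ≤ N x, ∀ k ∈ code (h^[i] (f x)), k ≤ bitBound C (mag x) := fun i hi k hk =>
    ((le_mag hk).trans ((hb x i hi).trans (he x))).trans (bitBound_mono (by omega) le_rfl)
  have h1 := (hp l hl x).mono (bitBound_mono (show d ≤ C by omega) le_rfl)
  have h2 := Exec.loop_of_dec (B := bitBound C (mag x)) (r := a)
    (p := .seq (.dec a) (.seq q (removeBlock (a + 1) (dim β) (dim β))))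
    (fun i => ofList (s ++ (N x - i) :: code (h^[i] (f x)))) (N x)
    (fun i hi => by rw [← hlen, ofList_mid])
    (fun i hi => by
      have e1 := exec_dec_ofList (B := bitBound C (mag x)) s (code (h^[i] (f x))) (N x - i)
      have hlen' : (s ++ [N x - (i + 1)]).length = a + 1 := by simp [hlen]
      have e2 := (hq (s ++ [N x - (i + 1)]) hlen' (h^[i] (f x))).mono
        (((bitBound_mono le_rfl ((hb x i hi.le).trans (he x))).trans
          (bitBound_bitBound c e _)).trans (bitBound_mono (show _ ≤ C by omega) le_rfl))
      have e3 := exec_removeBlock (B := bitBound C (mag x)) (s ++ [N x - (i + 1)])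
        (code (h^[i] (f x))) (code (h^[i + 1] (f x))) (hle i hi.le) (hle (i + 1) hi)
      rw [hlen'] at e3
      rw [hlen] at e1
      simp only [length_code] at e3
      rw [Function.iterate_succ_apply'] at e3 ⊢
      refine .seq e1 (.seq (e2.of_eq ?_ rfl) (e3.of_eq rfl ?_))
      · simp [Nat.sub_sub]
      · simp)
  have h3 := exec_remove (B := bitBound C (mag x)) s (code (h^[N x] (f x))) 0 (hle _ le_rfl)
  rw [hlen, length_code] at h3
  refine .seq (h1.of_eq rfl ?_) (.seq h2 (h3.of_eq ?_ rfl))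
  · simp [hs]
  · simp

end PSpace

/-! ### Arithmetic in polynomial space -/

theorem iterate_prod_fst {α β : Type} (h : α → β → β) (n : ℕ) (x : α × β) :
    (fun y : α × β => (y.1, h y.1 y.2))^[n] x = (x.1, (h x.1)^[n] x.2) := by
  induction n with
  | zero => rfl
  | succ n ih => rw [Function.iterate_succ_apply', ih, Function.iterate_succ_apply']

namespace PSpace
variable {α β : Type} [Coded α] [Coded β]

theorem congr {f g : α → β} (hf : PSpace f) (h : ∀ x, f x = g x) : PSpace g := funext h ▸ hf

/-- Iteration of a function with a parameter. -/
theorem iterate_with {N : α → ℕ} {f : α → β} {h : α → β → β} (hN : PSpace N) (hf : PSpace f)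
    (hh : PSpace fun y : α × β => h y.1 y.2) {G : α → ℕ} (hG : PolyBits G)
    (hb : ∀ x, ∀ i ≤ N x, mag ((h x)^[i] (f x)) ≤ G x) :
    PSpace fun x => (h x)^[N x] (f x) := by
  have key : PSpace fun x => (fun y : α × β => (y.1, h y.1 y.2))^[N x] (x, f x) := by
    refine iterate hN (by fun_prop) (by fun_prop) (PolyBits.mag.max hG) fun x i hi => ?_
    rw [iterate_prod_fst, mag_prod]
    exact max_le_max le_rfl (hb x i hi)
  exact (snd.comp key).congr fun x => by rw [iterate_prod_fst]

@[fun_prop]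
theorem add {f g : α → ℕ} (hf : PSpace f) (hg : PSpace g) : PSpace fun x => f x + g x := by
  have key : PSpace fun x => Nat.succ^[g x] (f x) :=
    iterate hg hf succ (hf.polyBits.add hg.polyBits) fun x i hi => by
      simp [Nat.succ_iterate]; omega
  exact key.congr fun x => by rw [Nat.succ_iterate]

@[fun_prop]
theorem sub {f g : α → ℕ} (hf : PSpace f) (hg : PSpace g) : PSpace fun x => f x - g x := by
  have key : PSpace fun x => Nat.pred^[g x] (f x) :=
    iterate hg hf pred hf.polyBits fun x i hi => by
      simp [Nat.pred_iterate]
  exact key.congr fun x => by rw [Nat.pred_iterate]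

@[fun_prop]
theorem mul {f g : α → ℕ} (hf : PSpace f) (hg : PSpace g) : PSpace fun x => f x * g x := by
  have it : ∀ a i : ℕ, (fun v => v + a)^[i] 0 = a * i := fun a i => by
    induction i with
    | zero => rfl
    | succ i ih => rw [Function.iterate_succ_apply', ih]; ring
  have key : PSpace fun x => (fun v => v + f x)^[g x] 0 :=
    iterate_with hg (const 0) (by fun_prop) (hf.polyBits.mul hg.polyBits) fun x i hi => by
      rw [it, mag_nat, mag_nat, mag_nat]
      exact Nat.mul_le_mul_left _ hi
  exact key.congr fun x => it _ _

/-- A Boolean function is computed through the numbers `0` and `1`. -/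
theorem of_toNat {f : α → Bool} (hf : PSpace fun x => (f x).toNat) : PSpace f := hf

@[fun_prop]
theorem toNat {f : α → Bool} (hf : PSpace f) : PSpace fun x => (f x).toNat := hf

@[fun_prop]
theorem cond {c : α → Bool} {f g : α → β} (hc : PSpace c) (hf : PSpace f) (hg : PSpace g) :
    PSpace fun x => bif c x then f x else g x := by
  have key : PSpace fun x => (fun y : β × β => (y.1, y.1))^[(c x).toNat] (f x, g x) := by
    refine iterate hc.toNat (by fun_prop) (by fun_prop)
      (PolyBits.mag_prod hf.polyBits hg.polyBits) fun x i hi => ?_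
    have : i = 0 ∨ i = 1 := by cases h : c x <;> simp [h] at hi <;> omega
    rcases this with rfl | rfl <;> simp [mag_prod]
  exact (snd.comp key).congr fun x => by cases c x <;> rfl

@[fun_prop]
theorem and {f g : α → Bool} (hf : PSpace f) (hg : PSpace g) : PSpace fun x => f x && g x :=
  (hf.cond hg (const false)).congr fun x => by cases f x <;> rfl

@[fun_prop]
theorem or {f g : α → Bool} (hf : PSpace f) (hg : PSpace g) : PSpace fun x => f x || g x :=
  (hf.cond (const true) hg).congr fun x => by cases f x <;> rfl

@[fun_prop]
theorem ble {f g : α → ℕ} (hf : PSpace f) (hg : PSpace g) :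
    PSpace fun x => Nat.ble (f x) (g x) := by
  have key : PSpace fun x => 1 - (f x - g x) := by fun_prop
  refine of_toNat (key.congr fun x => ?_)
  by_cases h : f x ≤ g x
  · rw [Nat.ble_eq_true_of_le h]; simp [Nat.sub_eq_zero_of_le h]
  · have : Nat.ble (f x) (g x) = false := by rw [← Bool.not_eq_true, Nat.ble_eq]; exact h
    rw [this]; simp; omega

@[fun_prop]
theorem beq {f g : α → ℕ} (hf : PSpace f) (hg : PSpace g) :
    PSpace fun x => Nat.beq (f x) (g x) := by
  have key : PSpace fun x => Nat.ble (f x) (g x) && Nat.ble (g x) (f x) := by fun_prop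
  refine key.congr fun x => ?_
  rw [Bool.eq_iff_iff, Bool.and_eq_true, Nat.ble_eq, Nat.ble_eq, Nat.beq_eq]
  exact Nat.le_antisymm_iff.symm

/-- Quotient and remainder are found by counting up to the dividend, starting the remainder anew
whenever it reaches the divisor. -/
theorem divMod {f g : α → ℕ} (hf : PSpace f) (hg : PSpace g) :
    PSpace fun x => (f x / g x, f x % g x) := by
  set h : ℕ → ℕ × ℕ → ℕ × ℕ := fun d y =>
    bif Nat.beq (y.2 + 1) d then (y.1 + 1, 0) else (y.1, y.2 + 1) with hh
  have it : ∀ d i : ℕ, (h d)^[i] (0, 0) = (i / d, i % d) := fun d i => by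
    induction i with
    | zero => simp
    | succ i ih =>
      rw [Function.iterate_succ_apply', ih]
      by_cases hd : i % d + 1 = d
      · have h1 : Nat.beq (i % d + 1) d = true := by rw [Nat.beq_eq]; exact hd
        have h2 : d ∣ i + 1 := by
          have := Nat.div_add_mod i d
          exact ⟨i / d + 1, by rw [mul_add]; omega⟩
        simp only [hh, h1, cond_true, Nat.succ_div, if_pos h2]
        rw [Nat.mod_eq_zero_of_dvd h2]
      · have h1 : Nat.beq (i % d + 1) d = false := by
          rw [← Bool.not_eq_true, Nat.beq_eq]; exact hd
        have h2 : (i + 1) % d = i % d + 1 := by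
          rcases Nat.eq_zero_or_pos d with rfl | hpos
          · simp
          · have := Nat.mod_lt i hpos
            rw [Nat.add_mod, Nat.mod_eq_of_lt (a := i % d + 1 % d)]
            · rw [Nat.mod_eq_of_lt (a := 1) (by omega)]
            · rw [Nat.mod_eq_of_lt (a := 1) (by omega)]; omega
        have h3 : ¬ d ∣ i + 1 := fun hdvd => by
          have := Nat.mod_eq_zero_of_dvd hdvd
          omega
        simp only [hh, h1, cond_false, Nat.succ_div, if_neg h3, h2, add_zero]
  have key : PSpace fun x => (h (g x))^[f x] (0, 0) := by
    refine iterate_with hf (const (0, 0)) (by simp only [hh]; fun_prop) hf.polyBits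
      fun x i hi => ?_
    rw [it, mag_prod, mag_nat, mag_nat, mag_nat]
    exact max_le ((Nat.div_le_self _ _).trans hi) ((Nat.mod_le _ _).trans hi)
  exact key.congr fun x => it _ _

@[fun_prop]
theorem div {f g : α → ℕ} (hf : PSpace f) (hg : PSpace g) : PSpace fun x => f x / g x :=
  fst.comp (hf.divMod hg)

@[fun_prop]
theorem mod {f g : α → ℕ} (hf : PSpace f) (hg : PSpace g) : PSpace fun x => f x % g x :=
  snd.comp (hf.divMod hg)

/-- Powers are computable in polynomial space only if the exponent is small. -/
theorem pow {f g : α → ℕ} (hf : PSpace f) (hg : PSpace g) (hl : PolyLength g) :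
    PSpace fun x => f x ^ g x := by
  have it : ∀ a i : ℕ, (fun v => v * a)^[i] 1 = a ^ i := fun a i => by
    induction i with
    | zero => rfl
    | succ i ih => rw [Function.iterate_succ_apply', ih, pow_succ]
  have key : PSpace fun x => (fun v => v * f x)^[g x] 1 := by
    refine iterate_with hg (const 1) (by fun_prop)
      ((PolyBits.const 1).max (hf.polyBits.pow hl)) fun x i hi => ?_
    rw [it, mag_nat, mag_nat]
    rcases Nat.eq_zero_or_pos (f x) with h | h
    · rw [h]
      rcases i with _ | i
      · simp
      · simp
    · exact (Nat.pow_le_pow_right h hi).trans (le_max_right _ _)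
  exact key.congr fun x => it _ _

/-- Search for a witness below a bound. -/
theorem exists_lt {N : α → ℕ} {p : α → ℕ → Bool} (hN : PSpace N)
    (hp : PSpace fun y : α × ℕ => p y.1 y.2) :
    PSpace fun x => decide (∃ i < N x, p x i = true) := by
  set h : α → ℕ × Bool → ℕ × Bool := fun x y => (y.1 + 1, y.2 || p x y.1) with hh
  have it : ∀ x i, (h x)^[i] (0, false) = (i, decide (∃ j < i, p x j = true)) := fun x i => by
    induction i with
    | zero => simp
    | succ i ih =>
      rw [Function.iterate_succ_apply', ih]
      simp only [hh, Prod.mk.injEq, true_and]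
      rw [Bool.eq_iff_iff]
      simp only [Bool.or_eq_true, decide_eq_true_eq]
      constructor
      · rintro (⟨j, hj, h⟩ | h)
        · exact ⟨j, by omega, h⟩
        · exact ⟨i, by omega, h⟩
      · rintro ⟨j, hj, h⟩
        rcases Nat.lt_succ_iff_lt_or_eq.1 hj with hj | rfl
        · exact Or.inl ⟨j, hj, h⟩
        · exact Or.inr h
  have hp' : PSpace fun y : α × (ℕ × Bool) => p y.1 y.2.1 :=
    hp.comp (f := fun y : α × (ℕ × Bool) => (y.1, y.2.1)) (by fun_prop)
  have key : PSpace fun x => (h x)^[N x] (0, false) := by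
    refine iterate_with hN (const (0, false)) (by simp only [hh]; fun_prop)
      (hN.polyBits.max (PolyBits.const 1)) fun x i hi => ?_
    rw [it, mag_prod, mag_nat, mag_nat]
    exact max_le_max hi (mag_bool _)
  exact (snd.comp key).congr fun x => by rw [it]

/-! ### Words -/

@[fun_prop]
theorem numeral {f : α → List (Fin 12)} (hf : PSpace f) :
    PSpace fun x => CounterProg.numeral (f x) := hf

theorem of_numeral {f : α → List (Fin 12)} (hf : PSpace fun x => CounterProg.numeral (f x)) :
    PSpace f := hf

@[fun_prop]
theorem digitVal {f : α → Fin 12} (hf : PSpace f) : PSpace fun x => ((f x : Fin 12) : ℕ) := hf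

theorem of_digitVal {f : α → Fin 12} (hf : PSpace fun x => ((f x : Fin 12) : ℕ)) : PSpace f := hf

@[fun_prop]
theorem tail {f : α → List (Fin 12)} (hf : PSpace f) : PSpace fun x => (f x).tail := by
  have key : PSpace fun x => (CounterProg.numeral (f x) - 1) / 12 := by fun_prop
  refine of_numeral (key.congr fun x => ?_)
  rcases f x with _ | ⟨d, l⟩
  · rfl
  · simp only [CounterProg.numeral, List.tail_cons]; omega

@[fun_prop]
theorem headD {f : α → List (Fin 12)} (hf : PSpace f) : PSpace fun x => (f x).headD 0 := by
  have key : PSpace fun x => (CounterProg.numeral (f x) - 1) % 12 := by fun_prop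
  refine of_digitVal (key.congr fun x => ?_)
  rcases f x with _ | ⟨d, l⟩
  · rfl
  · simp only [CounterProg.numeral, List.headD_cons]; omega

@[fun_prop]
theorem isEmpty {f : α → List (Fin 12)} (hf : PSpace f) : PSpace fun x => (f x).isEmpty := by
  have key : PSpace fun x => Nat.beq (CounterProg.numeral (f x)) 0 := by fun_prop
  refine key.congr fun x => ?_
  rcases f x with _ | ⟨d, l⟩
  · rfl
  · rw [Bool.eq_iff_iff, Nat.beq_eq]
    simp [CounterProg.numeral]

@[fun_prop]
theorem cons {f : α → Fin 12} {g : α → List (Fin 12)} (hf : PSpace f) (hg : PSpace g) :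
    PSpace fun x => f x :: g x := by
  have key : PSpace fun x => (f x : ℕ) + 1 + 12 * CounterProg.numeral (g x) := by fun_prop
  exact of_numeral key

theorem length_le_numeral (l : List (Fin 12)) : l.length ≤ CounterProg.numeral l := by
  induction l with
  | nil => simp
  | cons d l ih => simp only [List.length_cons, CounterProg.numeral]; omega

/-- A left fold over a word, with a parameter. -/
theorem foldl {l : α → List (Fin 12)} {f : α → β} {h : α → β → Fin 12 → β} (hl : PSpace l)
    (hf : PSpace f) (hh : PSpace fun y : α × β × Fin 12 => h y.1 y.2.1 y.2.2) {G : α → ℕ}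
    (hG : PolyBits G) (hb : ∀ x, ∀ u, u <+: l x → mag (u.foldl (h x) (f x)) ≤ G x) :
    PSpace fun x => (l x).foldl (h x) (f x) := by
  set s : α → List (Fin 12) × β → List (Fin 12) × β := fun x y =>
    bif y.1.isEmpty then y else (y.1.tail, h x y.2 (y.1.headD 0)) with hs
  have it : ∀ (x : α) (i : ℕ) (u : List (Fin 12)) (v : β),
      (s x)^[i] (u, v) = (u.drop i, (u.take i).foldl (h x) v) := by
    intro x i
    induction i with
    | zero => intro u v; simp
    | succ i ih =>
      intro u v
      rw [Function.iterate_succ_apply]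
      rcases u with _ | ⟨d, u⟩
      · rw [show s x ([], v) = ([], v) from rfl, ih]; simp
      · rw [show s x (d :: u, v) = (u, h x v d) from rfl, ih]; simp
  have hh' : PSpace fun y : α × (List (Fin 12) × β) => h y.1 y.2.2 (y.2.1.headD 0) :=
    hh.comp (f := fun y : α × (List (Fin 12) × β) => (y.1, y.2.2, y.2.1.headD 0)) (by fun_prop)
  have hdrop : ∀ (u : List (Fin 12)) (i : ℕ),
      CounterProg.numeral (u.drop i) ≤ CounterProg.numeral u := by
    intro u
    induction u with
    | nil => simp
    | cons d u ih =>
      rintro (_ | i)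
      · simp
      · have := ih i
        simp only [List.drop_succ_cons, CounterProg.numeral]; omega
  have key : PSpace fun x => (s x)^[CounterProg.numeral (l x)] (l x, f x) := by
    refine iterate_with (by fun_prop) (by fun_prop) (by simp only [hs]; fun_prop)
      (hl.polyBits.max hG) fun x i hi => ?_
    rw [it, mag_prod]
    refine max_le_max ?_ (hb x _ (List.take_prefix _ _))
    simpa using hdrop (l x) i
  refine (snd.comp key).congr fun x => ?_
  rw [it, List.take_of_length_le (length_le_numeral _)]

@[fun_prop]
theorem length {f : α → List (Fin 12)} (hf : PSpace f) : PSpace fun x => (f x).length := by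
  have it : ∀ (l : List (Fin 12)) (n : ℕ), l.foldl (fun v _ => v + 1) n = n + l.length := by
    intro l
    induction l with
    | nil => simp
    | cons d l ih => intro n; rw [List.foldl_cons, ih, List.length_cons]; ring
  have key : PSpace fun x => (f x).foldl (fun v _ => v + 1) 0 := by
    refine foldl hf (const 0) (by fun_prop) hf.polyBits fun x u hu => ?_
    rw [it, mag_nat, mag_word, zero_add]
    exact hu.length_le.trans (length_le_numeral _)
  exact key.congr fun x => by rw [it, zero_add]

end PSpace

/-! ### Evaluation of games -/

/-- The value of a game of `r` rounds: in every round, the first player chooses a number `m < M`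
and the second player chooses between the two continuations with the moves `2 * m` and `2 * m + 1`;
the first player wants to reach a final position where `leaf` is true. -/
def gameValue {β : Type} (M : ℕ) (g : β → ℕ → β) (leaf : β → Bool) : ℕ → β → Bool
  | 0, p => leaf p
  | r + 1, p => decide (∃ m < M, gameValue M g leaf r (g p (2 * m)) = true ∧
      gameValue M g leaf r (g p (2 * m + 1)) = true)

/-- The position reached from `p` after `j` rounds with the moves given by the last `j` digits of
`c` in base `b`, most significant digit first. -/
def positionAfter {β : Type} (b : ℕ) (g : β → ℕ → β) (p : β) : ℕ → ℕ → β
  | 0, _ => p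
  | j + 1, c => g (positionAfter b g p j (c / b)) (c % b)

/-- One step of the traversal of the game tree. The state `(i, c, s)` stands at the node which has
`i` rounds to go and was reached with the moves that are the digits of `c`; it is about to evaluate
this node if `s = 0`, and has found the node false or true if `s = 1` or `s = 2`. -/
def gameStep (M R : ℕ) (leaf : ℕ → Bool) (y : ℕ × ℕ × ℕ) : ℕ × ℕ × ℕ :=
  bif Nat.beq y.2.2 0 then
    bif Nat.beq y.1 0 then (0, y.2.1, bif leaf y.2.1 then 2 else 1)
    else (y.1 - 1, y.2.1 * (2 * M), 0)
  else bif Nat.ble R y.1 then y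
  else bif Nat.beq y.2.2 2 then
    bif Nat.beq (y.2.1 % (2 * M) % 2) 0 then (y.1, y.2.1 + 1, 0)
    else (y.1 + 1, y.2.1 / (2 * M), 2)
  else
    bif Nat.ble (y.2.1 % (2 * M) / 2 + 2) M then
      (y.1, 2 * M * (y.2.1 / (2 * M)) + 2 * (y.2.1 % (2 * M) / 2 + 1), 0)
    else (y.1 + 1, y.2.1 / (2 * M), 1)

section
variable {M R : ℕ} {leaf : ℕ → Bool}

theorem beq_false_of_ne' {a b : ℕ} (h : a ≠ b) : Nat.beq a b = false := by
  rw [← Bool.not_eq_true, Nat.beq_eq]; exact h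

theorem ble_false_of_lt {a b : ℕ} (h : b < a) : Nat.ble a b = false := by
  rw [← Bool.not_eq_true, Nat.ble_eq]; omega

theorem gameStep_leaf (c : ℕ) :
    gameStep M R leaf (0, c, 0) = (0, c, bif leaf c then 2 else 1) := rfl

theorem gameStep_down (i c : ℕ) : gameStep M R leaf (i + 1, c, 0) = (i, c * (2 * M), 0) := rfl

theorem gameStep_done (c s : ℕ) (hs : s ≠ 0) : gameStep M R leaf (R, c, s) = (R, c, s) := by
  simp only [gameStep, beq_false_of_ne' hs, Nat.ble_eq_true_of_le (le_refl R)]; rfl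

theorem gameStep_true_left {i c m : ℕ} (hi : i < R) (hm : m < M) :
    gameStep M R leaf (i, c * (2 * M) + 2 * m, 2) = (i, c * (2 * M) + (2 * m + 1), 0) := by
  have h : (c * (2 * M) + 2 * m) % (2 * M) = 2 * m := by
    rw [Nat.mul_add_mod_self_right, Nat.mod_eq_of_lt (by omega)]
  have h3 : Nat.beq (2 * m % 2) 0 = true := by rw [Nat.beq_eq]; omega
  simp only [gameStep, ble_false_of_lt hi, h, h3]
  rfl

theorem gameStep_true_right {i c m : ℕ} (hi : i < R) (hm : m < M) :
    gameStep M R leaf (i, c * (2 * M) + (2 * m + 1), 2) = (i + 1, c, 2) := by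
  have h : (c * (2 * M) + (2 * m + 1)) % (2 * M) = 2 * m + 1 := by
    rw [Nat.mul_add_mod_self_right, Nat.mod_eq_of_lt (by omega)]
  have h2 : (c * (2 * M) + (2 * m + 1)) / (2 * M) = c := by
    rw [mul_comm, Nat.mul_add_div (by omega), Nat.div_eq_of_lt (by omega), add_zero]
  have h3 : Nat.beq ((2 * m + 1) % 2) 0 = false := beq_false_of_ne' (by omega)
  simp only [gameStep, ble_false_of_lt hi, h, h2, h3]
  rfl

theorem gameStep_false {i c d m : ℕ} (hi : i < R) (hm : m < M) (hd : d = 2 * m ∨ d = 2 * m + 1) :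
    gameStep M R leaf (i, c * (2 * M) + d, 1) =
      if m + 1 < M then (i, c * (2 * M) + 2 * (m + 1), 0) else (i + 1, c, 1) := by
  have h : (c * (2 * M) + d) % (2 * M) = d := by
    rw [Nat.mul_add_mod_self_right, Nat.mod_eq_of_lt (by omega)]
  have h2 : (c * (2 * M) + d) / (2 * M) = c := by
    rw [mul_comm, Nat.mul_add_div (by omega), Nat.div_eq_of_lt (by omega), add_zero]
  have h3 : d / 2 = m := by omega
  simp only [gameStep, ble_false_of_lt hi, h, h2, h3]
  split_ifs with hM
  · rw [Nat.ble_eq_true_of_le (show m + 2 ≤ M by omega), mul_comm c]; rfl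
  · rw [ble_false_of_lt (show M < m + 2 by omega)]; rfl

/-- The traversal evaluates a node with `r` rounds to go in at most `(6 * M) ^ r` steps. -/
theorem exists_gameStep_iterate {β : Type} {g : β → ℕ → β} {fin : β → Bool} {p : β} (hM : 0 < M)
    (hleaf : ∀ c, leaf c = fin (positionAfter (2 * M) g p R c)) (r : ℕ) (hr : r ≤ R) (c : ℕ) :
    ∃ t ≤ (6 * M) ^ r, (gameStep M R leaf)^[t] (r, c, 0) =
      (r, c, bif gameValue M g fin r (positionAfter (2 * M) g p (R - r) c) then 2 else 1) := by
  induction r generalizing c with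
  | zero => exact ⟨1, le_rfl, by simp [gameStep_leaf, hleaf, gameValue]⟩
  | succ r ih =>
    set q := positionAfter (2 * M) g p (R - (r + 1)) c with hq
    have hpos : ∀ d < 2 * M,
        positionAfter (2 * M) g p (R - r) (c * (2 * M) + d) = g q d := by
      intro d hd
      rw [show R - r = (R - (r + 1)) + 1 by omega, positionAfter, Nat.mul_add_mod_self_right,
        Nat.mod_eq_of_lt hd, mul_comm c, Nat.mul_add_div (by omega), Nat.div_eq_of_lt hd, add_zero]
    -- evaluation of the moves from `m` on
    have hmoves : ∀ k m, m + (k + 1) = M → ∃ t ≤ 2 * (k + 1) * ((6 * M) ^ r + 1),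
        (gameStep M R leaf)^[t] (r, c * (2 * M) + 2 * m, 0) = (r + 1, c,
          bif decide (∃ m' < M, m ≤ m' ∧ gameValue M g fin r (g q (2 * m')) = true ∧
            gameValue M g fin r (g q (2 * m' + 1)) = true) then 2 else 1) := by
      intro k
      induction k with
      | zero =>
        intro m hm
        obtain ⟨t₁, ht₁, h₁⟩ := ih (by omega) (c * (2 * M) + 2 * m)
        obtain ⟨t₂, ht₂, h₂⟩ := ih (by omega) (c * (2 * M) + (2 * m + 1))
        rw [hpos _ (by omega)] at h₁ h₂
        have hex : ∀ P : ℕ → Prop, (∃ m' < M, m ≤ m' ∧ P m') ↔ P m := fun P =>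
          ⟨fun ⟨m', h1, h2, h3⟩ => (show m' = m by omega) ▸ h3, fun h => ⟨m, by omega, le_rfl, h⟩⟩
        simp only [hex]
        cases hv₁ : gameValue M g fin r (g q (2 * m))
        · refine ⟨1 + t₁, by omega, ?_⟩
          rw [Function.iterate_add_apply, h₁, hv₁]
          simp [gameStep_false (c := c) (show r < R by omega) (show m < M by omega) (Or.inl rfl),
            show ¬ (m + 1 < M) by omega]
        · refine ⟨1 + (t₂ + (1 + t₁)), by omega, ?_⟩
          rw [Function.iterate_add_apply, Function.iterate_add_apply, Function.iterate_add_apply,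
            h₁, hv₁, cond_true, Function.iterate_one,
            gameStep_true_left (by omega) (by omega), h₂]
          cases hv₂ : gameValue M g fin r (g q (2 * m + 1))
          · simp [gameStep_false (c := c) (show r < R by omega) (show m < M by omega)
              (Or.inr rfl), show ¬ (m + 1 < M) by omega]
          · simp [gameStep_true_right (c := c) (show r < R by omega) (show m < M by omega)]
      | succ k ihk =>
        intro m hm
        obtain ⟨t₁, ht₁, h₁⟩ := ih (by omega) (c * (2 * M) + 2 * m)
        obtain ⟨t₂, ht₂, h₂⟩ := ih (by omega) (c * (2 * M) + (2 * m + 1))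
        obtain ⟨t₃, ht₃, h₃⟩ := ihk (m + 1) (by omega)
        rw [hpos _ (by omega)] at h₁ h₂
        have hex : ∀ P : ℕ → Prop, (∃ m' < M, m ≤ m' ∧ P m') ↔
            P m ∨ ∃ m' < M, m + 1 ≤ m' ∧ P m' := by
          intro P
          constructor
          · rintro ⟨m', h1, h2, h3⟩
            rcases Nat.eq_or_lt_of_le h2 with rfl | h2
            · exact Or.inl h3
            · exact Or.inr ⟨m', h1, h2, h3⟩
          · rintro (h | ⟨m', h1, h2, h3⟩)
            · exact ⟨m, by omega, le_rfl, h⟩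
            · exact ⟨m', h1, by omega, h3⟩
        have hsum : t₃ + (1 + (t₂ + (1 + t₁))) ≤ 2 * (k + 1 + 1) * ((6 * M) ^ r + 1) := by
          calc _ ≤ 2 * (k + 1) * ((6 * M) ^ r + 1) + 2 * ((6 * M) ^ r + 1) := by omega
            _ = _ := by ring
        simp only [hex]
        cases hv₁ : gameValue M g fin r (g q (2 * m))
        · refine ⟨t₃ + (1 + t₁), by omega, ?_⟩
          rw [Function.iterate_add_apply, Function.iterate_add_apply, h₁, hv₁, cond_false,
            Function.iterate_one, gameStep_false (m := m) (by omega) (by omega) (Or.inl rfl),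
            if_pos (by omega), h₃]
          simp
        · cases hv₂ : gameValue M g fin r (g q (2 * m + 1))
          · refine ⟨t₃ + (1 + (t₂ + (1 + t₁))), hsum, ?_⟩
            rw [Function.iterate_add_apply, Function.iterate_add_apply, Function.iterate_add_apply,
              Function.iterate_add_apply, h₁, hv₁, cond_true, Function.iterate_one,
              gameStep_true_left (by omega) (by omega), h₂, hv₂, cond_false,
              gameStep_false (m := m) (by omega) (by omega) (Or.inr rfl), if_pos (by omega), h₃]
            simp
          · refine ⟨1 + (t₂ + (1 + t₁)), by omega, ?_⟩
            rw [Function.iterate_add_apply, Function.iterate_add_apply, Function.iterate_add_apply,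
              h₁, hv₁, cond_true, Function.iterate_one,
              gameStep_true_left (by omega) (by omega), h₂, hv₂, cond_true,
              gameStep_true_right (by omega) (by omega)]
            simp
    obtain ⟨t, ht, h⟩ := hmoves (M - 1) 0 (by omega)
    refine ⟨t + 1, ?_, ?_⟩
    · rw [show M - 1 + 1 = M by omega] at ht
      have h1 : 1 ≤ (6 * M) ^ r := Nat.one_le_pow _ _ (by omega)
      calc t + 1 ≤ 2 * M * ((6 * M) ^ r + 1) + 1 := by omega
        _ ≤ (6 * M) ^ (r + 1) := by rw [pow_succ]; nlinarith
    · rw [Function.iterate_succ_apply, gameStep_down]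
      rw [mul_zero, add_zero] at h
      rw [h]
      simp [gameValue]

/-- All nodes visited by the traversal lie in the tree. -/
theorem gameStep_invariant {y : ℕ × ℕ × ℕ} (hM : 0 < M)
    (h : y.1 ≤ R ∧ y.2.1 < (2 * M) ^ (R - y.1) ∧ y.2.2 ≤ 2) :
    (gameStep M R leaf y).1 ≤ R ∧
      (gameStep M R leaf y).2.1 < (2 * M) ^ (R - (gameStep M R leaf y).1) ∧
      (gameStep M R leaf y).2.2 ≤ 2 := by
  obtain ⟨i, c, s⟩ := y
  obtain ⟨hi, hc, hs⟩ := h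
  dsimp only at hi hc hs
  by_cases hs0 : s = 0
  · subst hs0
    rcases i with _ | i
    · rw [gameStep_leaf]
      exact ⟨Nat.zero_le _, hc, by cases leaf c <;> simp⟩
    · rw [gameStep_down]
      refine ⟨by dsimp only; omega, ?_, by simp⟩
      dsimp only
      rw [show R - i = R - (i + 1) + 1 by omega, pow_succ]
      exact Nat.mul_lt_mul_of_pos_right hc (by omega)
  · rcases Nat.eq_or_lt_of_le hi with rfl | hi
    · rw [gameStep_done _ _ hs0]; exact ⟨le_rfl, hc, hs⟩
    · have hpow : (2 * M) ^ (R - i) = (2 * M) ^ (R - (i + 1)) * (2 * M) := by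
        rw [← pow_succ]; congr 1; omega
      have hc' : c / (2 * M) < (2 * M) ^ (R - (i + 1)) := by
        rw [Nat.div_lt_iff_lt_mul (by omega), ← hpow]; exact hc
      obtain ⟨e, d, hd, rfl⟩ : ∃ e d, d < 2 * M ∧ c = e * (2 * M) + d :=
        ⟨c / (2 * M), c % (2 * M), Nat.mod_lt _ (by omega), (Nat.div_add_mod' c (2 * M)).symm⟩
      have he : (e * (2 * M) + d) / (2 * M) = e := by
        rw [mul_comm, Nat.mul_add_div (by omega), Nat.div_eq_of_lt hd, add_zero]
      rw [he] at hc'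
      have hlt : ∀ d' < 2 * M, e * (2 * M) + d' < (2 * M) ^ (R - i) := by
        intro d' hd'
        rw [hpow]
        nlinarith
      have hs' : s = 1 ∨ s = 2 := by omega
      rcases hs' with rfl | rfl
      · rw [gameStep_false (m := d / 2) hi (by omega) (by omega)]
        split_ifs with hM'
        · exact ⟨hi.le, hlt _ (by omega), by simp⟩
        · exact ⟨hi, hc', by simp⟩
      · rcases Nat.even_or_odd' d with ⟨m, rfl | rfl⟩
        · rw [gameStep_true_left hi (by omega)]
          exact ⟨hi.le, hlt _ (by omega), by simp⟩
        · rw [gameStep_true_right hi (by omega)]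
          exact ⟨hi, hc', by simp⟩

end

open CounterProg in
/-- Games with polynomially many rounds are evaluated in polynomial space, if moves and positions
have polynomially many bits. -/
theorem PSpace.gameValue {α β : Type} [Coded α] [Coded β] {M R : α → ℕ} {p : α → β}
    {g : α → β → ℕ → β} {fin : α → β → Bool} (hM : PSpace M) (hR : PSpace R) (hp : PSpace p)
    (hg : PSpace fun y : α × β × ℕ => g y.1 y.2.1 y.2.2)
    (hfin : PSpace fun y : α × β => fin y.1 y.2) (hM0 : ∀ x, 0 < M x) (hRl : PolyLength R)
    {G : α → ℕ} (hG : PolyBits G)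
    (hb : ∀ x, ∀ i ≤ R x, ∀ c, mag (positionAfter (2 * M x) (g x) (p x) i c) ≤ G x) :
    PSpace fun x => gameValue (M x) (g x) (fin x) (R x) (p x) := by
  -- only the moves are stored; the position is recomputed from them
  have hpos : PSpace fun y : α × ℕ => positionAfter (2 * M y.1) (g y.1) (p y.1) (R y.1) y.2 := by
    have hstep : PSpace fun z : (α × ℕ) × (ℕ × β) =>
        ((2 * M z.1.1) ^ (R z.1.1 - (z.2.1 + 1)), z) := by
      refine PSpace.prodMk (PSpace.pow (by fun_prop) (by fun_prop) ?_) PSpace.id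
      have h1 : PSpace fun z : (α × ℕ) × (ℕ × β) => z.1.1 := by fun_prop
      exact (hRl.comp h1.polyBits).of_le fun z => Nat.sub_le _ _
    have hstep' : PSpace fun z : (α × ℕ) × (ℕ × β) =>
        (z.2.1 + 1, g z.1.1 z.2.2
          (z.1.2 / (2 * M z.1.1) ^ (R z.1.1 - (z.2.1 + 1)) % (2 * M z.1.1))) := by
      have h2 : PSpace fun w : ℕ × ((α × ℕ) × (ℕ × β)) =>
          (w.2.2.1 + 1, g w.2.1.1 w.2.2.2 (w.2.1.2 / w.1 % (2 * M w.2.1.1))) :=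
        PSpace.prodMk (by fun_prop) (hg.comp (f := fun w : ℕ × ((α × ℕ) × (ℕ × β)) =>
          (w.2.1.1, w.2.2.2, w.2.1.2 / w.1 % (2 * M w.2.1.1))) (by fun_prop))
      exact h2.comp hstep
    have it : ∀ y : α × ℕ, ∀ i ≤ R y.1, (fun v : ℕ × β => (v.1 + 1, g y.1 v.2
        (y.2 / (2 * M y.1) ^ (R y.1 - (v.1 + 1)) % (2 * M y.1))))^[i] (0, p y.1) =
        (i, positionAfter (2 * M y.1) (g y.1) (p y.1) i (y.2 / (2 * M y.1) ^ (R y.1 - i))) := by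
      intro y i
      induction i with
      | zero => intro _; rfl
      | succ i ih =>
        intro hi
        rw [Function.iterate_succ_apply', ih (by omega), positionAfter, Nat.div_div_eq_div_mul,
          ← pow_succ, show R y.1 - (i + 1) + 1 = R y.1 - i by omega]
    have h1 : PSpace fun y : α × ℕ => y.1 := by fun_prop
    have key := iterate_with (N := fun y : α × ℕ => R y.1) (f := fun y : α × ℕ => ((0 : ℕ), p y.1))
      (h := fun y v => (v.1 + 1, g y.1 v.2
        (y.2 / (2 * M y.1) ^ (R y.1 - (v.1 + 1)) % (2 * M y.1)))) (by fun_prop) (by fun_prop)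
      hstep' ((hR.comp h1).polyBits.max (hG.comp h1.polyBits)) (fun y i hi => by
        rw [it y i hi, mag_prod]
        exact max_le_max (by simpa using hi) (hb _ i hi _))
    refine (snd.comp key).congr fun y => ?_
    rw [it y _ le_rfl]; simp
  have hleaf : PSpace fun y : α × ℕ =>
      fin y.1 (positionAfter (2 * M y.1) (g y.1) (p y.1) (R y.1) y.2) :=
    hfin.comp (PSpace.prodMk (by fun_prop) hpos)
  have hleaf' : PSpace fun y : α × (ℕ × ℕ × ℕ) =>
      fin y.1 (positionAfter (2 * M y.1) (g y.1) (p y.1) (R y.1) y.2.2.1) :=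
    hleaf.comp (f := fun y : α × (ℕ × ℕ × ℕ) => (y.1, y.2.2.1)) (by fun_prop)
  -- a step evaluates at most the leaf at which it stands, so this value may be computed beforehand
  have hstep : PSpace fun w : Bool × (α × (ℕ × ℕ × ℕ)) =>
      gameStep (M w.2.1) (R w.2.1) (fun _ => w.1) w.2.2 := by
    unfold gameStep; beta_reduce; fun_prop
  have hpow : PSpace fun x => (6 * M x) ^ R x := PSpace.pow (by fun_prop) hR hRl
  have hpow2 : PSpace fun x => (2 * M x) ^ R x := PSpace.pow (by fun_prop) hR hRl
  have hinv : ∀ (x : α) (leaf : ℕ → Bool) (i : ℕ),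
      ((gameStep (M x) (R x) leaf)^[i] (R x, 0, 0)).1 ≤ R x ∧
      ((gameStep (M x) (R x) leaf)^[i] (R x, 0, 0)).2.1 <
        (2 * M x) ^ (R x - ((gameStep (M x) (R x) leaf)^[i] (R x, 0, 0)).1) ∧
      ((gameStep (M x) (R x) leaf)^[i] (R x, 0, 0)).2.2 ≤ 2 := by
    intro x leaf i
    induction i with
    | zero => simp
    | succ i ih =>
      rw [Function.iterate_succ_apply']
      exact gameStep_invariant (hM0 x) ih
  have key := iterate_with (N := fun x => (6 * M x) ^ R x)
    (f := fun x => (R x, (0 : ℕ), (0 : ℕ)))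
    (h := fun x => gameStep (M x) (R x)
      fun c => fin x (positionAfter (2 * M x) (g x) (p x) (R x) c))
    hpow (by fun_prop) (hstep.comp (hleaf'.prodMk PSpace.id))
    (hR.polyBits.max (hpow2.polyBits.max (PolyBits.const 2)))
    (fun x i _ => by
      obtain ⟨h1, h2, h3⟩ := hinv x
        (fun c => fin x (positionAfter (2 * M x) (g x) (p x) (R x) c)) i
      rw [mag_prod, mag_prod, mag_nat, mag_nat, mag_nat, mag_nat, mag_nat]
      refine max_le_max h1 (max_le_max (h2.le.trans ?_) h3)
      exact Nat.pow_le_pow_right (by have := hM0 x; omega) (Nat.sub_le _ _))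
  -- the traversal stops changing when it has finished, so it may be run for too many steps
  have hres : PSpace fun x => Nat.beq (((gameStep (M x) (R x)
      fun c => fin x (positionAfter (2 * M x) (g x) (p x) (R x) c))^[(6 * M x) ^ R x]
        (R x, 0, 0)).2.2) 2 := by
    have h2 : PSpace fun y : ℕ × ℕ × ℕ => Nat.beq y.2.2 2 := by fun_prop
    exact h2.comp key
  refine hres.congr fun x => ?_
  obtain ⟨t, ht, h⟩ := exists_gameStep_iterate (g := g x) (fin := fin x) (p := p x) (R := R x)
    (hM0 x) (fun c => rfl) (R x) le_rfl 0
  obtain ⟨s, hs⟩ := Nat.exists_eq_add_of_le ht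
  rw [hs, add_comm t, Function.iterate_add_apply, h, Nat.sub_self, positionAfter]
  have hfix : ∀ v, v ≠ 0 → (gameStep (M x) (R x)
      fun c => fin x (positionAfter (2 * M x) (g x) (p x) (R x) c))^[s] (R x, 0, v) =
        (R x, 0, v) := fun v hv => Function.iterate_fixed (gameStep_done 0 v hv) s
  rw [hfix _ (by cases _root_.gameValue (M x) (g x) (fin x) (R x) (p x) <;> simp)]
  cases _root_.gameValue (M x) (g x) (fin x) (R x) (p x) <;> rfl

/-! ### Words of input symbols -/

/-- The identification of the input symbols with the digits of the machine. -/
def symbolEquiv : InputSymbol ≃ Fin 12 where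
  toFun
    | .hash => 0
    | .bit false => 1
    | .bit true => 2
    | .minus => 3
    | .slash => 4
    | .sep => 5
    | .letter => 6
    | .empty => 7
    | .eps => 8
    | .plus => 9
    | .comp => 10
    | .star => 11
  invFun := ![.hash, .bit false, .bit true, .minus, .slash, .sep, .letter, .empty, .eps, .plus,
    .comp, .star]
  left_inv := by
    intro s
    cases s with
    | bit b => cases b <;> rfl
    | _ => rfl
  right_inv := by decide

namespace Coded

/-- A symbol is presented as a digit. -/
instance : Coded InputSymbol := ⟨1, fun s => [(symbolEquiv s : ℕ)], fun _ => rfl⟩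

/-- A word is presented as the number of which it is the numeral. -/
instance : Coded (List InputSymbol) :=
  ⟨1, fun l => [CounterProg.numeral (l.map symbolEquiv)], fun _ => rfl⟩

@[simp] theorem mag_symbols (l : List InputSymbol) :
    mag l = CounterProg.numeral (l.map symbolEquiv) := by simp [mag, code]

end Coded

theorem mag_symbols_le_of_suffix {u l : List InputSymbol} (h : u <:+ l) : mag u ≤ mag l := by
  obtain ⟨v, rfl⟩ := h
  simp only [mag_symbols]
  induction v with
  | nil => exact le_rfl
  | cons s v ih => simp only [List.cons_append, List.map_cons, CounterProg.numeral]; omega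

theorem length_symbols_polyLength : PolyLength fun l : List InputSymbol => l.length :=
  ⟨1, fun l => by
    have := CounterProg.length_le_size_numeral (l.map symbolEquiv)
    rw [List.length_map] at this
    rw [mag_symbols, pow_one]
    show l.length ≤ _
    omega⟩

theorem two_pow_length_polyBits : PolyBits fun l : List InputSymbol => 2 ^ l.length :=
  (PolyBits.const 2).pow length_symbols_polyLength

/-- The first symbol of a word, `hash` for the empty word. -/
def headSymbol (l : List InputSymbol) : InputSymbol := l.headD .hash

@[simp] theorem headSymbol_cons (s : InputSymbol) (l : List InputSymbol) :
    headSymbol (s :: l) = s := rfl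

namespace PSpace
variable {α β : Type} [Coded α] [Coded β]

/-- Every function of a single symbol is computable. -/
theorem ofSymbol (φ : InputSymbol → β) : PSpace φ := by
  have hval : PSpace fun s : InputSymbol => (symbolEquiv s : ℕ) := (PSpace.id (α := InputSymbol))
  have key : PSpace fun s : InputSymbol =>
      bif Nat.beq (symbolEquiv s : ℕ) 0 then φ .hash else
      bif Nat.beq (symbolEquiv s : ℕ) 1 then φ (.bit false) else
      bif Nat.beq (symbolEquiv s : ℕ) 2 then φ (.bit true) else
      bif Nat.beq (symbolEquiv s : ℕ) 3 then φ .minus else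
      bif Nat.beq (symbolEquiv s : ℕ) 4 then φ .slash else
      bif Nat.beq (symbolEquiv s : ℕ) 5 then φ .sep else
      bif Nat.beq (symbolEquiv s : ℕ) 6 then φ .letter else
      bif Nat.beq (symbolEquiv s : ℕ) 7 then φ .empty else
      bif Nat.beq (symbolEquiv s : ℕ) 8 then φ .eps else
      bif Nat.beq (symbolEquiv s : ℕ) 9 then φ .plus else
      bif Nat.beq (symbolEquiv s : ℕ) 10 then φ .comp else φ .star := by
    fun_prop
  refine key.congr fun s => ?_
  cases s with
  | bit b => cases b <;> rfl
  | _ => rfl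

theorem map_symbolEquiv {f : α → List InputSymbol} (hf : PSpace f) :
    PSpace fun x => (f x).map symbolEquiv := hf

theorem of_map_symbolEquiv {f : α → List InputSymbol}
    (hf : PSpace fun x => (f x).map symbolEquiv) : PSpace f := hf

@[fun_prop]
theorem symbolsTail {f : α → List InputSymbol} (hf : PSpace f) : PSpace fun x => (f x).tail :=
  of_map_symbolEquiv ((map_symbolEquiv hf).tail.congr fun _ => List.map_tail.symm)

@[fun_prop]
theorem headSymbol {f : α → List InputSymbol} (hf : PSpace f) :
    PSpace fun x => headSymbol (f x) := by
  have key : PSpace fun x => ((f x).map symbolEquiv).headD 0 := (map_symbolEquiv hf).headD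
  have key' : PSpace fun x => symbolEquiv (_root_.headSymbol (f x)) :=
    key.congr fun x => by rcases f x with _ | ⟨s, l⟩ <;> rfl
  exact key'

@[fun_prop]
theorem symbolsLength {f : α → List InputSymbol} (hf : PSpace f) :
    PSpace fun x => (f x).length :=
  (map_symbolEquiv hf).length.congr fun _ => List.length_map _

@[fun_prop]
theorem symbolsCons {f : α → InputSymbol} {g : α → List InputSymbol} (hf : PSpace f)
    (hg : PSpace g) : PSpace fun x => f x :: g x := by
  have hf' : PSpace fun x => symbolEquiv (f x) := hf
  exact of_map_symbolEquiv ((hf'.cons (map_symbolEquiv hg)).congr fun _ => rfl)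

theorem iterate_length {l : α → List InputSymbol} {f : α → β} {h : β → β} (hl : PSpace l)
    (hf : PSpace f) (hh : PSpace h) {G : α → ℕ} (hG : PolyBits G)
    (hb : ∀ x, ∀ i ≤ (l x).length, mag (h^[i] (f x)) ≤ G x) :
    PSpace fun x => h^[(l x).length] (f x) := iterate hl.symbolsLength hf hh hG hb

end PSpace

/-! ### Reading numbers -/

/-- Whether the symbol is a bit. -/
def isBit : InputSymbol → Bool
  | .bit _ => true
  | _ => false

/-- The value of a bit. -/
def bitValue : InputSymbol → ℕ
  | .bit true => 1
  | _ => 0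

@[fun_prop] theorem pspace_isBit {α : Type} [Coded α] {f : α → InputSymbol} (hf : PSpace f) :
    PSpace fun x => isBit (f x) := (PSpace.ofSymbol isBit).comp hf

@[fun_prop] theorem pspace_bitValue {α : Type} [Coded α] {f : α → InputSymbol} (hf : PSpace f) :
    PSpace fun x => bitValue (f x) := (PSpace.ofSymbol bitValue).comp hf

/-- Reads one bit: the state consists of the word to be read, the number read so far and the value
of the next bit. -/
def readNatStep (y : List InputSymbol × ℕ × ℕ) : List InputSymbol × ℕ × ℕ :=
  bif isBit (headSymbol y.1) then
    (y.1.tail, y.2.1 + bitValue (headSymbol y.1) * y.2.2, 2 * y.2.2)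
  else y

/-- Reads a number in binary; the result consists of the number and the rest of the word. -/
def readNat (l : List InputSymbol) : ℕ × List InputSymbol :=
  ((readNatStep^[l.length] (l, 0, 1)).2.1, (readNatStep^[l.length] (l, 0, 1)).1)

/-- While a number is read, the bits read so far form a number of at most as many bits. -/
theorem readNatStep_invariant (l : List InputSymbol) (i : ℕ) :
    (readNatStep^[i] (l, 0, 1)).1 <:+ l ∧
    (readNatStep^[i] (l, 0, 1)).2.1 < (readNatStep^[i] (l, 0, 1)).2.2 ∧
    (readNatStep^[i] (l, 0, 1)).2.2 ≤ 2 ^ i := by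
  induction i with
  | zero => simp
  | succ i ih =>
    obtain ⟨h1, h2, h3⟩ := ih
    rw [Function.iterate_succ_apply']
    set y := readNatStep^[i] (l, 0, 1)
    unfold readNatStep
    have hp := pow_succ 2 i
    cases hb : isBit (headSymbol y.1)
    · exact ⟨h1, h2, h3.trans (by omega)⟩
    · have hv : bitValue (headSymbol y.1) ≤ 1 := by
        rcases headSymbol y.1 with (_ | _) | _ <;> simp [bitValue]
      refine ⟨(List.tail_suffix _).trans h1, ?_, ?_⟩
      · simp only [cond_true]
        have := Nat.mul_le_mul_right y.2.2 hv
        omega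
      · simp only [cond_true]
        omega

@[fun_prop]
theorem pspace_readNat {α : Type} [Coded α] {f : α → List InputSymbol} (hf : PSpace f) :
    PSpace fun x => readNat (f x) := by
  have key : PSpace fun l : List InputSymbol => readNatStep^[l.length] (l, 0, 1) := by
    refine PSpace.iterate_length PSpace.id (by fun_prop) (by unfold readNatStep; fun_prop)
      (PolyBits.mag.max (two_pow_length_polyBits.max two_pow_length_polyBits)) fun l i hi => ?_
    obtain ⟨h1, h2, h3⟩ := readNatStep_invariant l i
    have h4 : 2 ^ i ≤ 2 ^ l.length := Nat.pow_le_pow_right (by norm_num) hi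
    rw [mag_prod, mag_prod, mag_nat, mag_nat]
    exact max_le_max (mag_symbols_le_of_suffix h1)
      (max_le_max ((h2.le.trans h3).trans h4) (h3.trans h4))
  have key' : PSpace readNat := PSpace.prodMk
    (PSpace.fst.comp (PSpace.snd.comp key)) (PSpace.fst.comp key)
  exact key'.comp hf

theorem readNat_suffix (l : List InputSymbol) : (readNat l).2 <:+ l :=
  (readNatStep_invariant l _).1

theorem readNatStep_iterate_encodeNat (n : ℕ) (t : List InputSymbol) (v p : ℕ) :
    readNatStep^[(encodeNat n).length] (encodeNat n ++ t, v, p) =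
      (t, v + n * p, 2 ^ (encodeNat n).length * p) := by
  induction n using Nat.binaryRec' generalizing v p with
  | zero => simp [encodeNat]
  | bit b n h ih =>
    have hb : encodeNat (Nat.bit b n) = .bit b :: encodeNat n := by
      simp [encodeNat, Nat.bits_append_bit n b h]
    rw [hb, List.length_cons, Function.iterate_succ_apply]
    have hs : readNatStep (.bit b :: encodeNat n ++ t, v, p) =
        (encodeNat n ++ t, v + b.toNat * p, 2 * p) := by
      cases b <;> rfl
    rw [hs, ih]
    have : Nat.bit b n = 2 * n + b.toNat := Nat.bit_val b n
    rw [this, pow_succ]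
    simp only [Prod.mk.injEq, true_and]
    constructor <;> ring

theorem readNat_encodeNat (n : ℕ) (s : InputSymbol) (t : List InputSymbol)
    (hs : isBit s = false) : readNat (encodeNat n ++ s :: t) = (n, s :: t) := by
  have key : readNatStep^[(encodeNat n ++ s :: t).length] (encodeNat n ++ s :: t, 0, 1) =
      (s :: t, n, 2 ^ (encodeNat n).length) := by
    rw [List.length_append, add_comm, Function.iterate_add_apply, readNatStep_iterate_encodeNat]
    simp only [zero_add, mul_one]
    refine Function.iterate_fixed ?_ _
    simp [readNatStep, hs]
  rw [readNat, key]

/-- The presentation of a rational number: its sign, numerator and denominator. -/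
abbrev RatCode := Bool × ℕ × ℕ

/-- The presentation of a rational number: its sign, numerator and denominator. -/
def ratCode (x : ℚ) : RatCode := (decide (x < 0), x.num.natAbs, x.den)

theorem ratCode_injective : Function.Injective ratCode := by
  intro x y h
  simp only [ratCode, Prod.mk.injEq, decide_eq_decide] at h
  obtain ⟨h1, h2, h3⟩ := h
  refine Rat.ext ?_ h3
  rw [← Rat.num_neg, ← Rat.num_neg] at h1
  omega

theorem eq_of_ratCode (x : ℚ) :
    x = (bif (ratCode x).1 then -1 else 1) * ((ratCode x).2.1 : ℚ) / ((ratCode x).2.2 : ℚ) := by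
  have h : ((bif decide (x < 0) then -1 else 1) * (x.num.natAbs : ℤ)) = x.num := by
    by_cases hx : x < 0
    · have := Rat.num_neg.2 hx
      simp only [hx, decide_true, cond_true]; omega
    · have := Rat.num_nonneg.2 (not_lt.1 hx)
      simp only [hx, decide_false, cond_false]; omega
  conv_lhs => rw [← Rat.num_div_den x, ← h]
  simp only [ratCode]
  push_cast
  cases decide (x < 0) <;> simp

/-- Whether the symbol is a minus sign. -/
def isMinus : InputSymbol → Bool
  | .minus => true
  | _ => false

@[fun_prop] theorem pspace_isMinus {α : Type} [Coded α] {f : α → InputSymbol} (hf : PSpace f) :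
    PSpace fun x => isMinus (f x) := (PSpace.ofSymbol isMinus).comp hf

/-- Removes a minus sign at the beginning of the word. -/
def dropMinus (l : List InputSymbol) : List InputSymbol :=
  bif isMinus (headSymbol l) then l.tail else l

/-- Reads a rational number; the result consists of the number and the rest of the word. -/
def readRat (l : List InputSymbol) : RatCode × List InputSymbol :=
  ((isMinus (headSymbol l), (readNat (dropMinus l)).1, (readNat (readNat (dropMinus l)).2.tail).1),
    (readNat (readNat (dropMinus l)).2.tail).2.tail)

@[fun_prop]
theorem pspace_readRat {α : Type} [Coded α] {f : α → List InputSymbol} (hf : PSpace f) :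
    PSpace fun x => readRat (f x) := by
  have hd : PSpace dropMinus := by unfold dropMinus; fun_prop
  have h1 := (pspace_readNat PSpace.id).comp hd
  have h2 := (pspace_readNat PSpace.id).comp (PSpace.symbolsTail (PSpace.snd.comp h1))
  have key : PSpace readRat := PSpace.prodMk (PSpace.prodMk (by fun_prop)
    (PSpace.prodMk (PSpace.fst.comp h1) (PSpace.fst.comp h2)))
    (PSpace.symbolsTail (PSpace.snd.comp h2))
  exact key.comp hf

theorem readRat_suffix (l : List InputSymbol) : (readRat l).2 <:+ l := by
  have h : dropMinus l <:+ l := by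
    unfold dropMinus
    cases isMinus (headSymbol l)
    · exact List.suffix_rfl
    · exact List.tail_suffix l
  exact (List.tail_suffix _).trans ((readNat_suffix _).trans ((List.tail_suffix _).trans
    ((readNat_suffix _).trans h)))

theorem readRat_encodeRat (x : ℚ) (t : List InputSymbol) :
    readRat (encodeRat x ++ t) = (ratCode x, t) := by
  have hd : dropMinus (encodeRat x ++ t) =
      encodeNat x.num.natAbs ++ .slash :: (encodeNat x.den ++ .sep :: t) ∧
      isMinus (headSymbol (encodeRat x ++ t)) = decide (x < 0) := by
    have hh : ∀ (n : ℕ) (u : List InputSymbol),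
        isMinus (headSymbol (encodeNat n ++ .slash :: u)) = false := by
      intro n u
      unfold encodeNat
      rcases n.bits with _ | ⟨b, l⟩ <;> rfl
    by_cases hx : x < 0
    · have : encodeRat x ++ t = .minus ::
          (encodeNat x.num.natAbs ++ .slash :: (encodeNat x.den ++ .sep :: t)) := by
        simp [encodeRat, hx]
      rw [this]
      simp only [hx]
      exact ⟨rfl, rfl⟩
    · have : encodeRat x ++ t =
          encodeNat x.num.natAbs ++ .slash :: (encodeNat x.den ++ .sep :: t) := by
        simp [encodeRat, hx]
      rw [this, dropMinus, hh]
      simp [hx]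
  unfold readRat
  rw [hd.1, hd.2, readNat_encodeNat _ _ _ rfl, List.tail_cons, readNat_encodeNat _ _ _ rfl]
  rfl

theorem encodeRat_ne_nil (x : ℚ) : encodeRat x ≠ [] := by simp [encodeRat]

/-- Equality of presentations of rational numbers. -/
def ratCodeEq (x y : RatCode) : Bool :=
  Nat.beq x.1.toNat y.1.toNat && (Nat.beq x.2.1 y.2.1 && Nat.beq x.2.2 y.2.2)

theorem ratCodeEq_iff (x y : RatCode) : ratCodeEq x y = true ↔ x = y := by
  obtain ⟨a, b, c⟩ := x
  obtain ⟨a', b', c'⟩ := y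
  simp only [ratCodeEq, Bool.and_eq_true, Nat.beq_eq, Prod.mk.injEq]
  constructor
  · rintro ⟨h1, h2, h3⟩
    exact ⟨by cases a <;> cases a' <;> simp_all, h2, h3⟩
  · rintro ⟨rfl, rfl, rfl⟩; exact ⟨rfl, rfl, rfl⟩

@[fun_prop]
theorem pspace_ratCodeEq {α : Type} [Coded α] {f g : α → RatCode} (hf : PSpace f)
    (hg : PSpace g) : PSpace fun x => ratCodeEq (f x) (g x) := by
  unfold ratCodeEq
  fun_prop

attribute [irreducible] readNat readRat

/-! ### Reading instances -/

/-- Whether the symbol is `hash`. -/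
def isHash : InputSymbol → Bool
  | .hash => true
  | _ => false

@[fun_prop] theorem pspace_isHash {α : Type} [Coded α] {f : α → InputSymbol} (hf : PSpace f) :
    PSpace fun x => isHash (f x) := (PSpace.ofSymbol isHash).comp hf

/-- Removes the first symbol, unless it is `hash`. -/
def toHashStep (l : List InputSymbol) : List InputSymbol :=
  bif isHash (headSymbol l) then l else l.tail

/-- The part of the word after the first `hash`. -/
def afterHash (l : List InputSymbol) : List InputSymbol := (toHashStep^[l.length] l).tail

theorem toHashStep_suffix (l : List InputSymbol) : toHashStep l <:+ l := by
  unfold toHashStep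
  cases isHash (headSymbol l)
  · exact List.tail_suffix _
  · exact List.suffix_rfl

theorem toHashStep_iterate_suffix (l : List InputSymbol) (i : ℕ) : toHashStep^[i] l <:+ l := by
  induction i with
  | zero => exact List.suffix_rfl
  | succ i ih =>
    rw [Function.iterate_succ_apply']
    exact (toHashStep_suffix _).trans ih

@[fun_prop]
theorem pspace_afterHash {α : Type} [Coded α] {f : α → List InputSymbol} (hf : PSpace f) :
    PSpace fun x => afterHash (f x) := by
  have key : PSpace fun l : List InputSymbol => toHashStep^[l.length] l :=
    PSpace.iterate_length PSpace.id PSpace.id (by unfold toHashStep; fun_prop) PolyBits.mag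
      fun l i _ => mag_symbols_le_of_suffix (toHashStep_iterate_suffix l i)
  exact (PSpace.symbolsTail key).comp hf

theorem afterHash_suffix (l : List InputSymbol) : afterHash l <:+ l :=
  (List.tail_suffix _).trans (toHashStep_iterate_suffix l _)

theorem afterHash_append (u t : List InputSymbol) (hu : ∀ s ∈ u, s ≠ .hash) :
    afterHash (u ++ .hash :: t) = t := by
  have key : toHashStep^[u.length] (u ++ .hash :: t) = .hash :: t := by
    induction u with
    | nil => rfl
    | cons s u ih =>
      rw [List.length_cons, Function.iterate_succ_apply]
      have hs : isHash s = false := by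
        have := hu s (by simp)
        cases s <;> simp_all [isHash]
      have : toHashStep (s :: u ++ .hash :: t) = u ++ .hash :: t := by
        simp [toHashStep, hs]
      rw [this]
      exact ih fun s hs => hu s (by simp [hs])
  rw [afterHash, List.length_append, add_comm, Function.iterate_add_apply, key,
    Function.iterate_fixed (by simp [toHashStep, isHash]), List.tail_cons]

theorem isHash_headSymbol_encodeRat (x : ℚ) (t : List InputSymbol) :
    isHash (headSymbol (encodeRat x ++ t)) = false := by
  unfold encodeRat encodeNat
  split_ifs
  · rfl
  · rcases x.num.natAbs.bits with _ | ⟨b, l⟩ <;> rfl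

/-- Compares the next number of a list with `c`, up to the end of the list, which is a `hash`. -/
def memWeightsStep (c : RatCode) (y : List InputSymbol × Bool) : List InputSymbol × Bool :=
  bif isHash (headSymbol y.1) then y else
    ((readRat y.1).2, y.2 || ratCodeEq (readRat y.1).1 c)

theorem memWeightsStep_suffix (c : RatCode) (y : List InputSymbol × Bool) :
    (memWeightsStep c y).1 <:+ y.1 := by
  unfold memWeightsStep
  cases isHash (headSymbol y.1)
  · exact readRat_suffix _
  · exact List.suffix_rfl

/-- Whether the number presented by `c` is in the list of numbers. -/
def memWeights (l : List InputSymbol) (c : RatCode) : Bool :=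
  ((memWeightsStep c)^[l.length] (l, false)).2

theorem memWeightsStep_iterate_suffix (c : RatCode) (y : List InputSymbol × Bool) (i : ℕ) :
    ((memWeightsStep c)^[i] y).1 <:+ y.1 := by
  induction i with
  | zero => exact List.suffix_rfl
  | succ i ih =>
    rw [Function.iterate_succ_apply']
    exact (memWeightsStep_suffix _ _).trans ih

theorem pspace_memWeightsStep :
    PSpace fun y : (RatCode × List InputSymbol) × List InputSymbol × Bool =>
      memWeightsStep y.1.1 y.2 := by
  unfold memWeightsStep
  fun_prop

theorem mag_memWeightsStep_iterate (y : RatCode × List InputSymbol) (i : ℕ) :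
    mag ((memWeightsStep y.1)^[i] (y.2, false)) ≤ max (mag y) 1 := by
  have hs := mag_symbols_le_of_suffix (memWeightsStep_iterate_suffix y.1 (y.2, false) i)
  have h2 : mag y.2 ≤ mag y := by rw [mag_prod y]; exact le_max_right _ _
  rw [mag_prod]
  exact max_le_max (hs.trans h2) (mag_bool _)

theorem pspace_memWeightsStep_iterate : PSpace fun y : RatCode × List InputSymbol =>
    (memWeightsStep y.1)^[y.2.length] (y.2, false) := by
  have h0 : PSpace fun y : RatCode × List InputSymbol => (y.2, false) := by fun_prop
  have hl : PSpace fun y : RatCode × List InputSymbol => y.2.length := by fun_prop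
  have hG : PolyBits fun y : RatCode × List InputSymbol => max (mag y) 1 :=
    PolyBits.mag.max (PolyBits.const 1)
  exact PSpace.iterate_with (h := fun y : RatCode × List InputSymbol => memWeightsStep y.1) hl h0
    pspace_memWeightsStep hG fun y i _ => mag_memWeightsStep_iterate y i

@[fun_prop]
theorem pspace_memWeights {α : Type} [Coded α] {f : α → List InputSymbol} {g : α → RatCode}
    (hf : PSpace f) (hg : PSpace g) : PSpace fun x => memWeights (f x) (g x) := by
  have h1 : PSpace fun y : RatCode × List InputSymbol => memWeights y.2 y.1 := by
    unfold memWeights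
    have := PSpace.snd.comp pspace_memWeightsStep_iterate
    exact this
  have := h1.comp (hg.prodMk hf)
  exact this

theorem memWeights_flatMap (ws : List ℚ) (t : List InputSymbol) (c : RatCode) :
    memWeights (ws.flatMap encodeRat ++ .hash :: t) c = true ↔ ∃ x ∈ ws, ratCode x = c := by
  have key : ∀ (ws : List ℚ) (b : Bool) (n : ℕ), ws.length ≤ n →
      (((memWeightsStep c)^[n] (ws.flatMap encodeRat ++ .hash :: t, b)).2 = true ↔
        b = true ∨ ∃ x ∈ ws, ratCode x = c) := by
    intro ws
    induction ws with
    | nil =>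
      intro b n _
      rw [Function.iterate_fixed (by simp [memWeightsStep, isHash])]
      simp
    | cons x ws ih =>
      intro b n hn
      obtain ⟨n, rfl⟩ : ∃ k, n = k + 1 := ⟨n - 1, by simp at hn; omega⟩
      rw [Function.iterate_succ_apply, List.flatMap_cons, List.append_assoc]
      have : memWeightsStep c (encodeRat x ++ (ws.flatMap encodeRat ++ .hash :: t), b) =
          (ws.flatMap encodeRat ++ .hash :: t, b || ratCodeEq (ratCode x) c) := by
        simp [memWeightsStep, isHash_headSymbol_encodeRat, readRat_encodeRat]
      rw [this, ih _ _ (by simpa using hn), Bool.or_eq_true, ratCodeEq_iff, or_assoc]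
      simp
  have hl : ws.length ≤ (ws.flatMap encodeRat).length := by
    induction ws with
    | nil => simp
    | cons x ws ih =>
      have := List.length_pos_of_ne_nil (encodeRat_ne_nil x)
      simp only [List.length_cons, List.flatMap_cons, List.length_append]
      omega
  rw [memWeights, key ws false _ (by rw [List.length_append]; omega)]
  simp

/-- The number of expressions, or parts of a number, that follow the symbol in Polish notation. -/
def arity : InputSymbol → ℕ
  | .plus => 2
  | .comp => 2
  | .sep => 0
  | .empty => 0
  | .eps => 0
  | _ => 1

theorem arity_le (s : InputSymbol) : arity s ≤ 2 := by cases s <;> simp [arity]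

@[fun_prop] theorem pspace_arity {α : Type} [Coded α] {f : α → InputSymbol} (hf : PSpace f) :
    PSpace fun x => arity (f x) := (PSpace.ofSymbol arity).comp hf

/-- Skips one symbol of a sequence of expressions in Polish notation; the state consists of the
number of expressions to be skipped and the rest of the word. -/
def skipStep (y : ℕ × List InputSymbol) : ℕ × List InputSymbol :=
  bif Nat.beq y.1 0 then y else (y.1 - 1 + arity (headSymbol y.2), y.2.tail)

/-- Skips a regular expression in Polish notation. -/
def skipRegex (l : List InputSymbol) : List InputSymbol := (skipStep^[l.length] (1, l)).2

theorem skipStep_iterate (l : List InputSymbol) (i : ℕ) :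
    (skipStep^[i] (1, l)).1 ≤ i + 1 ∧ (skipStep^[i] (1, l)).2 <:+ l := by
  induction i with
  | zero => exact ⟨le_rfl, List.suffix_rfl⟩
  | succ i ih =>
    obtain ⟨h1, h2⟩ := ih
    rw [Function.iterate_succ_apply']
    set y := skipStep^[i] (1, l)
    unfold skipStep
    cases h : Nat.beq y.1 0
    · have := arity_le (headSymbol y.2)
      have : y.1 ≠ 0 := fun h' => by simp [h'] at h
      refine ⟨?_, (List.tail_suffix _).trans h2⟩
      simp only [cond_false]
      omega
    · exact ⟨h1.trans (by omega), h2⟩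

@[fun_prop]
theorem pspace_skipRegex {α : Type} [Coded α] {f : α → List InputSymbol} (hf : PSpace f) :
    PSpace fun x => skipRegex (f x) := by
  have key : PSpace fun l : List InputSymbol => skipStep^[l.length] (1, l) := by
    refine PSpace.iterate_length PSpace.id (by fun_prop) (by unfold skipStep; fun_prop)
      (G := fun l => max (l.length + 1) (mag l)) ?_ fun l i hi => ?_
    · exact (PSpace.polyBits (f := fun l : List InputSymbol => l.length + 1)
        (by fun_prop)).max PolyBits.mag
    · obtain ⟨h1, h2⟩ := skipStep_iterate l i
      rw [mag_prod, mag_nat]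
      exact max_le_max (by omega) (mag_symbols_le_of_suffix h2)
  exact (PSpace.snd.comp key).comp hf

theorem skipRegex_suffix (l : List InputSymbol) : skipRegex l <:+ l := (skipStep_iterate l _).2

theorem skipStep_cons (n : ℕ) (s : InputSymbol) (t : List InputSymbol) :
    skipStep (n + 1, s :: t) = (n + arity s, t) := by
  have : Nat.beq (n + 1) 0 = false := rfl
  simp [skipStep, this]

/-- Polish notation needs no parentheses: an expression ends as soon as no expressions are left to
be skipped. -/
theorem skipStep_iterate_encodeRegex (e : RegularExpression ℚ) (n : ℕ) (t : List InputSymbol) :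
    skipStep^[(encodeRegex e).length] (n + 1, encodeRegex e ++ t) = (n, t) := by
  induction e generalizing n t with
  | zero => rfl
  | epsilon => rfl
  | char x =>
    have h1 : ∀ (u : List InputSymbol), (∀ s ∈ u, arity s = 1) → ∀ v,
        skipStep^[u.length] (n + 1, u ++ v) = (n + 1, v) := by
      intro u hu v
      induction u with
      | nil => rfl
      | cons s u ih =>
        rw [List.length_cons, Function.iterate_succ_apply, List.cons_append, skipStep_cons,
          hu s (by simp)]
        exact ih fun s hs => hu s (by simp [hs])
    obtain ⟨u, hu, hux⟩ : ∃ u, (∀ s ∈ u, arity s = 1) ∧ encodeRat x = u ++ [.sep] := by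
      refine ⟨_, ?_, rfl⟩
      intro s hs
      simp only [encodeNat, List.append_assoc, List.mem_append, List.mem_map] at hs
      rcases hs with hs | ⟨b, _, rfl⟩ | hs | ⟨b, _, rfl⟩
      · split_ifs at hs
        · rw [List.mem_singleton.1 hs]; rfl
        · simp at hs
      · rfl
      · rw [List.mem_singleton.1 hs]; rfl
      · rfl
    rw [encodeRegex, hux, ← List.cons_append, List.length_append, add_comm,
      Function.iterate_add_apply, List.append_assoc, h1 (.letter :: u)]
    · rfl
    · intro s hs
      rcases List.mem_cons.1 hs with rfl | hs
      · rfl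
      · exact hu s hs
  | plus e f ihe ihf =>
    rw [encodeRegex, List.length_cons, List.cons_append, Function.iterate_succ_apply,
      skipStep_cons, List.length_append, add_comm, Function.iterate_add_apply, List.append_assoc]
    exact (congrArg _ (ihe (n + 1) _)).trans (ihf n t)
  | comp e f ihe ihf =>
    rw [encodeRegex, List.length_cons, List.cons_append, Function.iterate_succ_apply,
      skipStep_cons, List.length_append, add_comm, Function.iterate_add_apply, List.append_assoc]
    exact (congrArg _ (ihe (n + 1) _)).trans (ihf n t)
  | star e ih =>
    rw [encodeRegex, List.length_cons, List.cons_append, Function.iterate_succ_apply,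
      skipStep_cons]
    exact ih n t

theorem skipRegex_encodeRegex (e : RegularExpression ℚ) (t : List InputSymbol) :
    skipRegex (encodeRegex e ++ t) = t := by
  rw [skipRegex, List.length_append, add_comm, Function.iterate_add_apply,
    skipStep_iterate_encodeRegex, Function.iterate_fixed (by simp [skipStep])]

attribute [irreducible] afterHash memWeights skipRegex

/-! ### The game of splitting a word -/

/-- Whether the symbol is `plus`. -/
def isPlus : InputSymbol → Bool
  | .plus => true
  | _ => false

/-- Whether the symbol is `comp`. -/
def isComp : InputSymbol → Bool
  | .comp => true
  | _ => false

/-- Whether the symbol is `star`. -/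
def isStar : InputSymbol → Bool
  | .star => true
  | _ => false

/-- Whether the symbol is `eps`. -/
def isEps : InputSymbol → Bool
  | .eps => true
  | _ => false

/-- Whether the symbol is `letter`. -/
def isLetter : InputSymbol → Bool
  | .letter => true
  | _ => false

section
variable {α : Type} [Coded α] {f : α → InputSymbol}

@[fun_prop] theorem pspace_isPlus (hf : PSpace f) : PSpace fun x => isPlus (f x) :=
  (PSpace.ofSymbol isPlus).comp hf

@[fun_prop] theorem pspace_isComp (hf : PSpace f) : PSpace fun x => isComp (f x) :=
  (PSpace.ofSymbol isComp).comp hf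

@[fun_prop] theorem pspace_isStar (hf : PSpace f) : PSpace fun x => isStar (f x) :=
  (PSpace.ofSymbol isStar).comp hf

@[fun_prop] theorem pspace_isEps (hf : PSpace f) : PSpace fun x => isEps (f x) :=
  (PSpace.ofSymbol isEps).comp hf

@[fun_prop] theorem pspace_isLetter (hf : PSpace f) : PSpace fun x => isLetter (f x) :=
  (PSpace.ofSymbol isLetter).comp hf

end

/-- A position `(s, k, U, V)` of the game: the claim that some word of the language of the regular
expression at the beginning of `s` leads from the remainder `U` to the remainder `V`, where, if this
expression is a star, at most `2 ^ k` factors are used. -/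
abbrev RegexPosition := List InputSymbol × ℕ × ℕ × ℕ

/-- The position after the moves `d / 2` of the first player, who chooses one of two alternatives or
an intermediate remainder, and `d % 2` of the second player, who chooses the half to be verified. -/
def regexMove (K : ℕ) (p : RegexPosition) (d : ℕ) : RegexPosition :=
  bif isPlus (headSymbol p.1) then
    bif Nat.beq (d / 2) 0 then (p.1.tail, p.2) else (skipRegex p.1.tail, p.2)
  else bif isComp (headSymbol p.1) then
    bif Nat.beq (d % 2) 0 then (p.1.tail, p.2.1, p.2.2.1, d / 2)
    else (skipRegex p.1.tail, p.2.1, d / 2, p.2.2.2)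
  else bif isStar (headSymbol p.1) then
    bif Nat.beq p.2.1 0 then
      bif Nat.beq (d / 2) 0 then ([.eps], p.2) else (p.1.tail, K, p.2.2)
    else bif Nat.beq (d % 2) 0 then (p.1, p.2.1 - 1, p.2.2.1, d / 2)
    else (p.1, p.2.1 - 1, d / 2, p.2.2.2)
  else p

/-- The number presented by `U`. -/
def gridVal (D Z U : ℕ) : ℚ := ((U : ℚ) - Z) / D

/-- Whether the letter `x` leads from the remainder `U` to the remainder `V`, that is, whether
`U = x + lam * V` holds for the presented numbers. -/
def letterEq (lam x : RatCode) (D Z U V : ℕ) : Bool :=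
  Nat.beq (lam.2.2 * x.2.2 * U + lam.2.1 * x.2.2 * Z + bif x.1 then lam.2.2 * D * x.2.1 else 0)
    (lam.2.2 * x.2.2 * Z + lam.2.1 * x.2.2 * V + bif x.1 then 0 else lam.2.2 * D * x.2.1)

/-- The winning condition of the first player at the end of the game. -/
def regexLeaf (W : List InputSymbol) (lam : RatCode) (D Z : ℕ) (p : RegexPosition) : Bool :=
  bif isEps (headSymbol p.1) then Nat.beq p.2.2.1 p.2.2.2
  else isLetter (headSymbol p.1) && (memWeights W (readRat p.1.tail).1 &&
    letterEq lam (readRat p.1.tail).1 D Z p.2.2.1 p.2.2.2)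

theorem gridVal_injective {D : ℕ} (hD : 0 < D) (Z : ℕ) : Function.Injective (gridVal D Z) := by
  intro U V h
  have hD' : (D : ℚ) ≠ 0 := by positivity
  unfold gridVal at h
  rw [div_left_inj' hD'] at h
  exact_mod_cast sub_left_injective h

/-- The equation is multiplied out, so that no subtractions or divisions remain; since the discount
factor is positive, its sign is ignored. -/
theorem letterEq_iff {lam : ℚ} (h0 : 0 < lam) {D : ℕ} (hD : 0 < D) (x : ℚ) (Z U V : ℕ) :
    letterEq (ratCode lam) (ratCode x) D Z U V = true ↔
      gridVal D Z U = x + lam * gridVal D Z V := by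
  have hD' : (D : ℚ) ≠ 0 := by positivity
  have hl := eq_of_ratCode lam
  have hx := eq_of_ratCode x
  have hq : ((ratCode lam).2.2 : ℚ) ≠ 0 := by exact_mod_cast lam.den_nz
  have hd : ((ratCode x).2.2 : ℚ) ≠ 0 := by exact_mod_cast x.den_nz
  have hs : (ratCode lam).1 = false := by simp [ratCode, h0.le]
  rw [hs] at hl
  generalize ratCode lam = c at *
  generalize ratCode x = y at *
  obtain ⟨_, p, q⟩ := c
  obtain ⟨s, n, d⟩ := y
  simp only [cond_false] at *
  rw [letterEq, Nat.beq_eq, hl, hx, gridVal, gridVal]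
  rw [← Nat.cast_inj (R := ℚ)]
  cases s
  · simp only [cond_false]
    push_cast
    field_simp
    constructor <;> intro h <;> linear_combination h
  · simp only [cond_true]
    push_cast
    field_simp
    constructor <;> intro h <;> linear_combination h

section Moves
variable (K m k U V : ℕ) (s : List InputSymbol)

theorem beq_two_mul_mod : Nat.beq (2 * m % 2) 0 = true := by rw [Nat.beq_eq]; omega

theorem beq_two_mul_add_one_mod : Nat.beq ((2 * m + 1) % 2) 0 = false :=
  beq_false_of_ne' (by omega)

theorem two_mul_add_one_div : (2 * m + 1) / 2 = m := by omega

theorem regexMove_plus : regexMove K (.plus :: s, k, U, V) (2 * m) =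
    bif Nat.beq m 0 then (s, k, U, V) else (skipRegex s, k, U, V) := by
  rw [regexMove, Nat.mul_div_cancel_left _ two_pos]; rfl

theorem regexMove_plus' : regexMove K (.plus :: s, k, U, V) (2 * m + 1) =
    bif Nat.beq m 0 then (s, k, U, V) else (skipRegex s, k, U, V) := by
  rw [regexMove, two_mul_add_one_div]; rfl

theorem regexMove_comp : regexMove K (.comp :: s, k, U, V) (2 * m) = (s, k, U, m) := by
  rw [regexMove, Nat.mul_div_cancel_left _ two_pos, beq_two_mul_mod]; rfl

theorem regexMove_comp' : regexMove K (.comp :: s, k, U, V) (2 * m + 1) =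
    (skipRegex s, k, m, V) := by
  rw [regexMove, two_mul_add_one_div, beq_two_mul_add_one_mod]; rfl

theorem regexMove_star_zero : regexMove K (.star :: s, 0, U, V) (2 * m) =
    bif Nat.beq m 0 then ([.eps], 0, U, V) else (s, K, U, V) := by
  rw [regexMove, Nat.mul_div_cancel_left _ two_pos]; rfl

theorem regexMove_star_zero' : regexMove K (.star :: s, 0, U, V) (2 * m + 1) =
    bif Nat.beq m 0 then ([.eps], 0, U, V) else (s, K, U, V) := by
  rw [regexMove, two_mul_add_one_div]; rfl

theorem regexMove_star_succ : regexMove K (.star :: s, k + 1, U, V) (2 * m) =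
    (.star :: s, k, U, m) := by
  rw [regexMove, Nat.mul_div_cancel_left _ two_pos, beq_two_mul_mod]; rfl

theorem regexMove_star_succ' : regexMove K (.star :: s, k + 1, U, V) (2 * m + 1) =
    (.star :: s, k, m, V) := by
  rw [regexMove, two_mul_add_one_div, beq_two_mul_add_one_mod]; rfl

end Moves

/-- Further rounds do not matter once the position does not change any more. -/
theorem gameValue_of_fixed {β : Type} {M : ℕ} (hM : 0 < M) {g : β → ℕ → β} {leaf : β → Bool}
    {p : β} (h : ∀ d, g p d = p) (r : ℕ) : gameValue M g leaf r p = leaf p := by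
  induction r with
  | zero => rfl
  | succ r ih =>
    rw [gameValue, Bool.eq_iff_iff, decide_eq_true_iff]
    simp only [h, ih, and_self]
    exact ⟨fun ⟨_, _, h⟩ => h, fun h => ⟨0, hM, h⟩⟩

section Game
variable {lam : ℚ} {D Z K M : ℕ} {ws : List ℚ} {W : List InputSymbol}

/-- Soundness of the game: where the first player wins, there is a word as claimed by the
position. -/
theorem exists_word_of_gameValue (h0 : 0 < lam) (hD : 0 < D)
    (hW : ∀ x, memWeights W (ratCode x) = true ↔ x ∈ ws) (r : ℕ) (e : RegularExpression ℚ)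
    (t : List InputSymbol) (k U V : ℕ)
    (h : gameValue M (regexMove K) (regexLeaf W (ratCode lam) D Z) r
      (encodeRegex e ++ t, k, U, V) = true) :
    ∃ w ∈ e.matches', (∀ x ∈ w, x ∈ ws) ∧
      remainder lam (gridVal D Z U) w = gridVal D Z V := by
  induction r generalizing e t k U V with
  | zero =>
    rw [gameValue] at h
    cases e with
    | zero => cases h
    | epsilon =>
      have h' : Nat.beq U V = true := h
      rw [Nat.beq_eq] at h'
      exact ⟨[], rfl, by simp, by rw [h']; rfl⟩
    | char x =>
      have h' : (memWeights W (readRat (encodeRat x ++ t)).1 &&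
        letterEq (ratCode lam) (readRat (encodeRat x ++ t)).1 D Z U V) = true := h
      rw [readRat_encodeRat, Bool.and_eq_true, hW, letterEq_iff h0 hD] at h'
      refine ⟨[x], rfl, by simpa using h'.1, ?_⟩
      rw [remainder_cons, remainder_nil, div_eq_iff h0.ne', h'.2]
      ring
    | plus e f => cases h
    | comp e f => cases h
    | star e => cases h
  | succ r ih =>
    rw [gameValue, decide_eq_true_iff] at h
    obtain ⟨m, -, h1, h2⟩ := h
    cases e with
    | zero => exact ih .zero t k U V h1
    | epsilon => exact ih .epsilon t k U V h1
    | char x => exact ih (.char x) t k U V h1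
    | plus e f =>
      rw [encodeRegex, List.cons_append, List.append_assoc, regexMove_plus,
        skipRegex_encodeRegex] at h1
      cases hm : Nat.beq m 0 <;> rw [hm] at h1
      · obtain ⟨w, hw, h⟩ := ih f t k U V h1
        exact ⟨w, Or.inr hw, h⟩
      · obtain ⟨w, hw, h⟩ := ih e (encodeRegex f ++ t) k U V h1
        exact ⟨w, Or.inl hw, h⟩
    | comp e f =>
      rw [encodeRegex, List.cons_append, List.append_assoc] at h1 h2
      rw [regexMove_comp] at h1
      rw [regexMove_comp', skipRegex_encodeRegex] at h2
      obtain ⟨w, hw, hx, h⟩ := ih e _ _ _ _ h1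
      obtain ⟨v, hv, hy, h'⟩ := ih f _ _ _ _ h2
      refine ⟨w ++ v, Language.append_mem_mul hw hv, ?_, by rw [remainder_append, h, h']⟩
      intro x hx'
      exact (List.mem_append.1 hx').elim (hx x) (hy x)
    | star e =>
      rw [encodeRegex, List.cons_append] at h1 h2
      cases k with
      | zero =>
        rw [regexMove_star_zero] at h1
        cases hm : Nat.beq m 0 <;> rw [hm] at h1
        · obtain ⟨w, hw, h⟩ := ih e _ _ _ _ h1
          exact ⟨w, Language.mem_kstar.2 ⟨[w], by simp, by simpa using hw⟩, h⟩
        · obtain ⟨w, hw, h⟩ := ih .epsilon [] _ _ _ h1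
          exact ⟨w, Language.mem_kstar.2 ⟨[], by simpa using hw, by simp⟩, h⟩
      | succ k =>
        rw [regexMove_star_succ] at h1
        rw [regexMove_star_succ'] at h2
        obtain ⟨w, hw, hx, h⟩ := ih (.star e) _ _ _ _ h1
        obtain ⟨v, hv, hy, h'⟩ := ih (.star e) _ _ _ _ h2
        refine ⟨w ++ v, ?_, ?_, by rw [remainder_append, h, h']⟩
        · obtain ⟨L, rfl, hL⟩ := Language.mem_kstar.1 hw
          obtain ⟨L', rfl, hL'⟩ := Language.mem_kstar.1 hv
          refine Language.mem_kstar.2 ⟨L ++ L', by simp, fun y hy => ?_⟩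
          exact (List.mem_append.1 hy).elim (hL y) (hL' y)
        · intro x hx'
          exact (List.mem_append.1 hx').elim (hx x) (hy x)

/-- In a relation on the numbers below `M`, shortest paths have length less than `M`. -/
theorem exists_short_path {R : ℕ → ℕ → Prop} {U V : ℕ} (hU : U < M) (hR : ∀ a b, R a b → b < M)
    (h : Relation.ReflTransGen R U V) :
    ∃ n < M, ∃ f : ℕ → ℕ, f 0 = U ∧ f n = V ∧ ∀ i < n, R (f i) (f (i + 1)) := by
  have hex : ∃ n, ∃ f : ℕ → ℕ, f 0 = U ∧ f n = V ∧ ∀ i < n, R (f i) (f (i + 1)) := by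
    induction h with
    | refl => exact ⟨0, fun _ => U, rfl, rfl, by simp⟩
    | @tail b c _ hbc ih =>
      obtain ⟨n, f, h1, h2, h3⟩ := ih
      refine ⟨n + 1, fun i => if i ≤ n then f i else c, by simpa using h1, by simp, fun i hi => ?_⟩
      rcases Nat.lt_succ_iff_lt_or_eq.1 hi with hi | rfl
      · simpa [hi.le, Nat.succ_le_of_lt hi] using h3 i hi
      · simpa [h2] using hbc
  classical
  refine ⟨Nat.find hex, ?_, Nat.find_spec hex⟩
  by_contra! hM
  obtain ⟨f, h1, h2, h3⟩ := Nat.find_spec hex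
  set n := Nat.find hex with hn
  have hfM : ∀ i ∈ Finset.range (n + 1), f i ∈ Finset.range M := by
    intro i hi
    rw [Finset.mem_range] at hi ⊢
    cases i with
    | zero => rwa [h1]
    | succ i => exact hR _ _ (h3 i (by omega))
  obtain ⟨i, hi, j, hj, hij, hfij⟩ : ∃ i ∈ Finset.range (n + 1), ∃ j ∈ Finset.range (n + 1),
      i < j ∧ f i = f j := by
    obtain ⟨i, hi, j, hj, hne, hf⟩ := Finset.exists_ne_map_eq_of_card_lt_of_maps_to
      (by simp only [Finset.card_range]; omega) hfM
    rcases lt_or_gt_of_ne hne with h | h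
    · exact ⟨i, hi, j, hj, h, hf⟩
    · exact ⟨j, hj, i, hi, h, hf.symm⟩
  rw [Finset.mem_range] at hi hj
  -- the part of the path between two visits of the same point is cut out
  refine Nat.find_min hex (m := n - (j - i)) (by omega)
    ⟨fun a => if a ≤ i then f a else f (a + (j - i)), by simpa using h1, ?_, fun a ha => ?_⟩
  · dsimp only
    split_ifs with h
    · have hjn : j = n := by omega
      have : n - (j - i) = i := by omega
      rw [this, hfij, hjn, h2]
    · rw [Nat.sub_add_cancel (by omega), h2]
  · rcases lt_trichotomy a i with h | rfl | h
    · simpa [h.le, Nat.succ_le_of_lt h] using h3 a (by omega)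
    · have : a + 1 + (j - a) = j + 1 := by omega
      simpa [this, hfij] using h3 j (by omega)
    · have h' := h3 (a + (j - i)) (by omega)
      have h4 : ¬ a ≤ i := by omega
      have h5 : ¬ a + 1 ≤ i := by omega
      have h6 : a + 1 + (j - i) = a + (j - i) + 1 := by omega
      simpa [h4, h5, h6] using h'

/-- A number of rounds in which the game is decided. -/
def rounds (K : ℕ) : RegularExpression ℚ → ℕ
  | .zero => 0
  | .epsilon => 0
  | .char _ => 0
  | .plus e f => max (rounds K e) (rounds K f) + 1
  | .comp e f => max (rounds K e) (rounds K f) + 1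
  | .star e => rounds K e + K + 1

theorem rounds_le (K : ℕ) (e : RegularExpression ℚ) :
    rounds K e ≤ (encodeRegex e).length * (K + 1) := by
  induction e with
  | zero => exact Nat.zero_le _
  | epsilon => exact Nat.zero_le _
  | char x => exact Nat.zero_le _
  | plus e f he hf =>
    rw [rounds, encodeRegex, List.length_cons, List.length_append]
    rcases le_total (rounds K e) (rounds K f) with h | h <;>
      simp only [h, max_eq_left, max_eq_right] <;> nlinarith
  | comp e f he hf =>
    rw [rounds, encodeRegex, List.length_cons, List.length_append]
    rcases le_total (rounds K e) (rounds K f) with h | h <;>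
      simp only [h, max_eq_left, max_eq_right] <;> nlinarith
  | star e he =>
    rw [rounds, encodeRegex, List.length_cons]
    nlinarith

/-- The first player wins a star by repeatedly halving the path. -/
theorem gameValue_star (hM : M = 2 ^ K) (hK : 0 < K) {leaf : RegexPosition → Bool}
    (hleaf : ∀ k U, leaf ([.eps], k, U, U) = true) {e : RegularExpression ℚ}
    {s : List InputSymbol} {R : ℕ → ℕ → Prop} (hR : ∀ a b, R a b → b < M)
    (he : ∀ a b, R a b → ∀ r ≥ rounds K e, gameValue M (regexMove K) leaf r (s, K, a, b) = true)
    (k n : ℕ) (hn : n ≤ 2 ^ k) (f : ℕ → ℕ) (hf : ∀ i < n, R (f i) (f (i + 1))) (h0 : f 0 < M)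
    (r : ℕ) (hr : rounds K e + k + 1 ≤ r) :
    gameValue M (regexMove K) leaf r (.star :: s, k, f 0, f n) = true := by
  have hM2 : 1 < M := by rw [hM]; exact Nat.one_lt_two_pow hK.ne'
  induction k generalizing n f r with
  | zero =>
    obtain ⟨r, rfl⟩ : ∃ r', r = r' + 1 := ⟨r - 1, by omega⟩
    rw [gameValue, decide_eq_true_iff]
    obtain rfl | rfl : n = 0 ∨ n = 1 := by simp at hn; omega
    · refine ⟨0, by omega, ?_⟩
      rw [regexMove_star_zero, regexMove_star_zero']
      have := (gameValue_of_fixed (M := M) (by omega) (g := regexMove K) (leaf := leaf)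
        (p := ([.eps], 0, f 0, f 0)) (fun d => rfl) r).trans (hleaf _ _)
      exact ⟨this, this⟩
    · refine ⟨1, hM2, ?_⟩
      rw [regexMove_star_zero, regexMove_star_zero']
      have := he _ _ (hf 0 (by omega)) r (by omega)
      exact ⟨this, this⟩
  | succ k ih =>
    obtain ⟨r, rfl⟩ : ∃ r', r = r' + 1 := ⟨r - 1, by omega⟩
    rw [gameValue, decide_eq_true_iff]
    have hlt : ∀ i ≤ n, f i < M := by
      intro i hi
      cases i with
      | zero => exact h0
      | succ i => exact hR _ _ (hf i (by omega))
    rw [pow_succ] at hn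
    refine ⟨f (n / 2), hlt _ (by omega), ?_, ?_⟩
    · rw [regexMove_star_succ]
      exact ih (n / 2) (by omega) f (fun i hi => hf i (by omega)) h0 r (by omega)
    · rw [regexMove_star_succ']
      have := ih (n - n / 2) (by omega) (fun i => f (n / 2 + i))
        (fun i hi => hf (n / 2 + i) (by omega)) (hlt _ (by omega)) r (by omega)
      simpa [Nat.add_sub_cancel' (Nat.div_le_self n 2)] using this

/-- Completeness of the game: the first player wins if there is a word as claimed by the position
all of whose intermediate remainders lie on the grid. -/
theorem gameValue_of_word (h0 : 0 < lam) (hD : 0 < D)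
    (hW : ∀ x, memWeights W (ratCode x) = true ↔ x ∈ ws) (hM : M = 2 ^ K) (hK : 0 < K)
    (e : RegularExpression ℚ) (w : List ℚ) (hw : w ∈ e.matches') (hws : ∀ x ∈ w, x ∈ ws)
    (U V : ℕ) (hU : U < M) (hV : V < M)
    (hgrid : ∀ v, v <+: w → ∃ m < M, gridVal D Z m = remainder lam (gridVal D Z U) v)
    (hUV : gridVal D Z V = remainder lam (gridVal D Z U) w) (r : ℕ) (hr : rounds K e ≤ r)
    (t : List InputSymbol) :
    gameValue M (regexMove K) (regexLeaf W (ratCode lam) D Z) r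
      (encodeRegex e ++ t, K, U, V) = true := by
  have hM2 : 1 < M := by rw [hM]; exact Nat.one_lt_two_pow hK.ne'
  induction e generalizing w U V r t with
  | zero => exact absurd hw (by rintro ⟨⟩)
  | epsilon =>
    rw [gameValue_of_fixed (by omega) fun d => rfl]
    obtain rfl : w = [] := hw
    have : V = U := gridVal_injective hD Z hUV
    show Nat.beq U V = true
    rw [Nat.beq_eq, this]
  | char x =>
    rw [gameValue_of_fixed (by omega) fun d => rfl]
    obtain rfl : w = [x] := hw
    show (memWeights W (readRat (encodeRat x ++ t)).1 &&
        letterEq (ratCode lam) (readRat (encodeRat x ++ t)).1 D Z U V) = true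
    rw [readRat_encodeRat, Bool.and_eq_true, hW, letterEq_iff h0 hD]
    refine ⟨hws x (by simp), ?_⟩
    rw [hUV, remainder_cons, remainder_nil, mul_div_cancel₀ _ h0.ne']
    ring
  | plus e f ihe ihf =>
    rw [rounds] at hr
    obtain ⟨r, rfl⟩ : ∃ r', r = r' + 1 := ⟨r - 1, by omega⟩
    rw [gameValue, decide_eq_true_iff, encodeRegex, List.cons_append, List.append_assoc]
    rcases hw with hw | hw
    · refine ⟨0, by omega, ?_⟩
      rw [regexMove_plus, regexMove_plus']
      have := ihe w hw hws U V hU hV hgrid hUV r (by omega) (encodeRegex f ++ t)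
      exact ⟨this, this⟩
    · refine ⟨1, by omega, ?_⟩
      rw [regexMove_plus, regexMove_plus', skipRegex_encodeRegex]
      have := ihf w hw hws U V hU hV hgrid hUV r (by omega) t
      exact ⟨this, this⟩
  | comp e f ihe ihf =>
    rw [rounds] at hr
    obtain ⟨r, rfl⟩ : ∃ r', r = r' + 1 := ⟨r - 1, by omega⟩
    rw [gameValue, decide_eq_true_iff, encodeRegex, List.cons_append, List.append_assoc]
    obtain ⟨w, hw1, v, hv1, rfl⟩ := Language.mem_mul.1 hw
    obtain ⟨m, hm, hmw⟩ := hgrid w (List.prefix_append _ _)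
    refine ⟨m, hm, ?_, ?_⟩
    · rw [regexMove_comp]
      exact ihe w hw1 (fun x hx => hws x (by simp [hx])) U m hU hm
        (fun u hu => hgrid u (hu.trans (List.prefix_append _ _))) hmw r (by omega) _
    · rw [regexMove_comp', skipRegex_encodeRegex]
      refine ihf v hv1 (fun x hx => hws x (by simp [hx])) m V hm hV (fun u hu => ?_) ?_ r
        (by omega) _
      · rw [hmw, ← remainder_append]
        exact hgrid (w ++ u) ((List.prefix_append_right_inj _).2 hu)
      · rw [hmw, ← remainder_append, hUV]
  | star e ih =>
    rw [rounds] at hr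
    set R : ℕ → ℕ → Prop := fun a b => b < M ∧ ∀ r ≥ rounds K e,
      gameValue M (regexMove K) (regexLeaf W (ratCode lam) D Z) r
        (encodeRegex e ++ t, K, a, b) = true with hR
    have hRM : ∀ a b, R a b → b < M := fun a b h => h.1
    -- each factor is one step between intermediate remainders
    have hpath : Relation.ReflTransGen R U V := by
      obtain ⟨L, rfl, hL⟩ := Language.mem_kstar.1 hw
      clear hw
      induction L generalizing U with
      | nil =>
        have : V = U := gridVal_injective hD Z hUV
        rw [this]
      | cons y L ihL =>
        rw [List.flatten_cons] at hws hgrid hUV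
        obtain ⟨m, hm, hmy⟩ := hgrid y (List.prefix_append _ _)
        refine Relation.ReflTransGen.head (b := m) ⟨hm, fun r hr => ?_⟩ ?_
        · exact ih y (hL y (by simp)) (fun x hx => hws x (by simp [hx])) U m hU hm
            (fun u hu => hgrid u (hu.trans (List.prefix_append _ _))) hmy r hr t
        · refine ihL m hm (fun z hz => hL z (by simp [hz]))
            (fun x hx => hws x (List.mem_append_right _ hx)) (fun u hu => ?_) ?_
          · rw [hmy, ← remainder_append]
            exact hgrid (y ++ u) ((List.prefix_append_right_inj _).2 hu)
          · rw [hmy, ← remainder_append, hUV]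
    obtain ⟨n, hn, f, rfl, rfl, hf⟩ := exists_short_path hU hRM hpath
    exact gameValue_star hM hK (fun _ a => Nat.beq_refl a) hRM (fun a b h => h.2) K n
      (by omega) f hf hU r hr

end Game

/-! ### Deciding the constrained problem in polynomial space -/

section
variable {α : Type} [Coded α]

@[fun_prop]
theorem pspace_regexMove {K d : α → ℕ} {p : α → RegexPosition} (hK : PSpace K) (hp : PSpace p)
    (hd : PSpace d) : PSpace fun x => regexMove (K x) (p x) (d x) := by
  unfold regexMove
  fun_prop

@[fun_prop]
theorem pspace_letterEq {lam c : α → RatCode} {D Z U V : α → ℕ} (hlam : PSpace lam)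
    (hc : PSpace c) (hD : PSpace D) (hZ : PSpace Z) (hU : PSpace U) (hV : PSpace V) :
    PSpace fun x => letterEq (lam x) (c x) (D x) (Z x) (U x) (V x) := by
  unfold letterEq
  fun_prop

@[fun_prop]
theorem pspace_regexLeaf {W : α → List InputSymbol} {lam : α → RatCode} {D Z : α → ℕ}
    {p : α → RegexPosition} (hW : PSpace W) (hlam : PSpace lam) (hD : PSpace D) (hZ : PSpace Z)
    (hp : PSpace p) : PSpace fun x => regexLeaf (W x) (lam x) (D x) (Z x) (p x) := by
  unfold regexLeaf
  fun_prop

end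

theorem tail_suffix_of_suffix_or {s E : List InputSymbol} (h : s <:+ E ∨ s = [.eps]) :
    s.tail <:+ E := by
  rcases h with h | rfl
  · exact (List.tail_suffix _).trans h
  · exact List.nil_suffix

/-- The positions of the game stay small. -/
theorem regexMove_invariant {E : List InputSymbol} {K N d : ℕ} (hd : d / 2 ≤ N) (hK : K ≤ N)
    {p : RegexPosition}
    (h : (p.1 <:+ E ∨ p.1 = [.eps]) ∧ p.2.1 ≤ N ∧ p.2.2.1 ≤ N ∧ p.2.2.2 ≤ N) :
    ((regexMove K p d).1 <:+ E ∨ (regexMove K p d).1 = [.eps]) ∧ (regexMove K p d).2.1 ≤ N ∧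
      (regexMove K p d).2.2.1 ≤ N ∧ (regexMove K p d).2.2.2 ≤ N := by
  obtain ⟨s, k, U, V⟩ := p
  obtain ⟨h1, h2, h3, h4⟩ := h
  have ht := tail_suffix_of_suffix_or h1
  have hs : skipRegex s.tail <:+ E := (skipRegex_suffix _).trans ht
  unfold regexMove
  dsimp only at *
  cases isPlus (headSymbol s)
  · cases isComp (headSymbol s)
    · cases isStar (headSymbol s)
      · exact ⟨h1, h2, h3, h4⟩
      · cases Nat.beq k 0
        · cases Nat.beq (d % 2) 0
          · exact ⟨h1, (Nat.sub_le _ _).trans h2, hd, h4⟩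
          · exact ⟨h1, (Nat.sub_le _ _).trans h2, h3, hd⟩
        · cases Nat.beq (d / 2) 0
          · exact ⟨Or.inl ht, hK, h3, h4⟩
          · exact ⟨Or.inr rfl, h2, h3, h4⟩
    · cases Nat.beq (d % 2) 0
      · exact ⟨Or.inl hs, h2, hd, h4⟩
      · exact ⟨Or.inl ht, h2, h3, hd⟩
  · cases Nat.beq (d / 2) 0
    · exact ⟨Or.inl hs, h2, h3, h4⟩
    · exact ⟨Or.inl ht, h2, h3, h4⟩

theorem mag_positionAfter_regexMove {E : List InputSymbol} {K M N : ℕ} (hM : 0 < M) (hMN : M ≤ N)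
    (hK : K ≤ N) {p : RegexPosition}
    (h : (p.1 <:+ E ∨ p.1 = [.eps]) ∧ p.2.1 ≤ N ∧ p.2.2.1 ≤ N ∧ p.2.2.2 ≤ N) (i c : ℕ) :
    mag (positionAfter (2 * M) (regexMove K) p i c) ≤ max (max (mag E) 9) N := by
  have key : ∀ i c, let p' := positionAfter (2 * M) (regexMove K) p i c
      (p'.1 <:+ E ∨ p'.1 = [.eps]) ∧ p'.2.1 ≤ N ∧ p'.2.2.1 ≤ N ∧ p'.2.2.2 ≤ N := by
    intro i
    induction i with
    | zero => exact fun _ => h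
    | succ i ih =>
      intro c
      have hd : c % (2 * M) < 2 * M := Nat.mod_lt _ (by omega)
      exact regexMove_invariant (by omega) hK (ih _)
  obtain ⟨h1, h2, h3, h4⟩ := key i c
  rw [mag_prod, mag_prod, mag_prod, mag_nat, mag_nat, mag_nat]
  have : mag (positionAfter (2 * M) (regexMove K) p i c).1 ≤ max (mag E) 9 := by
    rcases h1 with h1 | h1
    · exact (mag_symbols_le_of_suffix h1).trans (le_max_left _ _)
    · rw [h1, mag_symbols]
      exact le_max_right _ _
  exact max_le_max this (max_le h2 (max_le h3 h4))

/-- The presentation of the discount factor of an instance. -/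
def discCode (l : List InputSymbol) : RatCode := (readRat l).1

/-- The presentation of the target of an instance. -/
def targetCode (l : List InputSymbol) : RatCode := (readRat (readRat l).2).1

/-- The part of an instance that consists of the weights and the constraint. -/
def weightsWord (l : List InputSymbol) : List InputSymbol := (readRat (readRat l).2).2

@[fun_prop] theorem pspace_discCode {α : Type} [Coded α] {f : α → List InputSymbol}
    (hf : PSpace f) : PSpace fun x => discCode (f x) := by unfold discCode; fun_prop

@[fun_prop] theorem pspace_targetCode {α : Type} [Coded α] {f : α → List InputSymbol}
    (hf : PSpace f) : PSpace fun x => targetCode (f x) := by unfold targetCode; fun_prop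

@[fun_prop] theorem pspace_weightsWord {α : Type} [Coded α] {f : α → List InputSymbol}
    (hf : PSpace f) : PSpace fun x => weightsWord (f x) := by unfold weightsWord; fun_prop

theorem weightsWord_suffix (l : List InputSymbol) : weightsWord l <:+ l :=
  (readRat_suffix _).trans (readRat_suffix _)

/-- Whether `U` presents the number with presentation `c`. -/
def targetEq (c : RatCode) (D Z U : ℕ) : Bool :=
  Nat.beq (c.2.2 * U + bif c.1 then D * c.2.1 else 0) (c.2.2 * Z + bif c.1 then 0 else D * c.2.1)

theorem targetEq_iff {D : ℕ} (hD : 0 < D) (x : ℚ) (Z U : ℕ) :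
    targetEq (ratCode x) D Z U = true ↔ gridVal D Z U = x := by
  have hD' : (D : ℚ) ≠ 0 := by positivity
  have hx := eq_of_ratCode x
  have hd : ((ratCode x).2.2 : ℚ) ≠ 0 := by exact_mod_cast x.den_nz
  generalize ratCode x = y at *
  obtain ⟨s, n, d⟩ := y
  dsimp only at *
  rw [targetEq, Nat.beq_eq, hx, gridVal]
  rw [← Nat.cast_inj (R := ℚ)]
  cases s
  · simp only [cond_false]
    push_cast
    field_simp
    constructor <;> intro h <;> linear_combination h
  · simp only [cond_true]
    push_cast
    field_simp
    constructor <;> intro h <;> linear_combination h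

@[fun_prop]
theorem pspace_targetEq {α : Type} [Coded α] {c : α → RatCode} {D Z U : α → ℕ} (hc : PSpace c)
    (hD : PSpace D) (hZ : PSpace Z) (hU : PSpace U) :
    PSpace fun x => targetEq (c x) (D x) (Z x) (U x) := by
  unfold targetEq
  fun_prop

/-- The numbers on the grid have this many bits: the common denominator, the largest weight and the
denominator of the discount factor, which bounds `1 / (1 - lam)`, each have at most as many bits as
the instance, and one more bit is needed for each of strictness and the sign. -/
def gridBits (l : List InputSymbol) : ℕ := 3 * l.length + 2

/-- The number that presents `0`. -/
def gridZero (l : List InputSymbol) : ℕ := 2 ^ (3 * l.length + 1)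

section
variable {α : Type} [Coded α] {f : α → List InputSymbol}

theorem polyLength_length (hf : PSpace f) : PolyLength fun x => (f x).length :=
  length_symbols_polyLength.comp hf.polyBits

theorem polyLength_gridBits (hf : PSpace f) : PolyLength fun x => gridBits (f x) :=
  ((PolyLength.const 3).mul (polyLength_length hf)).add (PolyLength.const 2)

@[fun_prop]
theorem pspace_gridBits (hf : PSpace f) : PSpace fun x => gridBits (f x) := by
  unfold gridBits
  fun_prop

@[fun_prop]
theorem pspace_gridZero (hf : PSpace f) : PSpace fun x => gridZero (f x) :=
  (PSpace.const 2).pow (g := fun x => 3 * (f x).length + 1) (by fun_prop)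
    (((PolyLength.const 3).mul (polyLength_length hf)).add (PolyLength.const 1))

@[fun_prop]
theorem pspace_two_pow_gridBits (hf : PSpace f) : PSpace fun x => 2 ^ gridBits (f x) :=
  (PSpace.const 2).pow (by fun_prop) (polyLength_gridBits hf)

end

theorem two_pow_gridBits (l : List InputSymbol) : 2 ^ gridBits l = 2 * gridZero l := by
  rw [gridBits, gridZero, pow_succ, mul_comm]

/-- Whether the first player wins the game for the instance `l` on the grid of the multiples of
`1 / D`, beginning with the remainder presented by `U` and ending with the remainder `0`. -/
def gridGame (l : List InputSymbol) (D U : ℕ) : Bool :=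
  gameValue (2 ^ gridBits l) (regexMove (gridBits l))
    (regexLeaf (weightsWord l) (discCode l) D (gridZero l)) (l.length * (gridBits l + 1))
    (afterHash (weightsWord l), gridBits l, U, gridZero l)

theorem pspace_gridGame : PSpace fun x : (List InputSymbol × ℕ) × ℕ =>
    gridGame x.1.1 x.1.2 x.2 := by
  have hl : PSpace fun x : (List InputSymbol × ℕ) × ℕ => x.1.1 := by fun_prop
  have hM : PSpace fun x : (List InputSymbol × ℕ) × ℕ => 2 ^ gridBits x.1.1 :=
    pspace_two_pow_gridBits hl
  have hR : PSpace fun x : (List InputSymbol × ℕ) × ℕ => x.1.1.length * (gridBits x.1.1 + 1) := by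
    fun_prop
  have hp : PSpace fun x : (List InputSymbol × ℕ) × ℕ =>
      (afterHash (weightsWord x.1.1), gridBits x.1.1, x.2, gridZero x.1.1) := by fun_prop
  have hg : PSpace fun y : ((List InputSymbol × ℕ) × ℕ) × RegexPosition × ℕ =>
      regexMove (gridBits y.1.1.1) y.2.1 y.2.2 := by fun_prop
  have hleaf : PSpace fun y : ((List InputSymbol × ℕ) × ℕ) × RegexPosition =>
      regexLeaf (weightsWord y.1.1.1) (discCode y.1.1.1) y.1.1.2 (gridZero y.1.1.1) y.2 := by
    fun_prop
  have hRl : PolyLength fun x : (List InputSymbol × ℕ) × ℕ =>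
      x.1.1.length * (gridBits x.1.1 + 1) :=
    (polyLength_length hl).mul ((polyLength_gridBits hl).add (PolyLength.const 1))
  have hG : PolyBits fun x : (List InputSymbol × ℕ) × ℕ =>
      max (max (mag x) 9) (max (2 ^ gridBits x.1.1) (mag x)) :=
    (PolyBits.mag.max (PolyBits.const 9)).max
      ((hM.polyBits.of_le fun _ => (mag_nat _).ge).max PolyBits.mag)
  refine PSpace.gameValue (g := fun x : (List InputSymbol × ℕ) × ℕ => regexMove (gridBits x.1.1))
    (fin := fun x => regexLeaf (weightsWord x.1.1) (discCode x.1.1) x.1.2 (gridZero x.1.1))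
    hM hR hp hg hleaf (fun x => by positivity) hRl hG fun x i _ c => ?_
  have hE : mag (afterHash (weightsWord x.1.1)) ≤ mag x := by
    have h1 := mag_symbols_le_of_suffix ((afterHash_suffix _).trans (weightsWord_suffix x.1.1))
    rw [mag_prod x, mag_prod x.1]
    exact h1.trans (le_max_left _ _ |>.trans (le_max_left _ _))
  refine (mag_positionAfter_regexMove (N := max (2 ^ gridBits x.1.1) (mag x)) (by positivity)
    (le_max_left _ _) (Nat.lt_two_pow_self.le.trans (le_max_left _ _))
    ⟨Or.inl List.suffix_rfl, ?_, ?_, ?_⟩ i c).trans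
    (max_le_max (max_le_max hE le_rfl) le_rfl)
  · exact Nat.lt_two_pow_self.le.trans (le_max_left _ _)
  · rw [mag_prod x, mag_nat]
    exact (le_max_right _ _).trans (le_max_right _ _)
  · refine le_trans ?_ (le_max_left _ _)
    rw [two_pow_gridBits]
    exact Nat.le_mul_of_pos_left _ two_pos

/-- Whether an instance of the constrained problem has a solution: the numbers on which the game
is played are guessed. -/
def decideCGTDSF (l : List InputSymbol) : Bool :=
  decide (∃ D < 2 ^ gridBits l, decide (∃ U < 2 ^ gridBits l,
    (Nat.ble 1 D && (targetEq (targetCode l) D (gridZero l) U && gridGame l D U)) = true) = true)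

theorem pspace_decideCGTDSF : PSpace decideCGTDSF := by
  have h1 : PSpace fun x : (List InputSymbol × ℕ) × ℕ => Nat.ble 1 x.1.2 &&
      (targetEq (targetCode x.1.1) x.1.2 (gridZero x.1.1) x.2 && gridGame x.1.1 x.1.2 x.2) := by
    have h2 : PSpace fun x : (List InputSymbol × ℕ) × ℕ =>
      Nat.ble 1 x.1.2 && targetEq (targetCode x.1.1) x.1.2 (gridZero x.1.1) x.2 := by fun_prop
    exact (h2.and pspace_gridGame).congr fun x => Bool.and_assoc _ _ _
  have h3 : PSpace fun x : List InputSymbol × ℕ => 2 ^ gridBits x.1 := by fun_prop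
  have h4 := PSpace.exists_lt (α := List InputSymbol × ℕ) (p := fun x U => Nat.ble 1 x.2 &&
      (targetEq (targetCode x.1) x.2 (gridZero x.1) U && gridGame x.1 x.2 U)) h3 h1
  exact PSpace.exists_lt (p := fun l D => decide (∃ U < 2 ^ gridBits l,
    (Nat.ble 1 D && (targetEq (targetCode l) D (gridZero l) U && gridGame l D U)) = true))
    (pspace_two_pow_gridBits PSpace.id) h4

/-! ### The grid of an instance -/

theorem length_encodeNat (n : ℕ) : (encodeNat n).length = Nat.size n := by
  rw [encodeNat, List.length_map, Nat.size_eq_bits_len]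

theorem size_den_le (x : ℚ) : Nat.size x.den ≤ (encodeRat x).length := by
  have := length_encodeNat x.den
  simp only [encodeRat, List.length_append]
  omega

theorem size_num_le (x : ℚ) : Nat.size x.num.natAbs ≤ (encodeRat x).length := by
  have := length_encodeNat x.num.natAbs
  simp only [encodeRat, List.length_append]
  omega

theorem den_le_two_pow (x : ℚ) : x.den ≤ 2 ^ (encodeRat x).length :=
  (Nat.lt_size_self _).le.trans (Nat.pow_le_pow_right two_pos (size_den_le x))

theorem abs_le_two_pow (x : ℚ) : |x| ≤ 2 ^ (encodeRat x).length := by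
  have h1 : x.num.natAbs ≤ 2 ^ (encodeRat x).length :=
    (Nat.lt_size_self _).le.trans (Nat.pow_le_pow_right two_pos (size_num_le x))
  have h2 : |x| ≤ (x.num.natAbs : ℚ) := by
    rw [Nat.cast_natAbs, Int.cast_abs]
    conv_lhs => rw [← Rat.num_div_den x]
    rw [abs_div]
    refine div_le_self (abs_nonneg _) ?_
    rw [Nat.abs_cast]
    exact_mod_cast x.den_pos
  exact h2.trans (by exact_mod_cast h1)

theorem prod_den_le_two_pow (ws : List ℚ) :
    (ws.map Rat.den).prod ≤ 2 ^ (ws.flatMap encodeRat).length := by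
  induction ws with
  | nil => simp
  | cons x ws ih =>
    rw [List.map_cons, List.prod_cons, List.flatMap_cons, List.length_append, pow_add]
    exact Nat.mul_le_mul (den_le_two_pow x) ih

theorem abs_le_two_pow_of_mem {ws : List ℚ} {x : ℚ} (hx : x ∈ ws) :
    |x| ≤ 2 ^ (ws.flatMap encodeRat).length := by
  refine (abs_le_two_pow x).trans (pow_le_pow_right₀ (by norm_num) ?_)
  rw [List.length_flatMap]
  exact List.single_le_sum (by simp) _ (List.mem_map_of_mem hx)

theorem exists_int_of_dvd {x : ℚ} {m : ℕ} (h : x.den ∣ m) : ∃ z : ℤ, m * x = z := by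
  obtain ⟨k, rfl⟩ := h
  refine ⟨k * x.num, ?_⟩
  push_cast
  rw [← Rat.den_mul_eq_num x]
  ring

theorem hash_not_mem_encodeRat (x : ℚ) : InputSymbol.hash ∉ encodeRat x := by
  unfold encodeRat encodeNat
  split_ifs <;> simp

theorem discCode_encode (P : CGTDSF) : discCode P.encode = ratCode P.disc := by
  simp only [discCode, CGTDSF.encode, GTDSF.encode, List.append_assoc, readRat_encodeRat]

theorem targetCode_encode (P : CGTDSF) : targetCode P.encode = ratCode P.target := by
  simp only [targetCode, CGTDSF.encode, GTDSF.encode, List.append_assoc, readRat_encodeRat]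

theorem weightsWord_encode (P : CGTDSF) : weightsWord P.encode =
    P.weights.flatMap encodeRat ++ .hash :: encodeRegex P.constraint := by
  simp only [weightsWord, CGTDSF.encode, GTDSF.encode, List.append_assoc, readRat_encodeRat]
  rfl

theorem afterHash_weightsWord_encode (P : CGTDSF) :
    afterHash (weightsWord P.encode) = encodeRegex P.constraint := by
  rw [weightsWord_encode, afterHash_append]
  rintro s hs rfl
  obtain ⟨x, -, hx⟩ := List.mem_flatMap.1 hs
  exact hash_not_mem_encodeRat x hx

theorem memWeights_encode (P : CGTDSF) (x : ℚ) :
    memWeights (weightsWord P.encode) (ratCode x) = true ↔ x ∈ P.weights := by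
  rw [weightsWord_encode, memWeights_flatMap]
  exact ⟨fun ⟨y, hy, h⟩ => ratCode_injective h ▸ hy, fun h => ⟨x, h, rfl⟩⟩

theorem gridVal_gridZero (D : ℕ) (l : List InputSymbol) :
    gridVal D (gridZero l) (gridZero l) = 0 := by
  simp [gridVal]

/-- The intermediate remainders of a solution lie on a grid of the guessed form. -/
theorem exists_grid (P : CGTDSF) {w : List ℚ} (hw : P.IsSolution w) :
    ∃ D, 0 < D ∧ D < 2 ^ gridBits P.encode ∧ ∀ v, v <+: w → ∃ U < 2 ^ gridBits P.encode,
      gridVal D (gridZero P.encode) U = remainder P.disc P.target v := by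
  obtain ⟨⟨hws, hsum⟩, -⟩ := hw
  set m := (P.weights.map Rat.den).prod with hm
  set n := P.encode.length with hn
  have hm0 : 0 < m := List.prod_pos fun d hd => by
    obtain ⟨x, -, rfl⟩ := List.mem_map.1 hd
    exact x.den_pos
  have hlen : (encodeRat P.disc).length + (encodeRat P.target).length +
      (P.weights.flatMap encodeRat).length ≤ n := by
    simp only [hn, CGTDSF.encode, GTDSF.encode, List.length_append]
    omega
  have hDn : P.target.den * m ≤ 2 ^ n := by
    refine (Nat.mul_le_mul (den_le_two_pow _) (prod_den_le_two_pow _)).trans ?_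
    rw [← pow_add]
    exact Nat.pow_le_pow_right two_pos (by omega)
  have hD0 : 0 < P.target.den * m := Nat.mul_pos P.target.den_pos hm0
  have hint : ∀ x ∈ w, ∃ z : ℤ, m * x = z := fun x hx =>
    exists_int_of_dvd (List.dvd_prod (List.mem_map_of_mem (hws x hx)))
  have hA : ∀ x ∈ w, |x| ≤ 2 ^ n := fun x hx => (abs_le_two_pow_of_mem (hws x hx)).trans
    (pow_le_pow_right₀ (by norm_num) (by omega))
  -- the gap between the discount factor and `1` is at least the inverse of its denominator
  have hgap : 1 ≤ (1 - P.disc) * 2 ^ n := by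
    have h1 : P.disc * P.disc.den = P.disc.num := Rat.mul_den_eq_num _
    have h2 : P.disc.num + 1 ≤ P.disc.den := by
      have h6 : (P.disc.num : ℚ) < P.disc.den := by
        rw [← h1]
        exact mul_lt_of_lt_one_left (by exact_mod_cast P.disc.den_pos) P.disc_lt_one
      exact_mod_cast h6
    have h3 : ((P.disc.den : ℕ) : ℚ) ≤ 2 ^ n := by
      have := (den_le_two_pow P.disc).trans (Nat.pow_le_pow_right two_pos (by omega : _ ≤ n))
      exact_mod_cast this
    have h4 : (P.disc.num : ℚ) + 1 ≤ P.disc.den := by exact_mod_cast h2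
    have h5 := P.disc_lt_one
    nlinarith
  refine ⟨P.target.den * m, hD0, ?_, fun v hv => ?_⟩
  · refine hDn.trans_lt (Nat.pow_lt_pow_right one_lt_two ?_)
    rw [gridBits]
    omega
  obtain ⟨u, rfl⟩ := hv
  have hr0 : remainder P.disc P.target (v ++ u) = 0 :=
    (remainder_eq_zero_iff P.disc_pos.ne' _ _).2 hsum
  obtain ⟨z, hz⟩ := exists_int_mul_remainder P.disc_pos v u hm0
    ⟨P.target.num, Rat.den_mul_eq_num _⟩ hint hr0
  rw [remainder_append, remainder_eq_zero_iff P.disc_pos.ne'] at hr0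
  have habs : |remainder P.disc P.target v| ≤ 2 ^ n * 2 ^ n := by
    have h1 := abs_discountedSum_mul_le P.disc_pos P.disc_lt_one u
      (fun x hx => hA x (List.mem_append_right _ hx))
    rw [hr0] at h1
    have h2 : (0 : ℚ) ≤ P.disc ^ u.length := pow_nonneg P.disc_pos.le _
    have h3 : (0 : ℚ) < 2 ^ n := by positivity
    have h4 : |remainder P.disc P.target v| * (1 - P.disc) ≤ 2 ^ n := by nlinarith
    calc |remainder P.disc P.target v|
        ≤ |remainder P.disc P.target v| * ((1 - P.disc) * 2 ^ n) :=
          le_mul_of_one_le_right (abs_nonneg _) hgap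
      _ = |remainder P.disc P.target v| * (1 - P.disc) * 2 ^ n := by ring
      _ ≤ 2 ^ n * 2 ^ n := mul_le_mul_of_nonneg_right h4 h3.le
  have hzabs : |z| < (gridZero P.encode : ℤ) := by
    have h1 : |(z : ℚ)| ≤ 2 ^ n * (2 ^ n * 2 ^ n) := by
      rw [← hz, abs_mul]
      refine mul_le_mul ?_ habs (abs_nonneg _) (by positivity)
      rw [← Nat.cast_mul, Nat.abs_cast]
      exact_mod_cast hDn
    have h2 : |z| ≤ ((2 ^ n * (2 ^ n * 2 ^ n) : ℕ) : ℤ) := by exact_mod_cast h1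
    refine h2.trans_lt ?_
    rw [gridZero, ← pow_add, ← pow_add, Nat.cast_lt]
    exact Nat.pow_lt_pow_right one_lt_two (by omega)
  rw [abs_lt] at hzabs
  refine ⟨(z + gridZero P.encode).toNat, ?_, ?_⟩
  · rw [two_pow_gridBits]
    omega
  · have h1 : (((z + gridZero P.encode).toNat : ℕ) : ℚ) = z + gridZero P.encode := by
      have : (((z + gridZero P.encode).toNat : ℕ) : ℤ) = z + gridZero P.encode := by omega
      exact_mod_cast this
    have h2 : ((P.target.den * m : ℕ) : ℚ) ≠ 0 := by exact_mod_cast hD0.ne'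
    rw [gridVal, h1, add_sub_cancel_right, div_eq_iff h2, ← hz]
    push_cast
    ring

/-- The grid provided by a solution is found by guessing; conversely, every guess that leads to a
win yields a solution. -/
theorem decideCGTDSF_encode (P : CGTDSF) :
    decideCGTDSF P.encode = true ↔ ∃ w, P.IsSolution w := by
  simp only [decideCGTDSF, decide_eq_true_iff, Bool.and_eq_true, Nat.ble_eq, targetCode_encode,
    gridGame, discCode_encode, afterHash_weightsWord_encode]
  constructor
  · rintro ⟨D, -, U, -, hD, hU, h⟩
    rw [targetEq_iff hD] at hU
    rw [← List.append_nil (encodeRegex P.constraint)] at h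
    obtain ⟨w, hw, hws, hr⟩ :=
      exists_word_of_gameValue P.disc_pos hD (memWeights_encode P) _ _ _ _ _ _ h
    rw [hU, gridVal_gridZero, remainder_eq_zero_iff P.disc_pos.ne'] at hr
    exact ⟨w, ⟨hws, hr⟩, hw⟩
  · rintro ⟨w, hw⟩
    obtain ⟨D, hD, hDlt, hgrid⟩ := exists_grid P hw
    obtain ⟨⟨hws, hsum⟩, hmem⟩ := hw
    obtain ⟨U, hU, hUt⟩ := hgrid [] List.nil_prefix
    rw [remainder_nil] at hUt
    refine ⟨D, hDlt, U, hU, hD, (targetEq_iff hD _ _ _).2 hUt, ?_⟩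
    rw [← List.append_nil (encodeRegex P.constraint)]
    refine gameValue_of_word P.disc_pos hD (memWeights_encode P) rfl (by rw [gridBits]; omega) _ w
      hmem hws U _ hU ?_ ?_ ?_ _ ?_ []
    · rw [two_pow_gridBits]
      have : 0 < gridZero P.encode := by rw [gridZero]; positivity
      omega
    · rw [hUt]
      exact hgrid
    · rw [hUt, gridVal_gridZero]
      exact ((remainder_eq_zero_iff P.disc_pos.ne' _ _).2 hsum).symm
    · refine (rounds_le _ _).trans (Nat.mul_le_mul_right _ ?_)
      simp only [CGTDSF.encode, List.length_append]
      omega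

/-! ### From programs to machines -/

/-- A problem with a decision function computable in polynomial space is decidable in PSPACE. -/
theorem PSpace.decidableInPSPACE {α : Type} {enc : α → List InputSymbol} {P : α → Prop}
    {f : List InputSymbol → Bool} (hf : PSpace f) (h : ∀ x, f (enc x) = true ↔ P x) :
    DecidableInPSPACE enc P := by
  obtain ⟨c, hc⟩ := hf
  obtain ⟨p, hp⟩ := hc 0
  refine CounterProg.decidableInPSPACE enc P symbolEquiv.symm p
    (fun l => f (l.map symbolEquiv.symm)) ((4 * Polynomial.X + 6) ^ c) (fun l => ?_) fun x => ?_
  · have key := hp [] rfl (l.map symbolEquiv.symm)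
    have hl : (l.map symbolEquiv.symm).map symbolEquiv = l := by simp
    have hcode : code (l.map symbolEquiv.symm) = [CounterProg.numeral l] := by
      show [CounterProg.numeral ((l.map symbolEquiv.symm).map symbolEquiv)] = _
      rw [hl]
    rw [mag_symbols, hl, hcode, List.nil_append] at key
    have hstart : CounterProg.ofList [CounterProg.numeral l] =
        Function.update (fun _ => 0) 0 (CounterProg.numeral l) := by
      funext i
      rcases i with _ | i <;> simp [CounterProg.ofList]
    rw [hstart] at key
    refine ⟨_, key.mono ?_, ?_⟩
    · unfold bitBound
      refine Nat.pow_le_pow_right two_pos ?_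
      simp only [Polynomial.eval_pow, Polynomial.eval_add, Polynomial.eval_mul, Polynomial.eval_X,
        Polynomial.eval_ofNat]
      refine Nat.pow_le_pow_left ?_ c
      have h1 : CounterProg.numeral l < 2 ^ (4 * (l.length + 1)) := by
        rw [pow_mul]
        exact CounterProg.numeral_lt l
      have h2 := Nat.size_le.2 h1
      omega
    · show (f (l.map symbolEquiv.symm)).toNat ≠ 0 ↔ _
      cases f (l.map symbolEquiv.symm) <;> simp
  · rw [← h]
    simp

/-! ### Reductions to the constrained problem -/

theorem mag_symbols_le_pow (l : List InputSymbol) : mag l ≤ 16 ^ (l.length + 1) := by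
  have := (CounterProg.numeral_lt (l.map symbolEquiv)).le
  rwa [List.length_map, ← mag_symbols] at this

namespace PSpace
variable {α β : Type} [Coded α] [Coded β]

theorem symbolsFoldl {l : α → List InputSymbol} {f : α → β} {h : β → InputSymbol → β}
    (hl : PSpace l) (hf : PSpace f) (hh : PSpace fun y : β × InputSymbol => h y.1 y.2) {G : α → ℕ}
    (hG : PolyBits G) (hb : ∀ x, ∀ u, u <+: l x → mag (u.foldl h (f x)) ≤ G x) :
    PSpace fun x => (l x).foldl h (f x) := by
  have hsymm : PSpace fun d : Fin 12 => symbolEquiv.symm d := by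
    have h1 : PSpace fun d : Fin 12 => symbolEquiv (symbolEquiv.symm d) :=
      PSpace.id.congr fun d => (symbolEquiv.apply_symm_apply d).symm
    exact h1
  have key : PSpace fun x => ((l x).map symbolEquiv).foldl
      (fun b d => h b (symbolEquiv.symm d)) (f x) := by
    refine foldl (h := fun _ b d => h b (symbolEquiv.symm d)) (map_symbolEquiv hl) hf ?_ hG
      fun x u hu => ?_
    · have h2 : PSpace fun y : α × β × Fin 12 => (y.2.1, symbolEquiv.symm y.2.2) :=
        prodMk (by fun_prop) (hsymm.comp (by fun_prop))
      exact hh.comp h2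
    · obtain ⟨v, hv, rfl⟩ := List.prefix_map_iff.1 hu
      rw [List.foldl_map]
      simpa using hb x v hv
  exact key.congr fun x => by rw [List.foldl_map]; simp

@[fun_prop]
theorem symbolsReverseAppend {f g : α → List InputSymbol} (hf : PSpace f) (hg : PSpace g) :
    PSpace fun x => (f x).reverse ++ g x := by
  have hfold : ∀ u v : List InputSymbol,
      u.foldl (fun v s => s :: v) v = u.reverse ++ v := fun u => by
    induction u with
    | nil => simp
    | cons s u ih => intro v; rw [List.foldl_cons, ih]; simp
  have key : PSpace fun x => (f x).foldl (fun v s => s :: v) (g x) := by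
    have hG : PolyBits fun x : α => 16 ^ ((f x).length + (g x).length + 1) :=
      (PolyBits.const 16).pow (((polyLength_length hf).add (polyLength_length hg)).add
        (PolyLength.const 1))
    refine symbolsFoldl hf hg (by fun_prop) hG fun x u hu => ?_
    rw [hfold]
    refine (mag_symbols_le_pow _).trans (Nat.pow_le_pow_right (by norm_num) ?_)
    have := hu.length_le
    simp only [List.length_append, List.length_reverse]
    omega
  exact key.congr fun x => hfold _ _

end PSpace

/-- Whether the symbol ends a number. -/
def isSep : InputSymbol → Bool
  | .sep => true
  | _ => false

/-- Inserts the beginning of a further alternative after the end of each number. -/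
def expandSymbol (s : InputSymbol) : List InputSymbol :=
  bif isSep s then [.sep, .plus, .letter] else [s]

/-- Turns an instance without a constraint into an instance whose constraint is the star of the
union of all numbers that occur in the instance, of `0` and of the empty language. -/
def addConstraint (u : List InputSymbol) : List InputSymbol :=
  u ++ .hash :: .star :: .plus :: .letter ::
    (u.flatMap expandSymbol ++ [.slash, .bit true, .sep, .empty])

theorem length_flatMap_expandSymbol (u : List InputSymbol) :
    (u.flatMap expandSymbol).length ≤ 3 * u.length := by
  induction u with
  | nil => simp
  | cons s u ih =>
    have : (expandSymbol s).length ≤ 3 := by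
      unfold expandSymbol
      cases isSep s <;> simp
    rw [List.flatMap_cons, List.length_append, List.length_cons]
    omega

/-- Words are assembled from right to left, reversing them first. -/
theorem pspace_addConstraint : PSpace addConstraint := by
  have hstep : PSpace fun y : List InputSymbol × InputSymbol =>
      bif isSep y.2 then .letter :: .plus :: .sep :: y.1 else y.2 :: y.1 := by
    have : PSpace fun y : List InputSymbol × InputSymbol => isSep y.2 :=
      (PSpace.ofSymbol isSep).comp PSpace.snd
    fun_prop
  have hfold : ∀ u v : List InputSymbol, u.foldl (fun v s =>
      bif isSep s then .letter :: .plus :: .sep :: v else s :: v) v =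
        (u.flatMap expandSymbol).reverse ++ v := fun u => by
    induction u with
    | nil => simp
    | cons s u ih =>
      intro v
      rw [List.foldl_cons, ih, List.flatMap_cons]
      unfold expandSymbol
      cases isSep s <;> simp
  have hrev : PSpace fun u : List InputSymbol => (u.flatMap expandSymbol).reverse := by
    have hG : PolyBits fun u : List InputSymbol => 16 ^ (3 * u.length + 1) :=
      (PolyBits.const 16).pow (((PolyLength.const 3).mul length_symbols_polyLength).add
        (PolyLength.const 1))
    have key : PSpace fun u : List InputSymbol => u.foldl (fun v s =>
        bif isSep s then .letter :: .plus :: .sep :: v else s :: v) [] := by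
      refine PSpace.symbolsFoldl PSpace.id (PSpace.const []) hstep hG fun u v hv => ?_
      rw [hfold]
      refine (mag_symbols_le_pow _).trans (Nat.pow_le_pow_right (by norm_num) ?_)
      have h1 := hv.length_le
      have h2 := length_flatMap_expandSymbol v
      rw [List.append_nil, List.length_reverse]
      omega
    exact key.congr fun u => by rw [hfold, List.append_nil]
  have hself : PSpace fun u : List InputSymbol => u.reverse :=
    (PSpace.symbolsReverseAppend PSpace.id (PSpace.const [])).congr fun u => List.append_nil _
  have h1 : PSpace fun u : List InputSymbol => (u.flatMap expandSymbol).reverse.reverse ++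
      [.slash, .bit true, .sep, .empty] := PSpace.symbolsReverseAppend hrev (PSpace.const _)
  have h2 : PSpace fun u : List InputSymbol => u.reverse.reverse ++
      .hash :: .star :: .plus :: .letter :: ((u.flatMap expandSymbol).reverse.reverse ++
        [.slash, .bit true, .sep, .empty]) :=
    PSpace.symbolsReverseAppend hself (by fun_prop)
  exact h2.congr fun u => by rw [List.reverse_reverse, List.reverse_reverse]; rfl

/-- The union of the numbers of a list, of `0` and of the empty language. -/
def sumRegex : List ℚ → RegularExpression ℚ
  | [] => .plus (.char 0) .zero
  | x :: l => .plus (.char x) (sumRegex l)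

theorem mem_sumRegex {x : ℚ} {l : List ℚ} (h : x ∈ l) : [x] ∈ (sumRegex l).matches' := by
  induction l with
  | nil => simp at h
  | cons y l ih =>
    rcases List.mem_cons.1 h with rfl | h
    · exact Or.inl rfl
    · exact Or.inr (ih h)

theorem flatMap_expandSymbol_encodeRat (x : ℚ) :
    (encodeRat x).flatMap expandSymbol = encodeRat x ++ [.plus, .letter] := by
  have h : ∀ u : List InputSymbol, .sep ∉ u → u.flatMap expandSymbol = u := by
    intro u hu
    induction u with
    | nil => rfl
    | cons s u ih =>
      have hs : isSep s = false := by
        cases s <;> simp_all [isSep]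
      rw [List.flatMap_cons, ih fun h => hu (by simp [h]), expandSymbol, hs]
      rfl
  obtain ⟨u, hu, hx⟩ : ∃ u, .sep ∉ u ∧ encodeRat x = u ++ [.sep] := by
    refine ⟨_, ?_, rfl⟩
    unfold encodeNat
    split_ifs <;> simp
  rw [hx, List.flatMap_append, h u hu, List.append_assoc]
  rfl

theorem encodeRegex_sumRegex (l : List ℚ) : encodeRegex (sumRegex l) =
    .plus :: .letter :: ((l.flatMap encodeRat).flatMap expandSymbol ++
      [.slash, .bit true, .sep, .empty]) := by
  induction l with
  | nil => simp [sumRegex, encodeRegex, encodeRat, encodeNat]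
  | cons x l ih =>
    rw [sumRegex, encodeRegex, ih, encodeRegex, List.flatMap_cons, List.flatMap_append,
      flatMap_expandSymbol_encodeRat]
    simp

/-- The instance of the constrained problem in which every word over the weights is allowed. The
constraint also mentions the discount factor, the target and `0`, which does no harm, as solutions
consist of weights. -/
def GTDSF.toCGTDSF (P : GTDSF) : CGTDSF :=
  { P with constraint := .star (sumRegex (P.disc :: P.target :: P.weights)) }

theorem GTDSF.encode_toCGTDSF (P : GTDSF) : P.toCGTDSF.encode = addConstraint P.encode := by
  have h : P.encode = (P.disc :: P.target :: P.weights).flatMap encodeRat := by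
    simp [GTDSF.encode]
  rw [addConstraint, CGTDSF.encode]
  show P.encode ++ [.hash] ++ encodeRegex (.star (sumRegex (P.disc :: P.target :: P.weights))) = _
  rw [encodeRegex, encodeRegex_sumRegex, ← h]
  simp

theorem GTDSF.isSolution_toCGTDSF (P : GTDSF) (w : List ℚ) :
    P.toCGTDSF.IsSolution w ↔ P.IsSolution w := by
  refine ⟨fun h => h.1, fun h => ⟨h, ?_⟩⟩
  refine Language.mem_kstar.2 ⟨w.map fun x => [x], by simp [← List.flatMap_def], ?_⟩
  intro y hy
  obtain ⟨x, hx, rfl⟩ := List.mem_map.1 hy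
  exact mem_sumRegex (by simp [h.1 x hx])

/-- The instance of the generalized problem with two weights. -/
def TDSF.toGTDSF (P : TDSF) : GTDSF where
  disc := P.disc
  disc_pos := P.disc_pos
  disc_lt_one := P.disc_lt_one
  target := P.target
  weights := [P.a, P.b]

theorem TDSF.encode_toGTDSF (P : TDSF) : P.toGTDSF.encode = P.encode := by
  simp [GTDSF.encode, TDSF.encode, TDSF.toGTDSF]

theorem TDSF.isSolution_toGTDSF (P : TDSF) (w : List ℚ) :
    P.toGTDSF.IsSolution w ↔ P.IsSolution w := by
  simp [GTDSF.IsSolution, TDSF.IsSolution, TDSF.toGTDSF]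

/-! ### Decidability and length of solutions -/

theorem CGTDSF.decidableInPSPACE :
    DecidableInPSPACE CGTDSF.encode (fun P => ∃ w, P.IsSolution w) :=
  pspace_decideCGTDSF.decidableInPSPACE decideCGTDSF_encode

theorem decide_addConstraint_encode (P : GTDSF) :
    decideCGTDSF (addConstraint P.encode) = true ↔ ∃ w, P.IsSolution w := by
  rw [← P.encode_toCGTDSF, decideCGTDSF_encode]
  simp only [P.isSolution_toCGTDSF]

theorem GTDSF.decidableInPSPACE :
    DecidableInPSPACE GTDSF.encode (fun P => ∃ w, P.IsSolution w) :=
  (pspace_decideCGTDSF.comp pspace_addConstraint).decidableInPSPACE decide_addConstraint_encode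

theorem TDSF.decidableInPSPACE :
    DecidableInPSPACE TDSF.encode (fun P => ∃ w, P.IsSolution w) :=
  (pspace_decideCGTDSF.comp pspace_addConstraint).decidableInPSPACE fun P => by
    rw [← P.encode_toGTDSF, decide_addConstraint_encode]
    simp only [P.isSolution_toGTDSF]

theorem mainTheorem1 :
    -- the existence of a solution is decidable in PSPACE
    DecidableInPSPACE CGTDSF.encode (fun P => ∃ w, P.IsSolution w) ∧
    DecidableInPSPACE GTDSF.encode (fun P => ∃ w, P.IsSolution w) ∧
    DecidableInPSPACE TDSF.encode (fun P => ∃ w, P.IsSolution w) ∧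
    -- a solution of bounded length, with the constraint `e`
    (∀ (P : CGTDSF) (k : ℕ) (a : Fin (k + 1) → ℚ) (p q : ℕ) (c : ℤ) (d m : ℕ),
      StrictMono a → P.weights = List.ofFn a →
      P.disc = p / q →
      0 < d → P.target = c / d →
      0 < m → (∀ i, ∃ z : ℤ, a i = z / m) →
      (∃ i, a i ≠ 0) →
      (∃ w, P.IsSolution w) →
      ∃ w, P.IsSolution w ∧
        (w.length : ℚ) ≤ 4 * (d * (q - p)) * (regexLength P.constraint + 2) *
          max |a (Fin.last k)| |a 0| * (P.disc * m / (1 - P.disc))) ∧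
    -- a solution of bounded length, without a constraint
    (∀ (P : GTDSF) (k : ℕ) (a : Fin (k + 1) → ℚ) (p q : ℕ) (c : ℤ) (d m : ℕ),
      StrictMono a → P.weights = List.ofFn a →
      P.disc = p / q →
      0 < d → P.target = c / d →
      0 < m → (∀ i, ∃ z : ℤ, a i = z / m) →
      (∃ w, P.IsSolution w) →
      ∃ w, P.IsSolution w ∧
        (w.length : ℚ) ≤ 4 * (d * (q - p)) * 2 *
          max |a (Fin.last k)| |a 0| * (P.disc * m / (1 - P.disc))) :=
  ⟨CGTDSF.decidableInPSPACE, GTDSF.decidableInPSPACE, TDSF.decidableInPSPACE,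
    CGTDSF.exists_short_solution, GTDSF.exists_short_solution⟩
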